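/- Let $\ell>0$ and $a\in\mathbb R$. Let $\mathcal P$ be the set of pairs $(u,\mu)$ such that $u\in H^1_{\mathrm{loc}}(\mathbb R)$ is real-valued and $\ell$-periodic (identified with its continuous representative), $\mu$ is an $\ell$-periodic, locally finite, non-negative Borel measure on $\mathbb R$ with $\mu(B)\ge\int_B u^2+u'^2\,dx$ for all Borel sets $B$, and the topological supports of the distribution $\omega=u-u''$ and of the measure $\upsilon$ defined by $\mu(B)=\upsilon(B)+\int_B u^2+u'^2\,dx$ are discrete. For such a pair $\omega$ is a real-valued measure with discrete support. A solution of $$-f''+\tfrac14 f=z\,\omega f+z^2\upsilon f,\qquad z\in\mathbb C,$$ is a continuous function $f:\mathbb R\to\mathbb C$ with $f''=\tfrac14 f$ off the support of $|\omega|+\upsilon$ and $f'(x-)=f'(x+)+\bigl(z\,\omega(\{x\})+z^2\upsilon(\{x\})\bigr)f(x)$ at each point $x$ of that support; $f'$ is extended to $\mathbb R$ as a left-continuous function. Let $c(z,\cdot)$, $s(z,\cdot)$ be the solutions with $c(z,a)=s'(z,a)=1$ and $c'(z,a)=s(z,a)=0$. The Floquet discriminant of $(u,\mu)$ is $z\mapsto\frac12\bigl(c(z,a+\ell)+s'(z,a+\ell)\bigr)$,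 and its Dirichlet spectrum is the set of all $z\in\mathbb C$ for which there is a nontrivial solution $f$ with $f(a)=f(a+\ell)=0$. Let $\Delta$ be a real polynomial all of whose complex roots are real, non-zero and simple, with $\Delta(0)=\cosh(\ell/2)$, and such that $|\Delta(\lambda)|\ge1$ whenever $\dot\Delta(\lambda)=0$. List the zeros of $\Delta^2-1$ (all real and non-zero) with multiplicities in non-decreasing order as $\lambda_{-2I_-}\le\dots\le\lambda_{-1}<0<\lambda_1\le\dots\le\lambda_{2I_+}$, put $\mathcal I=\{-I_-,\dots,-1\}\cup\{1,\dots,I_+\}$, and define the gaps $$\Gamma_i=\begin{cases}[-\infty,\lambda_{2i}],& i=-I_-,\\ [\lambda_{2i-1},\lambda_{2i}],& -I_-<i\le-1,\\ [\lambda_{2i},\lambda_{2i+1}],& 1\le i<I_+,\\ [\lambda_{2i},\infty],& i=I_+,\end{cases}\qquad i\in\mathcal I.$$ With the convention $\Delta(\pm\infty)=1$, let $$\mathcal T=\prod_{i\in\mathcal I}\mathcal T_i,\qquad \mathcal T_i=\{(z,\zeta)\in\Gamma_i\times\mathbb R:\ \zeta^2=\Delta(z)^2-1\}.$$ Let $\mathrm{Iso}(\Delta)$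 be the set of all pairs in $\mathcal P$ whose Floquet discriminant equals $\Delta$. For $(u,\mu)\in\mathrm{Iso}(\Delta)$ the Dirichlet divisors $\hat\kappa=(\hat\kappa_i)_{i\in\mathcal I}$ are given by $\hat\kappa_i=\bigl(\kappa_i,\Delta(\kappa_i)-s'(\kappa_i,a+\ell)\bigr)$ if $\Gamma_i$ contains a (necessarily unique) Dirichlet eigenvalue $\kappa_i$, and otherwise ($\Gamma_i$ being then $\Gamma_{-I_-}$ or $\Gamma_{I_+}$) by $\hat\kappa_i=(-\infty,0)$ if $i<0$ and $\hat\kappa_i=(\infty,0)$ if $i>0$. Then the map $(u,\mu)\mapsto\hat\kappa$ is a bijection from $\mathrm{Iso}(\Delta)$ onto $\mathcal T$. -/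

import Mathlib

open MeasureTheory Filter Topology Polynomial

noncomputable section

namespace PeriodicPeakon

/-- `H¹_loc(ℝ)`, real-valued, through the continuous representative: locally absolutely continuous
functions whose (almost everywhere defined) derivative is locally square integrable. -/
def MemH1loc (h : ℝ → ℝ) : Prop :=
  ∀ x y : ℝ, AbsolutelyContinuousOnInterval h x y ∧
    MemLp (deriv h) 2 (volume.restrict (Set.Icc x y))

/-- `H¹_c(ℝ)`: compactly supported functions in `H¹_loc(ℝ)`. -/
def MemH1c (h : ℝ → ℝ) : Prop := MemH1loc h ∧ HasCompactSupport h

/-- The measure `B ↦ ∫_B u² + u'² dx`. -/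
def energyMeasure (u : ℝ → ℝ) : Measure ℝ :=
  volume.withDensity fun x => ENNReal.ofReal (u x ^ 2 + deriv u x ^ 2)

/-- The set `𝒟` of pairs `(u, μ)` with period `ℓ`. -/
structure MemD (ℓ : ℝ) (p : (ℝ → ℝ) × Measure ℝ) : Prop where
  periodic_u : Function.Periodic p.1 ℓ
  memH1loc : MemH1loc p.1
  locallyFinite : IsLocallyFiniteMeasure p.2
  periodic_mu : p.2.map (fun x => x + ℓ) = p.2
  energy_le : energyMeasure p.1 ≤ p.2

/-- The distribution `ω = u - u''`. -/
def omega (u h : ℝ → ℝ) : ℝ := (∫ x, u x * h x) + ∫ x, deriv u x * deriv h x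

/-- The measure `υ`, determined by `μ = υ + (u² + u'²) dx`. -/
def upsilon (p : (ℝ → ℝ) × Measure ℝ) : Measure ℝ := p.2 - energyMeasure p.1

theorem upsilon_add_energyMeasure {ℓ : ℝ} {p : (ℝ → ℝ) × Measure ℝ} (hp : MemD ℓ p) :
    p.2 = upsilon p + energyMeasure p.1 := by
  have hlf := hp.locallyFinite
  have key : ∀ n : ℕ, p.2.restrict (Set.Icc (-(n : ℝ)) n) =
      (upsilon p + energyMeasure p.1).restrict (Set.Icc (-(n : ℝ)) n) := by
    intro n
    have hle : (energyMeasure p.1).restrict (Set.Icc (-(n : ℝ)) n) ≤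
        p.2.restrict (Set.Icc (-(n : ℝ)) n) := Measure.restrict_mono le_rfl hp.energy_le
    have hfin' : IsFiniteMeasure (p.2.restrict (Set.Icc (-(n : ℝ)) n)) :=
      isFiniteMeasure_restrict.2 isCompact_Icc.measure_lt_top.ne
    have hfin : IsFiniteMeasure ((energyMeasure p.1).restrict (Set.Icc (-(n : ℝ)) n)) :=
      isFiniteMeasure_of_le _ hle
    rw [Measure.restrict_add, upsilon,
      Measure.restrict_sub_eq_restrict_sub_restrict measurableSet_Icc,
      Measure.sub_add_cancel_of_le hle]
  refine (Measure.ext_iff_of_iUnion_eq_univ (s := fun n : ℕ => Set.Icc (-(n : ℝ)) n) ?_).2 key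
  refine Set.eq_univ_of_forall fun x => Set.mem_iUnion.2 ?_
  obtain ⟨n, hn⟩ := exists_nat_ge |x|
  exact ⟨n, abs_le.1 hn⟩

/-- The topological support of the distribution `ω`. -/
def omegaSupport (u : ℝ → ℝ) : Set ℝ :=
  {x | ∀ U : Set ℝ, IsOpen U → x ∈ U → ∃ h, MemH1c h ∧ tsupport h ⊆ U ∧ omega u h ≠ 0}

/-- The set `𝒫` of pairs in `𝒟` for which the supports of `ω` and `υ` are discrete. -/
structure MemP (ℓ : ℝ) (p : (ℝ → ℝ) × Measure ℝ) : Prop where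
  memD : MemD ℓ p
  discrete_omega : IsDiscrete (omegaSupport p.1)
  discrete_upsilon : IsDiscrete (upsilon p).support

/-- Near the point `x`, the distribution `ω` equals `w` times the Dirac measure at `x`. -/
def IsOmegaMassAt (u : ℝ → ℝ) (x w : ℝ) : Prop :=
  ∃ U : Set ℝ, IsOpen U ∧ x ∈ U ∧ ∀ h, MemH1c h → tsupport h ⊆ U → omega u h = w * h x

/-- The point mass `ω({x})` (for pairs in `𝒫` there is exactly one `w` as below). -/
def omegaMass (u : ℝ → ℝ) (x : ℝ) : ℝ := Classical.epsilon (IsOmegaMassAt u x)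

/-- The point mass `υ({x})`. -/
def upsilonMass (p : (ℝ → ℝ) × Measure ℝ) (x : ℝ) : ℝ := ((upsilon p) {x}).toReal

/-- The support of `|ω| + υ`. -/
def singularSet (p : (ℝ → ℝ) × Measure ℝ) : Set ℝ := omegaSupport p.1 ∪ (upsilon p).support

/-- `f`, with left-continuous derivative `f'`, solves `-f'' + f/4 = z ω f + z² υ f`: the equation
`f'' = f/4` holds off the support of `|ω| + υ`, and at each point `x` of this support the function
`f` is continuous and `f'(x-) = f'(x+) + (z ω({x}) + z² υ({x})) f(x)`. -/
structure IsSolution (p : (ℝ → ℝ) × Measure ℝ) (z : ℂ) (f f' : ℝ → ℂ) : Prop where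
  continuous : Continuous f
  hasDerivAt : ∀ x ∉ singularSet p, HasDerivAt f (f' x) x
  hasDerivAt_deriv : ∀ x ∉ singularSet p, HasDerivAt f' (f x / 4) x
  left_limit : ∀ x ∈ singularSet p, Tendsto f' (𝓝[<] x) (𝓝 (f' x))
  right_limit : ∀ x ∈ singularSet p, Tendsto f' (𝓝[>] x)
    (𝓝 (f' x - (z * omegaMass p.1 x + z ^ 2 * upsilonMass p x) * f x))

/-- The solution `(f, f')` with `f(a) = f₀`, `f'(a) = f₁` (for pairs in `𝒫` there is exactly
one). -/
def ivp (p : (ℝ → ℝ) × Measure ℝ) (a : ℝ) (z f₀ f₁ : ℂ) : ℝ → ℂ × ℂ :=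
  Classical.epsilon fun F : ℝ → ℂ × ℂ =>
    IsSolution p z (fun x => (F x).1) (fun x => (F x).2) ∧ F a = (f₀, f₁)

/-- The monodromy matrix, with the fundamental system `c = ivp 1 0`, `s = ivp 0 1`. -/
def monodromy (ℓ a : ℝ) (p : (ℝ → ℝ) × Measure ℝ) (z : ℂ) : Matrix (Fin 2) (Fin 2) ℂ :=
  !![(ivp p a z 1 0 (a + ℓ)).1, (ivp p a z 0 1 (a + ℓ)).1;
     (ivp p a z 1 0 (a + ℓ)).2, (ivp p a z 0 1 (a + ℓ)).2]

/-- The Floquet discriminant. -/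
def discriminant (ℓ a : ℝ) (p : (ℝ → ℝ) × Measure ℝ) (z : ℂ) : ℂ :=
  (monodromy ℓ a p z).trace / 2

/-- The Dirichlet spectrum on `[a, a + ℓ)`. -/
def dirichletSpectrum (ℓ a : ℝ) (p : (ℝ → ℝ) × Measure ℝ) : Set ℂ :=
  {z | ∃ f f' : ℝ → ℂ, IsSolution p z f f' ∧ f ≠ 0 ∧ f a = 0 ∧ f (a + ℓ) = 0}

/-- The isospectral set. -/
def Iso (ℓ a : ℝ) (Δ : ℝ[X]) : Set ((ℝ → ℝ) × Measure ℝ) :=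
  {p | MemP ℓ p ∧ ∀ z : ℂ, discriminant ℓ a p z = aeval z Δ}

/-- The positive zeros of `Δ² - 1`, with multiplicities. -/
def posRoots (Δ : ℝ[X]) : Multiset ℝ := (Δ ^ 2 - 1).roots.filter (0 < ·)

/-- The negative zeros of `Δ² - 1`, with multiplicities. -/
def negRoots (Δ : ℝ[X]) : Multiset ℝ := (Δ ^ 2 - 1).roots.filter (· < 0)

/-- The number `I₊`; there are `2 I₊` positive zeros of `Δ² - 1`. -/
def numPos (Δ : ℝ[X]) : ℕ := (posRoots Δ).card / 2

/-- The number `I₋`; there are `2 I₋` negative zeros of `Δ² - 1`. -/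
def numNeg (Δ : ℝ[X]) : ℕ := (negRoots Δ).card / 2

/-- The zeros `λ_j` of `Δ² - 1` in non-decreasing order, repeated according to multiplicity:
`λ_1 ≤ λ_2 ≤ …` are the positive ones and `λ_{-1} ≥ λ_{-2} ≥ …` are the negative ones. -/
def lam (Δ : ℝ[X]) (j : ℤ) : ℝ :=
  if 0 < j then ((posRoots Δ).sort (· ≤ ·)).getD (j.toNat - 1) 0
  else ((negRoots Δ).sort (· ≥ ·)).getD ((-j).toNat - 1) 0

/-- The index set `ℐ = {-I₋, …, -1} ∪ {1, …, I₊}`. -/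
abbrev GapIndex (Δ : ℝ[X]) : Type :=
  {i : ℤ // i ≠ 0 ∧ -(numNeg Δ : ℤ) ≤ i ∧ i ≤ (numPos Δ : ℤ)}

/-- The gap `Γ_i`. -/
def gap (Δ : ℝ[X]) (i : GapIndex Δ) : Set EReal :=
  if i.1 = -(numNeg Δ : ℤ) then Set.Icc ⊥ (lam Δ (2 * i.1) : EReal)
  else if i.1 < 0 then Set.Icc (lam Δ (2 * i.1 - 1) : EReal) (lam Δ (2 * i.1) : EReal)
  else if i.1 < (numPos Δ : ℤ) then Set.Icc (lam Δ (2 * i.1) : EReal) (lam Δ (2 * i.1 + 1) : EReal)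
  else Set.Icc (lam Δ (2 * i.1) : EReal) ⊤

/-- Evaluation of `Δ` on the extended reals, with the convention `Δ(±∞) = 1`. -/
def evalExt (Δ : ℝ[X]) (z : EReal) : ℝ := if z = ⊥ ∨ z = ⊤ then 1 else Δ.eval z.toReal

/-- The factor `𝒯_i`. -/
def torusFactor (Δ : ℝ[X]) (i : GapIndex Δ) : Set (EReal × ℝ) :=
  {q | q.1 ∈ gap Δ i ∧ q.2 ^ 2 = evalExt Δ q.1 ^ 2 - 1}

/-- The torus `𝒯 = ∏ 𝒯_i`. -/
def torus (Δ : ℝ[X]) : Set (GapIndex Δ → EReal × ℝ) := Set.univ.pi (torusFactor Δ)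

open Classical in
/-- The Dirichlet divisors of a pair with Floquet discriminant `Δ`: the `i`-th one is
`(κ_i, Δ(κ_i) - s'(κ_i, a + ℓ))` if `κ_i` is the Dirichlet eigenvalue in `Γ_i`, and `(±∞, 0)` if
there is no Dirichlet eigenvalue in `Γ_i`. -/
def dirichletDivisors (ℓ a : ℝ) (Δ : ℝ[X]) (p : (ℝ → ℝ) × Measure ℝ) (i : GapIndex Δ) :
    EReal × ℝ :=
  if h : ∃ κ : ℝ, (κ : EReal) ∈ gap Δ i ∧ (κ : ℂ) ∈ dirichletSpectrum ℓ a p then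
    (((h.choose : ℝ) : EReal), Δ.eval h.choose - (ivp p a (h.choose : ℂ) 0 1 (a + ℓ)).2.re)
  else (if i.1 < 0 then ⊥ else ⊤, 0)

end PeriodicPeakon

end

noncomputable section

namespace PeriodicPeakon

/-! Put b = a + ℓ. A mass at a does not influence s, because s(a) = 0, so s(z, b) and s'(z, b) are
polynomials in z determined by the masses inside (a, b). Dividing by 2 sinh((x - a)/2), the solution
at z = 0 that vanishes at a, turns the equation into that of a string (`transP_kickP_ofNormalized`).
The outcome is s(z, b) = 2 sinh(ℓ/2) g(z), and s' = κ r(κ) / (2 sinh(ℓ/2)) at a zero κ of g, where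
g(0) = 1 and -r/g is a rational Nevanlinna function vanishing at infinity. Such pairs (g, r)
correspond bijectively to finite chains of masses in (a, b), by expansion of -r/g into a Stieltjes
continued fraction (`exists_chain`, `chain_unique`). The interior masses are therefore encoded by
the Dirichlet eigenvalues, which are the zeros of g and fix g through g(0) = 1, together with the
values s'(κ, b), which fix r by interpolation.

At an eigenvalue the Wronskian gives c s' = 1, while c + s' = 2Δ. Hence (Δ - s')² = Δ² - 1:
eigenvalues lie where |Δ| ≥ 1, the divisor satisfies the equation of the torus, and the divisor
gives s' back. A mass (w, v) at a enters the trace only through -(w z + v z²) s, so w and v follow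
from Δ and the interior masses. As 1 - d²/dx² has no periodic kernel, the masses over one period
determine the pair. This is injectivity.

To place the eigenvalues in the gaps, positivity of the residues of r/g gives κ g'(κ) s'(κ) > 0, and
s' has the sign of Δ. So the numbers of zeros of Δ and of g between 0 and κ have different parity.
The bound deg Δ ≤ deg g + 2, with the signs of the leading coefficients in the case of equality,
then forces exactly one more zero of Δ than of g between 0 and κ (`IsoData.card_between`). The
finite points x of Γ_i, in turn, are those with the sign of i, with |i| zeros of Δ between 0 and x,
and with |Δ(x)| ≥ 1 (`IsHillPoly.coe_mem_gap_iff`). So a gap holds at most one eigenvalue, and only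
the two outermost gaps can hold none.

Conversely, given a point of the torus, let g have its finite points as zeros and let r interpolate
the values s' = Δ - ζ. The count of zeros of Δ in the gaps gives the required signs, so (g, r) comes
from a chain. The polynomial c + s' - 2Δ, with c computed without a mass at a, vanishes at the zeros
of g and at 0; its quotient by s is w z + v z², and leading coefficients show v ≥ 0
(`exists_chain_of_eigenvalues`). Periodic Green's functions then produce the pair (`exists_memP`).
-/

/-! ### Polynomial pairs with positive residues (rational Nevanlinna functions) -/

/-- All complex zeros of `A` are real, and `A' B > 0` at each of them. -/
structure NevPair (A B : ℝ[X]) : Prop where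
  im_eq_zero : ∀ z : ℂ, aeval z A = 0 → z.im = 0
  pos : ∀ x : ℝ, A.eval x = 0 → 0 < A.derivative.eval x * B.eval x

theorem aeval_ofReal (A : ℝ[X]) (x : ℝ) : aeval (x : ℂ) A = ((A.eval x : ℝ) : ℂ) := by
  have := aeval_algebraMap_apply ℂ x A
  simpa using this

theorem ne_zero_of_im_eq_zero {A : ℝ[X]} (h : ∀ z : ℂ, aeval z A = 0 → z.im = 0) : A ≠ 0 := by
  rintro rfl
  simpa using h Complex.I (by simp)

theorem splits_of_im_eq_zero {A : ℝ[X]} (h : ∀ z : ℂ, aeval z A = 0 → z.im = 0) : A.Splits := by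
  refine Splits.of_splits_map (algebraMap ℝ ℂ) (IsAlgClosed.splits _) fun z hz => ?_
  have h0 : aeval z A = 0 := by
    have := (mem_roots'.1 hz).2
    rwa [IsRoot, eval_map_algebraMap] at this
  exact ⟨z.re, Complex.ext (by simp) (by simp [h z h0])⟩

/-- A polynomial with only real zeros, all simple, is a product over its set of zeros. -/
theorem eq_C_mul_nodal {A : ℝ[X]} (h : ∀ z : ℂ, aeval z A = 0 → z.im = 0)
    (hs : ∀ x : ℝ, A.eval x = 0 → A.derivative.eval x ≠ 0) :
    A = C A.leadingCoeff * Lagrange.nodal A.roots.toFinset id := by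
  have h0 := ne_zero_of_im_eq_zero h
  have hn : A.roots.Nodup := by
    rw [Multiset.nodup_iff_count_le_one]
    intro x
    rw [count_roots]
    by_contra! hlt
    have hd := (one_lt_rootMultiplicity_iff_isRoot h0).1 hlt
    exact hs x hd.1 hd.2
  conv_lhs => rw [(splits_of_im_eq_zero h).eq_prod_roots]
  congr 1
  rw [Lagrange.nodal, Finset.prod, Multiset.toFinset_val, hn.dedup]
  simp

theorem mem_rootsFinset {A : ℝ[X]} (h0 : A ≠ 0) {x : ℝ} :
    x ∈ A.roots.toFinset ↔ A.eval x = 0 := by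
  simp [h0]

theorem card_roots_eq_natDegree {A : ℝ[X]} (h : ∀ z : ℂ, aeval z A = 0 → z.im = 0)
    (hs : ∀ x : ℝ, A.eval x = 0 → A.derivative.eval x ≠ 0) :
    A.roots.toFinset.card = A.natDegree := by
  have h0 := ne_zero_of_im_eq_zero h
  conv_rhs => rw [eq_C_mul_nodal h hs]
  rw [natDegree_C_mul (leadingCoeff_ne_zero.2 h0), Lagrange.natDegree_nodal]

theorem NevPair.ne_zero {A B : ℝ[X]} (h : NevPair A B) : A ≠ 0 := ne_zero_of_im_eq_zero h.im_eq_zero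

theorem NevPair.simple {A B : ℝ[X]} (h : NevPair A B) (x : ℝ) (hx : A.eval x = 0) :
    A.derivative.eval x ≠ 0 := left_ne_zero_of_mul (h.pos x hx).ne'

theorem NevPair.congr {A B B' : ℝ[X]} (h : NevPair A B)
    (hB : ∀ x : ℝ, A.eval x = 0 → B'.eval x = B.eval x) : NevPair A B' :=
  ⟨h.im_eq_zero, fun x hx => by rw [hB x hx]; exact h.pos x hx⟩

theorem degree_C_mul_le' (c : ℝ) (P : ℝ[X]) : (C c * P).degree ≤ P.degree := by
  rw [← smul_eq_C_mul]; exact degree_smul_le _ _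

/-- Partial fractions of a quotient of polynomials with positive residues. -/
theorem NevPair.partialFractions {A R : ℝ[X]} (h : NevPair A R) (hdeg : R.degree < A.degree) :
    ∃ (ρ : ℝ → ℝ) (Q : ℝ → ℝ[X]), (∀ κ ∈ A.roots.toFinset, 0 < ρ κ ∧ A = (X - C κ) * Q κ ∧
        (Q κ).coeff (A.natDegree - 1) = A.leadingCoeff) ∧
      R = ∑ κ ∈ A.roots.toFinset, C (ρ κ) * Q κ := by
  set K := A.roots.toFinset with hK
  have hA := eq_C_mul_nodal h.im_eq_zero h.simple
  have hcard := card_roots_eq_natDegree h.im_eq_zero h.simple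
  have h0 := h.ne_zero
  let Q : ℝ → ℝ[X] := fun κ => C A.leadingCoeff * Lagrange.nodal (K.erase κ) id
  have hQ : ∀ κ ∈ K, A = (X - C κ) * Q κ := by
    intro κ hκ
    conv_lhs => rw [hA]
    rw [Lagrange.nodal_eq_mul_nodal_erase hκ]
    simp only [Q, id]; ring
  have hQd : ∀ κ ∈ K, (Q κ).eval κ = A.derivative.eval κ := by
    intro κ hκ
    conv_rhs => rw [hQ κ hκ]
    simp
  refine ⟨fun κ => R.eval κ / A.derivative.eval κ, Q, fun κ hκ => ⟨?_, hQ κ hκ, ?_⟩, ?_⟩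
  · have := h.pos κ ((mem_rootsFinset h0).1 hκ)
    simp only [div_eq_mul_inv]
    rcases pos_and_pos_or_neg_and_neg_of_mul_pos this with ⟨h1, h2⟩ | ⟨h1, h2⟩
    · positivity
    · exact mul_pos_of_neg_of_neg h2 (inv_lt_zero.2 h1)
  · have : (Lagrange.nodal (K.erase κ) id : ℝ[X]).natDegree = A.natDegree - 1 := by
      rw [Lagrange.natDegree_nodal, Finset.card_erase_of_mem hκ, hcard]
    simp only [Q, coeff_C_mul]
    rw [← this, Monic.coeff_natDegree (Lagrange.nodal_monic), mul_one]
  · have hAd : A.degree = (K.card : ℕ) := by rw [degree_eq_natDegree h0, hcard]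
    -- Both sides have degree below the number of zeros of `A`, and at a zero only its own summand
    -- survives.
    refine eq_of_degrees_lt_of_eval_finset_eq (s := K) (by rwa [← hAd]) ?_ ?_
    · rw [← hAd]
      refine (degree_sum_le _ _).trans_lt ((Finset.sup_lt_iff (by
        rw [bot_lt_iff_ne_bot]; exact degree_ne_bot.2 h0)).2 fun κ hκ => ?_)
      refine (degree_C_mul_le' _ _).trans_lt ?_
      simp only [Q]
      refine (degree_C_mul_le' _ _).trans_lt ?_
      rw [Lagrange.degree_nodal, hAd]
      exact_mod_cast Finset.card_erase_lt_of_mem hκ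
    · intro x hx
      rw [eval_finsetSum, Finset.sum_eq_single_of_mem x hx]
      · rw [eval_C_mul, hQd x hx, div_mul_cancel₀]
        exact h.simple x ((mem_rootsFinset h0).1 hx)
      · intro κ hκ hne
        have : (Q κ).eval x = 0 := by
          simp only [Q, eval_C_mul]
          rw [show x = id x from rfl, Lagrange.eval_nodal_at_node (Finset.mem_erase.2 ⟨hne.symm, hx⟩),
            mul_zero]
        rw [eval_C_mul, this, mul_zero]

/-- This is the sign of Im 1/(z - κ), cleared of denominators: Q times the conjugate of A is |Q|²
times the conjugate of z - κ. -/
theorem aeval_conj_im (A : ℝ[X]) (Q : ℝ[X]) (κ : ℝ) (z : ℂ) (hA : A = (X - C κ) * Q) :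
    (aeval z Q * (starRingEnd ℂ) (aeval z A)).im = - z.im * Complex.normSq (aeval z Q) := by
  rw [hA]
  simp only [map_mul, map_sub, aeval_X, aeval_C]
  rw [show aeval z Q * (((starRingEnd ℂ) z - (starRingEnd ℂ) (algebraMap ℝ ℂ κ)) *
    (starRingEnd ℂ) (aeval z Q)) = (aeval z Q * (starRingEnd ℂ) (aeval z Q)) *
    ((starRingEnd ℂ) z - (starRingEnd ℂ) (algebraMap ℝ ℂ κ)) by ring, Complex.mul_conj]
  simp
  ring

/-- If `-B / A` is a Nevanlinna function, then so is `A / B`. -/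
theorem NevPair.flip {A B : ℝ[X]} (h : NevPair A B) {w v : ℝ} (hv : 0 ≤ v)
    (hdeg : (B + (C w + C v * X) * A).degree < A.degree) (hB : B ≠ 0) : NevPair B (-A) := by
  set R := B + (C w + C v * X) * A with hR
  have hAR : NevPair A R := h.congr fun x hx => by simp [hR, hx]
  obtain ⟨ρ, Q, hQ, hsum⟩ := hAR.partialFractions hdeg
  set K := A.roots.toFinset with hK
  have h0 := h.ne_zero
  -- the degenerate case is excluded
  have hconst : v = 0 → K = ∅ → ∃ c : ℝ, c ≠ 0 ∧ B = C c * A := by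
    intro hv0 hKe
    rw [hKe, Finset.sum_empty] at hsum
    refine ⟨-w, ?_, ?_⟩
    · intro hw
      apply hB
      have hw' : w = 0 := by linarith
      simpa [hv0, hw', hsum] using hR.symm
    · have : B = -((C w + C v * X) * A) := by
        rw [eq_neg_iff_add_eq_zero, ← hR, hsum]
      rw [this, hv0]; simp
  have hQne : ∀ κ ∈ K, ∀ z : ℂ, aeval z A ≠ 0 → 0 < Complex.normSq (aeval z (Q κ)) := by
    intro κ hκ z hz
    rw [Complex.normSq_pos]
    intro h1
    apply hz
    rw [(hQ κ hκ).2.1, map_mul, h1, mul_zero]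
  constructor
  · intro z hz
    by_cases hAz : aeval z A = 0
    · exact h.im_eq_zero z hAz
    -- At a zero of `B` the quantity Im(R Ā) is computed twice, from R = (w + v z) A and from the
    -- partial fractions of R/A. The results have opposite signs unless z is real.
    have e1 : aeval z R = (w + v * z) * aeval z A := by
      simp [hR, hz]
    have e2 : (aeval z R * (starRingEnd ℂ) (aeval z A)).im
        = v * z.im * Complex.normSq (aeval z A) := by
      rw [e1, mul_assoc, Complex.mul_conj]
      simp
    have e3 : (aeval z R * (starRingEnd ℂ) (aeval z A)).im
        = - z.im * ∑ κ ∈ K, ρ κ * Complex.normSq (aeval z (Q κ)) := by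
      rw [hsum, map_sum, Finset.sum_mul, Complex.im_sum, Finset.mul_sum]
      refine Finset.sum_congr rfl fun κ hκ => ?_
      rw [map_mul, aeval_C, mul_assoc]
      have := aeval_conj_im A (Q κ) κ z (hQ κ hκ).2.1
      rw [show (algebraMap ℝ ℂ (ρ κ)) = ((ρ κ : ℝ) : ℂ) from rfl, Complex.im_ofReal_mul, this]
      ring
    have e4 : z.im * (v * Complex.normSq (aeval z A) +
        ∑ κ ∈ K, ρ κ * Complex.normSq (aeval z (Q κ))) = 0 := by
      linear_combination e3 - e2
    rcases mul_eq_zero.1 e4 with h1 | h1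
    · exact h1
    -- Both non-negative summands vanish, so v = 0 and `A` has no zeros. Then `B` is a non-zero
    -- constant multiple of `A`, which contradicts A(z) ≠ 0.
    exfalso
    have hAp := Complex.normSq_pos.2 hAz
    have hS : 0 ≤ ∑ κ ∈ K, ρ κ * Complex.normSq (aeval z (Q κ)) :=
      Finset.sum_nonneg fun κ hκ => mul_nonneg (hQ κ hκ).1.le (Complex.normSq_nonneg _)
    have hv0 : v = 0 := by
      by_contra hne
      have : 0 < v * Complex.normSq (aeval z A) := mul_pos (lt_of_le_of_ne hv (Ne.symm hne)) hAp
      linarith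
    have hKe : K = ∅ := by
      by_contra hne
      have : 0 < ∑ κ ∈ K, ρ κ * Complex.normSq (aeval z (Q κ)) :=
        Finset.sum_pos (fun κ hκ => mul_pos (hQ κ hκ).1 (hQne κ hκ z hAz))
          (Finset.nonempty_iff_ne_empty.2 hne)
      rw [hv0] at h1; linarith
    obtain ⟨c, hc, hBc⟩ := hconst hv0 hKe
    rw [hBc, map_mul, aeval_C] at hz
    rcases mul_eq_zero.1 hz with h2 | h2
    · exact hc (by simpa using h2)
    · exact hAz h2
  · intro x hx
    have hAx : A.eval x ≠ 0 := by
      intro h1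
      have := h.pos x h1
      rw [hx] at this; simp at this
    have hAx' : aeval (x : ℂ) A ≠ 0 := by rw [aeval_ofReal]; exact_mod_cast hAx
    -- The Wronskian of `A` and `R`, again computed twice. At a zero of `B` the comparison gives A
    -- B' = -(v A² + ∑ ρ Q²), which is negative.
    have id1 : A * derivative R - derivative A * R = -∑ κ ∈ K, C (ρ κ) * Q κ ^ 2 := by
      rw [hsum, derivative_sum, Finset.mul_sum, Finset.mul_sum, ← Finset.sum_sub_distrib,
        ← Finset.sum_neg_distrib]
      refine Finset.sum_congr rfl fun κ hκ => ?_
      have hA := (hQ κ hκ).2.1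
      have hA' : derivative A = Q κ + (X - C κ) * derivative (Q κ) := by
        conv_lhs => rw [hA]
        simp
      rw [hA', derivative_C_mul]
      conv_lhs => rw [hA]
      ring
    have id2 : A * derivative R - derivative A * R =
        A * derivative B - derivative A * B + C v * A ^ 2 := by
      simp only [hR, derivative_add, derivative_mul, derivative_C, derivative_X]
      ring
    have e := congrArg (eval x) (id2.symm.trans id1)
    simp only [eval_add, eval_sub, eval_mul, eval_pow, eval_C, eval_neg, eval_finsetSum, hx,
      mul_zero, sub_zero] at e
    have hQx : ∀ κ ∈ K, (Q κ).eval x ≠ 0 := by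
      intro κ hκ h1
      apply hAx
      rw [(hQ κ hκ).2.1, eval_mul, h1, mul_zero]
    have hS : 0 ≤ ∑ κ ∈ K, ρ κ * (Q κ).eval x ^ 2 :=
      Finset.sum_nonneg fun κ hκ => mul_nonneg (hQ κ hκ).1.le (sq_nonneg _)
    have hA2 : 0 < A.eval x ^ 2 := by positivity
    rw [eval_neg]
    have hgoal : 0 < v * A.eval x ^ 2 + ∑ κ ∈ K, ρ κ * (Q κ).eval x ^ 2 := by
      by_contra hcon
      have hv0 : v = 0 := by
        by_contra hne
        have : 0 < v * A.eval x ^ 2 := mul_pos (lt_of_le_of_ne hv (Ne.symm hne)) hA2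
        linarith
      have hKe : K = ∅ := by
        by_contra hne
        have : 0 < ∑ κ ∈ K, ρ κ * (Q κ).eval x ^ 2 :=
          Finset.sum_pos (fun κ hκ => mul_pos (hQ κ hκ).1 (by have := hQx κ hκ; positivity))
            (Finset.nonempty_iff_ne_empty.2 hne)
        rw [hv0] at hcon; linarith
      obtain ⟨c, hc, hBc⟩ := hconst hv0 hKe
      rw [hBc, eval_mul, eval_C] at hx
      rcases mul_eq_zero.1 hx with h2 | h2
      · exact hc h2
      · exact hAx h2
    nlinarith

/-- All the cofactors `Q κ` share the leading coefficient of `A`, so this coefficient of `R` is the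
sum of the positive residues times that leading coefficient. -/
theorem NevPair.coeff_pos {A R : ℝ[X]} (h : NevPair A R) (hdeg : R.degree < A.degree)
    (hA : 0 < A.natDegree) : 0 < A.leadingCoeff * R.coeff (A.natDegree - 1) := by
  obtain ⟨ρ, Q, hQ, hsum⟩ := h.partialFractions hdeg
  have h0 := h.ne_zero
  have : R.coeff (A.natDegree - 1) = (∑ κ ∈ A.roots.toFinset, ρ κ) * A.leadingCoeff := by
    conv_lhs => rw [hsum]
    rw [finsetSum_coeff, Finset.sum_mul]
    exact Finset.sum_congr rfl fun κ hκ => by rw [coeff_C_mul, (hQ κ hκ).2.2]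
  rw [this]
  have hl := leadingCoeff_ne_zero.2 h0
  have hpos : 0 < ∑ κ ∈ A.roots.toFinset, ρ κ := by
    refine Finset.sum_pos (fun κ hκ => (hQ κ hκ).1) (Finset.card_pos.1 ?_)
    rwa [card_roots_eq_natDegree h.im_eq_zero h.simple]
  have : 0 < A.leadingCoeff * A.leadingCoeff := mul_self_pos.2 hl
  nlinarith

theorem NevPair.natDegree_eq {A R : ℝ[X]} (h : NevPair A R) (hdeg : R.degree < A.degree)
    (hA : 0 < A.natDegree) : R.natDegree = A.natDegree - 1 ∧ R ≠ 0 ∧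
      0 < A.leadingCoeff * R.leadingCoeff := by
  have hc := h.coeff_pos hdeg hA
  have hne : R.coeff (A.natDegree - 1) ≠ 0 := right_ne_zero_of_mul hc.ne'
  have hR : R ≠ 0 := by rintro rfl; simp at hne
  have h1 := natDegree_lt_natDegree hR hdeg
  have h2 := le_natDegree_of_ne_zero hne
  have h3 : R.natDegree = A.natDegree - 1 := by omega
  refine ⟨h3, hR, ?_⟩
  rwa [leadingCoeff, leadingCoeff, h3] at *

theorem NevPair.of_neg {A B : ℝ[X]} (h : NevPair (-A) (-B)) : NevPair A B :=
  ⟨fun z hz => h.im_eq_zero z (by simp [hz]), fun x hx => by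
    simpa using h.pos x (by simp [hx])⟩

/-! ### One step of the Stieltjes continued fraction -/

/-- The normalized pairs `(g, r)` for which `-r / g` is a rational Nevanlinna function vanishing
at infinity. -/
structure IsNormalizedPair (g r : ℝ[X]) : Prop where
  nev : NevPair g r
  degree_lt : r.degree < g.degree
  eval_zero : g.eval 0 = 1

/-- The second component after a point mass. -/
def massStep (w v : ℝ) (g r : ℝ[X]) : ℝ[X] := r - (C w + C v * X) * g

/-- The first component after an interval. -/
def lengthStep (h : ℝ) (g r : ℝ[X]) : ℝ[X] := g + C h * X * r

theorem isNormalizedPair_one_zero : IsNormalizedPair 1 0 :=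
  ⟨⟨fun z hz => by simp at hz, fun x hx => by simp at hx⟩, by simp, by simp⟩

theorem natDegree_linear_mul {w v : ℝ} (hwv : w ≠ 0 ∨ v ≠ 0) {g : ℝ[X]} (hg : g ≠ 0) :
    ((C w + C v * X) * g).natDegree = g.natDegree + (if v = 0 then 0 else 1) ∧
      (C w + C v * X) * g ≠ 0 := by
  have hne : (C w + C v * X : ℝ[X]) ≠ 0 := by
    intro h0
    rcases hwv with h | h
    · exact h (by simpa using congrArg (fun p => coeff p 0) h0)
    · exact h (by simpa [coeff_C] using congrArg (fun p => coeff p 1) h0)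
  refine ⟨?_, mul_ne_zero hne hg⟩
  rw [natDegree_mul hne hg, add_comm]
  congr 1
  split_ifs with hv
  · simp [hv]
  · rw [add_comm, natDegree_add_C, natDegree_C_mul_X _ hv]

theorem IsNormalizedPair.ne_zero {g r : ℝ[X]} (h : IsNormalizedPair g r) : g ≠ 0 := h.nev.ne_zero

theorem IsNormalizedPair.natDegree_massStep {g r : ℝ[X]} (h : IsNormalizedPair g r) {w v : ℝ}
    (hwv : w ≠ 0 ∨ v ≠ 0) : (massStep w v g r).natDegree = g.natDegree + (if v = 0 then 0 else 1) ∧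
      massStep w v g r ≠ 0 := by
  obtain ⟨h1, h2⟩ := natDegree_linear_mul hwv h.ne_zero
  have hlt : r.degree < ((C w + C v * X) * g).degree := by
    refine h.degree_lt.trans_le ?_
    rw [degree_eq_natDegree h.ne_zero, degree_eq_natDegree h2, h1]
    exact_mod_cast Nat.le_add_right _ _
  have hdeg : (massStep w v g r).degree = ((C w + C v * X) * g).degree :=
    degree_sub_eq_right_of_degree_lt hlt
  refine ⟨by rw [natDegree_eq_of_degree_eq hdeg, h1], ?_⟩
  intro h0
  rw [h0, degree_zero] at hdeg
  exact h2 (degree_eq_bot.1 hdeg.symm)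

theorem natDegree_lengthStep {g r : ℝ[X]} {h : ℝ} (hh : h ≠ 0) (hr : r ≠ 0)
    (hle : g.natDegree ≤ r.natDegree) : (lengthStep h g r).natDegree = r.natDegree + 1 ∧
      (lengthStep h g r).coeff (r.natDegree + 1) = h * r.leadingCoeff := by
  have hc : (lengthStep h g r).coeff (r.natDegree + 1) = h * r.leadingCoeff := by
    rw [lengthStep, coeff_add, coeff_eq_zero_of_natDegree_lt (by omega), zero_add, mul_assoc,
      coeff_C_mul, coeff_X_mul]
    rfl
  refine ⟨natDegree_eq_of_le_of_coeff_ne_zero ?_ ?_, hc⟩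
  · refine (natDegree_add_le _ _).trans (max_le (by omega) ?_)
    rw [mul_assoc]
    refine (natDegree_C_mul_le _ _).trans ?_
    rw [natDegree_X_mul hr]
  · rw [hc]; exact mul_ne_zero hh (leadingCoeff_ne_zero.2 hr)

/-- One multiple of r cancels the top coefficient. The vanishing term `C 0 * X` is kept to match the
degree hypothesis of `NevPair.flip`. -/
theorem exists_degree_sub_lt {g r : ℝ[X]} (hr : r ≠ 0) (hle : g.natDegree ≤ r.natDegree) :
    ∃ w : ℝ, (-g + (C w + C 0 * X) * r).degree < r.degree := by
  refine ⟨g.coeff r.natDegree / r.leadingCoeff, ?_⟩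
  rw [degree_eq_natDegree hr, degree_lt_iff_coeff_zero]
  intro m hm
  simp only [C_0, zero_mul, add_zero, coeff_add, coeff_neg, coeff_C_mul]
  rcases hm.lt_or_eq with h | rfl
  · rw [coeff_eq_zero_of_natDegree_lt (by omega), coeff_eq_zero_of_natDegree_lt h]; simp
  · rw [coeff_natDegree, div_mul_cancel₀ _ (leadingCoeff_ne_zero.2 hr)]; simp

/-- With ρ the new second component, -ρ/g = -r/g + w + v z is Nevanlinna since v ≥ 0. So is its
negative reciprocal g/ρ, hence also g/ρ + h z since h > 0, and one more negative reciprocal gives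
the new quotient. The two reciprocals are the two uses of `NevPair.flip`. -/
theorem IsNormalizedPair.step {g r : ℝ[X]} (H : IsNormalizedPair g r) {h w v : ℝ} (hh : 0 < h)
    (hv : 0 ≤ v) (hwv : w ≠ 0 ∨ v ≠ 0) :
    IsNormalizedPair (lengthStep h g (massStep w v g r)) (massStep w v g r) := by
  obtain ⟨hd, h0⟩ := H.natDegree_massStep hwv
  set ρ := massStep w v g r with hρ
  have n1 : NevPair ρ (-g) := by
    refine (H.nev.congr (B' := ρ) fun x hx => by simp [hρ, massStep, hx]).flip hv ?_ h0
      (w := w)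
    have : ρ + (C w + C v * X) * g = r := by rw [hρ, massStep]; ring
    rw [this]; exact H.degree_lt
  have n2 : NevPair ρ (-lengthStep h g ρ) := n1.congr fun x hx => by simp [lengthStep, hx]
  obtain ⟨hd2, -⟩ := natDegree_lengthStep (g := g) hh.ne' h0 (by omega)
  have hne : lengthStep h g ρ ≠ 0 := by
    intro h1; rw [h1] at hd2; simp at hd2
  refine ⟨?_, ?_, ?_⟩
  · obtain ⟨w', hw'⟩ := exists_degree_sub_lt (g := g) h0 (by omega)
    have n3 := n2.flip (w := w') hh.le (by
      have : -lengthStep h g ρ + (C w' + C h * X) * ρ = -g + (C w' + C 0 * X) * ρ := by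
        rw [lengthStep, C_0]; ring
      rw [this]; exact hw') (neg_ne_zero.2 hne)
    exact n3.of_neg
  · exact degree_lt_degree (by omega)
  · simp [lengthStep, H.eval_zero]

theorem IsNormalizedPair.natDegree_step {g r : ℝ[X]} (H : IsNormalizedPair g r) {h w v : ℝ}
    (hh : 0 < h) (hwv : w ≠ 0 ∨ v ≠ 0) :
    (lengthStep h g (massStep w v g r)).natDegree = g.natDegree + (if v = 0 then 0 else 1) + 1 := by
  obtain ⟨hd, h0⟩ := H.natDegree_massStep hwv
  rw [(natDegree_lengthStep (g := g) hh.ne' h0 (by omega)).1, hd]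

/-- Undoes the last step by division: h is fixed by cancelling the top term of g against h X r, and
-(w + v X) is the polynomial part of r/g₁. -/
theorem IsNormalizedPair.exists_step {g r : ℝ[X]} (H : IsNormalizedPair g r)
    (hg : 0 < g.natDegree) : ∃ (h w v : ℝ) (g₁ r₁ : ℝ[X]), 0 < h ∧ 0 ≤ v ∧ (w ≠ 0 ∨ v ≠ 0) ∧
      IsNormalizedPair g₁ r₁ ∧ r = massStep w v g₁ r₁ ∧ g = lengthStep h g₁ r ∧
      g₁.natDegree < g.natDegree := by
  obtain ⟨hrd, hr0, hlead⟩ := H.nev.natDegree_eq H.degree_lt hg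
  have hlr := leadingCoeff_ne_zero.2 hr0
  have hlg := leadingCoeff_ne_zero.2 H.ne_zero
  set h := g.leadingCoeff / r.leadingCoeff with hh
  have hhpos : 0 < h := by
    rw [hh]
    have : g.leadingCoeff / r.leadingCoeff = (g.leadingCoeff * r.leadingCoeff) /
      (r.leadingCoeff ^ 2) := by field_simp
    rw [this]; positivity
  set g₁ := g - C h * X * r with hg₁
  have hg₁0 : g₁.eval 0 = 1 := by simp [hg₁, H.eval_zero]
  have hg₁ne : g₁ ≠ 0 := by
    intro h0; rw [h0] at hg₁0; simp at hg₁0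
  have hXr : (C h * X * r).natDegree = g.natDegree := by
    rw [mul_assoc, natDegree_C_mul hhpos.ne', natDegree_X_mul hr0, hrd]; omega
  have hdlt : g₁.degree < g.degree := by
    refine degree_sub_lt_left ?_ H.ne_zero ?_
    · rw [degree_eq_natDegree H.ne_zero, degree_eq_natDegree, hXr]
      intro h0; rw [h0] at hXr; simp at hXr; omega
    · rw [leadingCoeff_mul, leadingCoeff_mul, leadingCoeff_C, leadingCoeff_X, hh]
      field_simp
  have hnlt : g₁.natDegree < g.natDegree := natDegree_lt_natDegree hg₁ne hdlt
  have hle : g₁.natDegree ≤ r.natDegree := by omega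
  have n1 : NevPair r (-g) := H.nev.flip (w := 0) (v := 0) le_rfl (by simpa using H.degree_lt) hr0
  have n2 : NevPair r (-g₁) := n1.congr fun x hx => by simp [hg₁, hx]
  obtain ⟨w', hw'⟩ := exists_degree_sub_lt (g := g₁) hr0 hle
  have n3 : NevPair g₁ r := (n2.flip le_rfl hw' (neg_ne_zero.2 hg₁ne)).of_neg
  have hl1 := leadingCoeff_ne_zero.2 hg₁ne
  have hgl : g = lengthStep h g₁ r := by rw [lengthStep, hg₁]; ring
  have key : ∀ w v : ℝ, 0 ≤ v → (w ≠ 0 ∨ v ≠ 0) →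
      (r + (C w + C v * X) * g₁).degree < g₁.degree → _ := fun w v hv hwv hdeg =>
    (⟨h, w, v, g₁, r + (C w + C v * X) * g₁, hhpos, hv, hwv,
      ⟨n3.congr fun x hx => by simp [hx], hdeg, hg₁0⟩, by rw [massStep]; ring, hgl, hnlt⟩ :
      ∃ (h w v : ℝ) (g₁ r₁ : ℝ[X]), 0 < h ∧ 0 ≤ v ∧ (w ≠ 0 ∨ v ≠ 0) ∧
      IsNormalizedPair g₁ r₁ ∧ r = massStep w v g₁ r₁ ∧ g = lengthStep h g₁ r ∧
      g₁.natDegree < g.natDegree)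
  -- Equal degrees mean v = 0 and w ≠ 0. Otherwise the pair (r, -g₁) has positive residues and a
  -- proper quotient, so deg g₁ = deg r - 1 and the leading coefficients give v > 0.
  rcases hle.eq_or_lt with heq | hlt
  · refine key (-(r.leadingCoeff / g₁.leadingCoeff)) 0 le_rfl
      (Or.inl (neg_ne_zero.2 (div_ne_zero hlr hl1))) ?_
    rw [degree_eq_natDegree hg₁ne, degree_lt_iff_coeff_zero]
    intro m hm
    simp only [C_0, zero_mul, add_zero, coeff_add, coeff_C_mul]
    rcases hm.lt_or_eq with h1 | rfl
    · rw [coeff_eq_zero_of_natDegree_lt (by omega), coeff_eq_zero_of_natDegree_lt h1]; simp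
    · rw [coeff_natDegree, heq, coeff_natDegree]; field_simp; ring
  · obtain ⟨hd1, -, hl2⟩ := n2.natDegree_eq (by
      rw [degree_neg]; exact degree_lt_degree hlt) (by omega)
    rw [natDegree_neg] at hd1
    rw [leadingCoeff_neg] at hl2
    set v := -(r.leadingCoeff / g₁.leadingCoeff) with hv
    have hvpos : 0 < v := by
      have : v = (r.leadingCoeff * -g₁.leadingCoeff) / (g₁.leadingCoeff ^ 2) := by
        rw [hv]; field_simp
      rw [this]; positivity
    set c := (r + C v * X * g₁).coeff g₁.natDegree with hc
    refine key (-(c / g₁.leadingCoeff)) v hvpos.le (Or.inr hvpos.ne') ?_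
    rw [degree_eq_natDegree hg₁ne, degree_lt_iff_coeff_zero]
    intro m hm
    have hsplit : r + (C (-(c / g₁.leadingCoeff)) + C v * X) * g₁ =
        (r + C v * X * g₁) + C (-(c / g₁.leadingCoeff)) * g₁ := by ring
    rw [hsplit, coeff_add, coeff_C_mul]
    rcases hm.lt_or_eq with h1 | rfl
    · rw [coeff_eq_zero_of_natDegree_lt h1, mul_zero, add_zero, coeff_add, mul_assoc, coeff_C_mul]
      obtain ⟨k, rfl⟩ : ∃ k, m = k + 1 := ⟨m - 1, by omega⟩
      rw [coeff_X_mul]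
      rcases (Nat.lt_succ_iff.1 h1).lt_or_eq with h2 | rfl
      · rw [coeff_eq_zero_of_natDegree_lt h2, coeff_eq_zero_of_natDegree_lt (by omega)]; simp
      · rw [show g₁.natDegree + 1 = r.natDegree by omega, coeff_natDegree, coeff_natDegree, hv]
        field_simp; ring
    · rw [← hc, coeff_natDegree]; field_simp; ring

/-- The top coefficient of the length step is h times that of the mass step, which fixes h and then
g₁. The difference r₁ - r₂ is a linear factor times g₁ but has smaller degree than g₁, so that
factor is zero. -/
theorem IsNormalizedPair.step_unique {g₁ r₁ g₂ r₂ : ℝ[X]} (H₁ : IsNormalizedPair g₁ r₁)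
    (H₂ : IsNormalizedPair g₂ r₂) {h₁ w₁ v₁ h₂ w₂ v₂ : ℝ} (hh₁ : 0 < h₁) (hh₂ : 0 < h₂)
    (hwv₁ : w₁ ≠ 0 ∨ v₁ ≠ 0) (hwv₂ : w₂ ≠ 0 ∨ v₂ ≠ 0)
    (hr : massStep w₁ v₁ g₁ r₁ = massStep w₂ v₂ g₂ r₂)
    (hg : lengthStep h₁ g₁ (massStep w₁ v₁ g₁ r₁) = lengthStep h₂ g₂ (massStep w₂ v₂ g₂ r₂)) :
    h₁ = h₂ ∧ w₁ = w₂ ∧ v₁ = v₂ ∧ g₁ = g₂ ∧ r₁ = r₂ := by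
  obtain ⟨hd₁, h0⟩ := H₁.natDegree_massStep hwv₁
  obtain ⟨hd₂, -⟩ := H₂.natDegree_massStep hwv₂
  have c₁ := (natDegree_lengthStep (g := g₁) hh₁.ne' h0 (by omega)).2
  have c₂ := (natDegree_lengthStep (g := g₂) hh₂.ne' (hr ▸ h0) (by omega)).2
  rw [hr] at h0 c₁ hg
  rw [hg, c₂] at c₁
  have hh : h₁ = h₂ := (mul_right_cancel₀ (leadingCoeff_ne_zero.2 h0) c₁).symm
  subst hh
  have hgg : g₁ = g₂ := by
    simpa [lengthStep] using hg
  subst hgg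
  have e : (C (w₁ - w₂) + C (v₁ - v₂) * X) * g₁ = r₁ - r₂ := by
    simp only [massStep] at hr
    rw [C_sub, C_sub]; linear_combination -hr
  have hwv : ¬ (w₁ - w₂ ≠ 0 ∨ v₁ - v₂ ≠ 0) := by
    intro hne
    obtain ⟨h1, h2⟩ := natDegree_linear_mul hne H₁.ne_zero
    rw [e] at h1 h2
    have : (r₁ - r₂).degree < g₁.degree :=
      (degree_sub_le _ _).trans_lt (max_lt H₁.degree_lt H₂.degree_lt)
    have := natDegree_lt_natDegree h2 this
    omega
  push Not at hwv
  rw [hwv.1, hwv.2] at e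
  refine ⟨rfl, by linarith [hwv.1], by linarith [hwv.2], rfl, ?_⟩
  have : r₁ - r₂ = 0 := by simpa using e.symm
  exact sub_eq_zero.1 this

/-! ### Polynomial transfer through a chain of point masses -/

/-- Transfer of polynomial initial data over a mass-free interval of length `t`. -/
def transP (t : ℝ) (F : ℝ[X] × ℝ[X]) : ℝ[X] × ℝ[X] :=
  (C (Real.cosh (t / 2)) * F.1 + C (2 * Real.sinh (t / 2)) * F.2,
   C (Real.sinh (t / 2) / 2) * F.1 + C (Real.cosh (t / 2)) * F.2)

/-- The effect of point masses `w`, `v` on polynomial data. -/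
def kickP (w v : ℝ) (F : ℝ[X] × ℝ[X]) : ℝ[X] × ℝ[X] :=
  (F.1, F.2 - (C w * X + C v * X ^ 2) * F.1)

/-- Transfer from `a` to `b` through finitely many point masses `(x, w, v)`, listed from right to
left. -/
def chainP (a : ℝ) (F : ℝ[X] × ℝ[X]) : List (ℝ × ℝ × ℝ) → ℝ → ℝ[X] × ℝ[X]
  | [], b => transP (b - a) F
  | m :: L, b => transP (b - m.1) (kickP m.2.1 m.2.2 (chainP a F L m.1))

/-- The masses lie between `a` and `b`, decrease in position, and are admissible. -/
def ValidChain (a : ℝ) : List (ℝ × ℝ × ℝ) → ℝ → Prop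
  | [], b => a < b
  | m :: L, b => m.1 < b ∧ 0 ≤ m.2.2 ∧ (m.2.1 ≠ 0 ∨ m.2.2 ≠ 0) ∧ ValidChain a L m.1

theorem ValidChain.lt {a : ℝ} : ∀ {L : List (ℝ × ℝ × ℝ)} {b : ℝ}, ValidChain a L b → a < b
  | [], _, h => h
  | _ :: _, _, h => (ValidChain.lt h.2.2.2).trans h.1

theorem chainP_linear (a : ℝ) (p q : ℝ[X]) (F G : ℝ[X] × ℝ[X]) (L : List (ℝ × ℝ × ℝ)) (b : ℝ) :
    chainP a (p * F.1 + q * G.1, p * F.2 + q * G.2) L b =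
      (p * (chainP a F L b).1 + q * (chainP a G L b).1,
       p * (chainP a F L b).2 + q * (chainP a G L b).2) := by
  induction L generalizing b with
  | nil => simp only [chainP, transP, Prod.mk.injEq]; constructor <;> ring
  | cons m L ih =>
    simp only [chainP, transP, kickP, ih, Prod.mk.injEq]; constructor <;> ring

/-- Conservation of the Wronskian: free transfers and kicks both have determinant one. -/
theorem chainP_det (a : ℝ) (F G : ℝ[X] × ℝ[X]) (L : List (ℝ × ℝ × ℝ)) (b : ℝ) :
    (chainP a F L b).1 * (chainP a G L b).2 - (chainP a F L b).2 * (chainP a G L b).1 =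
      F.1 * G.2 - F.2 * G.1 := by
  have ht : ∀ (t : ℝ) (F G : ℝ[X] × ℝ[X]), (transP t F).1 * (transP t G).2 -
      (transP t F).2 * (transP t G).1 = F.1 * G.2 - F.2 * G.1 := by
    intro t F G
    have h : (C (Real.cosh (t / 2)) : ℝ[X]) ^ 2 - C (Real.sinh (t / 2)) ^ 2 = 1 := by
      rw [← C_pow, ← C_pow, ← C_sub, Real.cosh_sq_sub_sinh_sq, C_1]
    have h2 : (C (2 * Real.sinh (t / 2)) : ℝ[X]) * C (Real.sinh (t / 2) / 2) =
        C (Real.sinh (t / 2)) ^ 2 := by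
      rw [← C_pow, ← C_mul]; congr 1; ring
    simp only [transP]
    linear_combination (F.1 * G.2 - F.2 * G.1) * h - (F.1 * G.2 - F.2 * G.1) * h2
  induction L generalizing b with
  | nil => exact ht _ _ _
  | cons m L ih =>
    rw [chainP, chainP, ht, ← ih m.1]
    simp only [kickP]; ring

/-- At z = 0 the masses are invisible, and free transfers compose by the addition theorems. -/
theorem chainP_eval_zero (a : ℝ) (F : ℝ[X] × ℝ[X]) (L : List (ℝ × ℝ × ℝ)) (b : ℝ) :
    (chainP a F L b).1.eval 0 = (transP (b - a) F).1.eval 0 ∧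
    (chainP a F L b).2.eval 0 = (transP (b - a) F).2.eval 0 := by
  induction L generalizing b with
  | nil => exact ⟨rfl, rfl⟩
  | cons m L ih =>
    have e : (b - a) / 2 = (b - m.1) / 2 + (m.1 - a) / 2 := by ring
    have h1 := ih m.1
    simp only [transP, eval_add, eval_mul, eval_C] at h1
    simp only [chainP, transP, kickP, eval_add, eval_mul, eval_C, eval_sub, eval_X, eval_pow,
      h1.1, h1.2, e, Real.cosh_add, Real.sinh_add]
    constructor <;> ring

/-! ### Liouville transform and reconstruction of chains -/

/-- The solution of the equation at energy zero that vanishes at `a`. -/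
def sinhSol (a x : ℝ) : ℝ := 2 * Real.sinh ((x - a) / 2)

theorem sinhSol_pos {a x : ℝ} (h : a < x) : 0 < sinhSol a x := by
  have : 0 < Real.sinh ((x - a) / 2) := Real.sinh_pos_iff.2 (by linarith)
  rw [sinhSol]; positivity

/-- The length of `[x, b]` after the Liouville transformation. -/
def liouvilleLength (a x b : ℝ) : ℝ := 2 * Real.sinh ((b - x) / 2) / (sinhSol a x * sinhSol a b)

theorem liouvilleLength_pos {a x b : ℝ} (h : a < x) (h' : x < b) : 0 < liouvilleLength a x b := by
  have h1 := sinhSol_pos h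
  have h2 := sinhSol_pos (h.trans h')
  have : 0 < Real.sinh ((b - x) / 2) := Real.sinh_pos_iff.2 (by linarith)
  rw [liouvilleLength]; positivity

theorem liouvilleLength_lt {a x y b : ℝ} (h : a < x) (hxy : x < y) (h' : y < b) :
    liouvilleLength a y b < liouvilleLength a x b := by
  have h1 := sinhSol_pos h
  have h2 := sinhSol_pos (h.trans hxy)
  have h3 := sinhSol_pos ((h.trans hxy).trans h')
  have h4 : 0 < Real.sinh ((b - y) / 2) := Real.sinh_pos_iff.2 (by linarith)
  have h5 : Real.sinh ((b - y) / 2) < Real.sinh ((b - x) / 2) := Real.sinh_lt_sinh.2 (by linarith)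
  have h6 : sinhSol a x < sinhSol a y := by
    have := Real.sinh_lt_sinh.2 (show (x - a) / 2 < (y - a) / 2 by linarith)
    simp only [sinhSol]; linarith
  rw [liouvilleLength, liouvilleLength]
  apply div_lt_div₀ (by linarith) (by nlinarith) (by linarith) (by positivity)

theorem liouvilleLength_inj {a x y b : ℝ} (hx : a < x) (hy : a < y) (hx' : x < b) (hy' : y < b)
    (h : liouvilleLength a x b = liouvilleLength a y b) : x = y := by
  rcases lt_trichotomy x y with h1 | h1 | h1
  · exact absurd h (liouvilleLength_lt hx h1 hy').ne'
  · exact h1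
  · exact absurd h (liouvilleLength_lt hy h1 hx').ne

/-- The length runs continuously from infinity at a to zero at b. The equation is cross-multiplied
so that the intermediate value theorem applies on the closed interval. -/
theorem exists_liouvilleLength {a b h : ℝ} (hab : a < b) (hh : 0 < h) :
    ∃ x, a < x ∧ x < b ∧ liouvilleLength a x b = h := by
  have hb := sinhSol_pos hab
  let f : ℝ → ℝ := fun x => 2 * Real.sinh ((b - x) / 2) - h * (sinhSol a x * sinhSol a b)
  have hf : Continuous f := by
    simp only [f, sinhSol]; fun_prop
  have h1 : 0 < f a := by
    have : 0 < Real.sinh ((b - a) / 2) := Real.sinh_pos_iff.2 (by linarith)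
    simp only [f, sinhSol, sub_self, zero_div, Real.sinh_zero]; simpa using this
  have h2 : f b < 0 := by
    simp only [f, sub_self, zero_div, Real.sinh_zero]
    have : 0 < h * (sinhSol a b * sinhSol a b) := by positivity
    linarith
  obtain ⟨x, hx, hfx⟩ := intermediate_value_Icc' hab.le hf.continuousOn ⟨h2.le, h1.le⟩
  have hxa : a < x := lt_of_le_of_ne hx.1 (by rintro rfl; rw [hfx] at h1; exact lt_irrefl _ h1)
  have hxb : x < b := lt_of_le_of_ne hx.2 (by rintro rfl; rw [hfx] at h2; exact lt_irrefl _ h2)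
  refine ⟨x, hxa, hxb, ?_⟩
  have hx0 := sinhSol_pos hxa
  rw [liouvilleLength, div_eq_iff (by positivity)]
  simp only [f] at hfx; linarith

/-- The solution vanishing at `a`, in terms of its Liouville transform. -/
def ofNormalized (a b : ℝ) (p : ℝ[X] × ℝ[X]) : ℝ[X] × ℝ[X] :=
  (C (sinhSol a b) * p.1, C (Real.cosh ((b - a) / 2)) * p.1 + C (sinhSol a b)⁻¹ * X * p.2)

/-- The Liouville transform of the solution vanishing at `a`. -/
def chainNorm (a : ℝ) : List (ℝ × ℝ × ℝ) → ℝ → ℝ[X] × ℝ[X]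
  | [], _ => (1, 0)
  | m :: L, b =>
    (lengthStep (liouvilleLength a m.1 b) (chainNorm a L m.1).1
      (massStep (m.2.1 * sinhSol a m.1 ^ 2) (m.2.2 * sinhSol a m.1 ^ 2)
        (chainNorm a L m.1).1 (chainNorm a L m.1).2),
     massStep (m.2.1 * sinhSol a m.1 ^ 2) (m.2.2 * sinhSol a m.1 ^ 2)
        (chainNorm a L m.1).1 (chainNorm a L m.1).2)

/-- The heart of the Liouville transform: relative to the zero-energy solution a free interval
becomes a length step, and masses are scaled by the square of that solution. The factor X in the
second component of `ofNormalized` absorbs one z of the jump z w + z² v, leaving w + v z. The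
identities `e1` to `e3` are addition theorems for sinh and cosh. -/
theorem transP_kickP_ofNormalized {a x b w v : ℝ} (hax : a < x) (hxb : x < b) (p : ℝ[X] × ℝ[X]) :
    transP (b - x) (kickP w v (ofNormalized a x p)) = ofNormalized a b
      (lengthStep (liouvilleLength a x b) p.1
        (massStep (w * sinhSol a x ^ 2) (v * sinhSol a x ^ 2) p.1 p.2),
       massStep (w * sinhSol a x ^ 2) (v * sinhSol a x ^ 2) p.1 p.2) := by
  have hx := (sinhSol_pos hax).ne'
  have hb := (sinhSol_pos (hax.trans hxb)).ne'
  have e : (b - a) / 2 = (b - x) / 2 + (x - a) / 2 := by ring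
  have e1 : sinhSol a b = Real.cosh ((b - x) / 2) * sinhSol a x +
      2 * Real.sinh ((b - x) / 2) * Real.cosh ((x - a) / 2) := by
    simp only [sinhSol, e, Real.sinh_add]; ring
  have e2 : Real.cosh ((b - a) / 2) = Real.cosh ((b - x) / 2) * Real.cosh ((x - a) / 2) +
      Real.sinh ((b - x) / 2) / 2 * sinhSol a x := by
    simp only [sinhSol, e, Real.cosh_add]; ring
  have e3 : Real.cosh ((b - x) / 2) * sinhSol a b =
      2 * Real.cosh ((b - a) / 2) * Real.sinh ((b - x) / 2) + sinhSol a x := by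
    rw [e1, e2]
    have := Real.cosh_sq ((b - x) / 2)
    linear_combination sinhSol a x * this
  ext1
  · refine Polynomial.funext fun t => ?_
    simp only [transP, kickP, ofNormalized, lengthStep, massStep, liouvilleLength, eval_add,
      eval_mul, eval_C, eval_sub, eval_X, eval_pow]
    field_simp
    linear_combination (-(p.1.eval t) * sinhSol a x) * e1
  · refine Polynomial.funext fun t => ?_
    simp only [transP, kickP, ofNormalized, lengthStep, massStep, liouvilleLength, eval_add,
      eval_mul, eval_C, eval_sub, eval_X, eval_pow]
    field_simp
    rw [e2]
    rw [e2] at e3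
    linear_combination (2 * t * (p.2.eval t - sinhSol a x ^ 2 * (w + t * v) * p.1.eval t)) * e3

theorem chainP_zero_one {a : ℝ} {L : List (ℝ × ℝ × ℝ)} {b : ℝ} (h : ValidChain a L b) :
    chainP a (0, 1) L b = ofNormalized a b (chainNorm a L b) := by
  induction L generalizing b with
  | nil => simp [chainP, transP, chainNorm, ofNormalized, sinhSol]
  | cons m L ih =>
    rw [chainP, ih h.2.2.2, transP_kickP_ofNormalized h.2.2.2.lt h.1, chainNorm]

theorem scaled_masses {a x w v : ℝ} (hax : a < x) (hv : 0 ≤ v) (hwv : w ≠ 0 ∨ v ≠ 0) :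
    0 ≤ v * sinhSol a x ^ 2 ∧ (w * sinhSol a x ^ 2 ≠ 0 ∨ v * sinhSol a x ^ 2 ≠ 0) := by
  have h := sinhSol_pos hax
  refine ⟨by positivity, hwv.imp (fun h1 => ?_) fun h1 => ?_⟩ <;> positivity

theorem isNormalizedPair_chainNorm {a : ℝ} {L : List (ℝ × ℝ × ℝ)} {b : ℝ}
    (h : ValidChain a L b) : IsNormalizedPair (chainNorm a L b).1 (chainNorm a L b).2 := by
  induction L generalizing b with
  | nil => exact isNormalizedPair_one_zero
  | cons m L ih =>
    have hlt := h.2.2.2.lt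
    obtain ⟨h1, h2⟩ := scaled_masses hlt h.2.1 h.2.2.1
    exact (ih h.2.2.2).step (liouvilleLength_pos hlt h.1) h1 h2

theorem chainNorm_natDegree_cons {a : ℝ} {m : ℝ × ℝ × ℝ} {L : List (ℝ × ℝ × ℝ)} {b : ℝ}
    (h : ValidChain a (m :: L) b) : (chainNorm a (m :: L) b).1.natDegree =
      (chainNorm a L m.1).1.natDegree + (if m.2.2 = 0 then 0 else 1) + 1 := by
  have hlt := h.2.2.2.lt
  obtain ⟨-, h2⟩ := scaled_masses hlt h.2.1 h.2.2.1
  rw [chainNorm, (isNormalizedPair_chainNorm h.2.2.2).natDegree_step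
    (liouvilleLength_pos hlt h.1) h2]
  have := (sinhSol_pos hlt).ne'
  simp [this]

/-- A kick raises the degree by at most one if v = 0 and by at most two otherwise. The solution
vanishing at a attains exactly this growth at every mass, so its degree bounds all others. -/
theorem chainP_natDegree_le {a : ℝ} {F : ℝ[X] × ℝ[X]} (hF₁ : F.1.natDegree = 0)
    (hF₂ : F.2.natDegree = 0) {L : List (ℝ × ℝ × ℝ)} {b : ℝ} (h : ValidChain a L b) :
    (chainP a F L b).1.natDegree ≤ (chainNorm a L b).1.natDegree ∧
    (chainP a F L b).2.natDegree ≤ (chainNorm a L b).1.natDegree := by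
  have ht : ∀ (t : ℝ) (G : ℝ[X] × ℝ[X]) (n : ℕ), G.1.natDegree ≤ n → G.2.natDegree ≤ n →
      (transP t G).1.natDegree ≤ n ∧ (transP t G).2.natDegree ≤ n := by
    intro t G n h1 h2
    constructor <;>
    · refine (natDegree_add_le _ _).trans (max_le ?_ ?_)
      · exact (natDegree_C_mul_le _ _).trans h1
      · exact (natDegree_C_mul_le _ _).trans h2
  induction L generalizing b with
  | nil => exact ht _ _ _ (by simp [hF₁]) (by simp [hF₂])
  | cons m L ih =>
    obtain ⟨h1, h2⟩ := ih h.2.2.2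
    rw [chainNorm_natDegree_cons h]
    refine ht _ _ _ (h1.trans (by omega)) ?_
    refine (natDegree_sub_le _ _).trans (max_le (by omega) ?_)
    refine natDegree_mul_le.trans ?_
    have : (C m.2.1 * X + C m.2.2 * X ^ 2 : ℝ[X]).natDegree ≤ (if m.2.2 = 0 then 0 else 1) + 1 := by
      split_ifs with h0
      · rw [h0, C_0, zero_mul, add_zero]; compute_degree
      · compute_degree
    omega

/-- Peel off the rightmost mass by `IsNormalizedPair.step_unique`: its position is recovered because
the Liouville length is strictly monotone in it, and w, v by undoing the scaling. The degree tells
an empty chain from a non-empty one. -/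
theorem chain_unique {a : ℝ} {L L' : List (ℝ × ℝ × ℝ)} {b : ℝ} (h : ValidChain a L b)
    (h' : ValidChain a L' b) (he : chainNorm a L b = chainNorm a L' b) : L = L' := by
  induction L generalizing L' b with
  | nil =>
    cases L' with
    | nil => rfl
    | cons m' L' =>
      have := chainNorm_natDegree_cons h'
      rw [← he] at this
      simp [chainNorm] at this
  | cons m L ih =>
    cases L' with
    | nil =>
      have := chainNorm_natDegree_cons h
      rw [he] at this
      simp [chainNorm] at this
    | cons m' L' =>
      have hlt := h.2.2.2.lt
      have hlt' := h'.2.2.2.lt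
      obtain ⟨-, h2⟩ := scaled_masses hlt h.2.1 h.2.2.1
      obtain ⟨-, h2'⟩ := scaled_masses hlt' h'.2.1 h'.2.2.1
      simp only [chainNorm, Prod.mk.injEq] at he
      obtain ⟨e1, e2, e3, e4, e5⟩ := (isNormalizedPair_chainNorm h.2.2.2).step_unique
        (isNormalizedPair_chainNorm h'.2.2.2) (liouvilleLength_pos hlt h.1)
        (liouvilleLength_pos hlt' h'.1) h2 h2' he.2 he.1
      obtain ⟨x, w, v⟩ := m
      obtain ⟨x', w', v'⟩ := m'
      have hx : x = x' := liouvilleLength_inj hlt hlt' h.1 h'.1 e1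
      subst hx
      have hne : sinhSol a x ^ 2 ≠ 0 := by have := sinhSol_pos hlt; positivity
      have hw : w = w' := mul_right_cancel₀ hne e2
      have hv : v = v' := mul_right_cancel₀ hne e3
      subst hw hv
      rw [ih h.2.2.2 h'.2.2.2 (Prod.ext e4 e5)]

/-- Induction on deg g: each continued fraction step is realized by one mass, whose position becomes
the right end point of the remaining chain. -/
theorem exists_chain {a : ℝ} {g r : ℝ[X]} (H : IsNormalizedPair g r) {b : ℝ} (hab : a < b) :
    ∃ L, ValidChain a L b ∧ chainNorm a L b = (g, r) := by
  induction hn : g.natDegree using Nat.strong_induction_on generalizing g r b with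
  | _ n ih =>
    rcases Nat.eq_zero_or_pos n with h0 | hpos
    · refine ⟨[], hab, ?_⟩
      rw [h0] at hn
      have hg : g = 1 := by
        rw [eq_C_of_natDegree_eq_zero hn] at H ⊢
        have := H.eval_zero
        simp at this; simp [this]
      have hr : r = 0 := by
        have := H.degree_lt
        rw [hg, degree_one] at this
        exact degree_eq_bot.1 (Nat.WithBot.lt_zero_iff.1 this)
      rw [hg, hr, chainNorm]
    · obtain ⟨h, w, v, g₁, r₁, hh, hv, hwv, H₁, er, eg, hlt⟩ := H.exists_step (hn ▸ hpos)
      obtain ⟨x, hax, hxb, hx⟩ := exists_liouvilleLength hab hh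
      obtain ⟨L, hL, hLe⟩ := ih _ (hn ▸ hlt) H₁ hax rfl
      have hs := sinhSol_pos hax
      have hs2 : sinhSol a x ^ 2 ≠ 0 := by positivity
      refine ⟨(x, w / sinhSol a x ^ 2, v / sinhSol a x ^ 2) :: L,
        ⟨hxb, by dsimp only; positivity, hwv.imp (fun h => div_ne_zero h hs2)
          (fun h => div_ne_zero h hs2), hL⟩, ?_⟩
      simp only [chainNorm, hLe, div_mul_cancel₀ _ hs2, hx]
      rw [← er, ← eg]

/-! ### The function space H¹_loc -/

theorem MemH1loc.continuous {h : ℝ → ℝ} (hh : MemH1loc h) : Continuous h := by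
  rw [continuous_iff_continuousAt]
  intro x
  have := (hh (x - 1) (x + 1)).1.continuousOn
  rw [Set.uIcc_of_le (by linarith)] at this
  exact this.continuousAt (Icc_mem_nhds (by linarith) (by linarith))

theorem MemH1loc.ae_differentiableAt {h : ℝ → ℝ} (hh : MemH1loc h) :
    ∀ᵐ x : ℝ, DifferentiableAt ℝ h x := by
  have : ∀ᵐ x : ℝ, ∀ n : ℕ, x ∈ Set.uIcc (-(n : ℝ)) n → DifferentiableAt ℝ h x :=
    ae_all_iff.2 fun n => (hh _ _).1.ae_differentiableAt
  filter_upwards [this] with x hx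
  obtain ⟨n, hn⟩ := exists_nat_ge |x|
  refine hx n ?_
  rw [Set.uIcc_of_le (by linarith [abs_nonneg x])]
  exact abs_le.1 hn

theorem memH1loc_of_lipschitzWith {h : ℝ → ℝ} {K : NNReal} (hh : LipschitzWith K h) :
    MemH1loc h := fun _ _ =>
  ⟨hh.lipschitzOnWith.absolutelyContinuousOnInterval,
    MemLp.of_bound (measurable_deriv h).aestronglyMeasurable K
      (Eventually.of_forall fun _ => norm_deriv_le_of_lipschitz hh)⟩

theorem memH1loc_of_contDiff {h : ℝ → ℝ} (hh : ContDiff ℝ 1 h) : MemH1loc h := by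
  intro x y
  refine ⟨hh.contDiffOn.absolutelyContinuousOnInterval, ?_⟩
  obtain ⟨K, hK⟩ := (isCompact_Icc (a := x) (b := y)).exists_bound_of_continuousOn
    (hh.continuous_deriv le_rfl).continuousOn
  refine MemLp.of_bound (measurable_deriv h).aestronglyMeasurable K ?_
  exact (ae_restrict_mem measurableSet_Icc).mono hK

theorem MemH1loc.deriv_sub {u v : ℝ → ℝ} (hu : MemH1loc u) (hv : MemH1loc v) :
    deriv (fun x => u x - v x) =ᵐ[volume] fun x => deriv u x - deriv v x := by
  filter_upwards [hu.ae_differentiableAt, hv.ae_differentiableAt] with x h1 h2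
  exact deriv_fun_sub h1 h2

theorem MemH1loc.sub {u v : ℝ → ℝ} (hu : MemH1loc u) (hv : MemH1loc v) :
    MemH1loc fun x => u x - v x := fun x y =>
  ⟨(hu x y).1.fun_sub (hv x y).1,
    ((hu x y).2.sub (hv x y).2).ae_eq (ae_restrict_of_ae (hu.deriv_sub hv).symm)⟩

/-! ### Local structure of u and the point masses of ω -/

/-- The solution `A eʸ + B e⁻ʸ` of `v'' = v`. -/
def expSol (A B y : ℝ) : ℝ := A * Real.exp y + B * Real.exp (-y)

theorem hasDerivAt_expSol (A B y : ℝ) : HasDerivAt (expSol A B) (expSol A (-B) y) y := by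
  have h1 := (Real.hasDerivAt_exp y).const_mul A
  have h2 := ((hasDerivAt_neg y).exp).const_mul B
  exact (h1.add h2).congr_deriv (by simp only [expSol]; ring)

theorem deriv_expSol (A B : ℝ) : deriv (expSol A B) = expSol A (-B) :=
  funext fun y => (hasDerivAt_expSol A B y).deriv

theorem contDiff_expSol (A B : ℝ) : ContDiff ℝ 1 (expSol A B) := by
  unfold expSol; fun_prop

/-- Integration by parts: for v'' = v the integrand v h + v' h' is the derivative of v' h. -/
theorem integral_expSol_mul {h : ℝ → ℝ} {p q : ℝ} (hh : AbsolutelyContinuousOnInterval h p q)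
    (A B : ℝ) : ∫ y in p..q, expSol A B y * h y + expSol A (-B) y * deriv h y =
      expSol A (-B) q * h q - expSol A (-B) p * h p := by
  have := AbsolutelyContinuousOnInterval.integral_deriv_mul_eq_sub
    (contDiff_expSol A (-B)).contDiffOn.absolutelyContinuousOnInterval hh
  rw [← this, deriv_expSol, neg_neg]

theorem exists_expSol {p q : ℝ} (hpq : p < q) (α β : ℝ) :
    ∃ A B, expSol A B p = α ∧ expSol A B q = β := by
  have hs : Real.exp q * Real.exp (-p) - Real.exp p * Real.exp (-q) ≠ 0 := by
    rw [← Real.exp_add, ← Real.exp_add]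
    have := Real.exp_lt_exp.2 (show p + -q < q + -p by linarith)
    linarith
  refine ⟨(β * Real.exp (-p) - α * Real.exp (-q)) /
      (Real.exp q * Real.exp (-p) - Real.exp p * Real.exp (-q)),
    (α * Real.exp q - β * Real.exp p) /
      (Real.exp q * Real.exp (-p) - Real.exp p * Real.exp (-q)), ?_, ?_⟩
  · rw [expSol, div_mul_eq_mul_div, div_mul_eq_mul_div, ← add_div, div_eq_iff hs]; ring
  · rw [expSol, div_mul_eq_mul_div, div_mul_eq_mul_div, ← add_div, div_eq_iff hs]; ring

theorem deriv_eq_zero_of_eq_zero_off {h : ℝ → ℝ} {p q : ℝ} (h0 : ∀ y ∉ Set.Icc p q, h y = 0)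
    {y : ℝ} (hy : y ∉ Set.Icc p q) : deriv h y = 0 := by
  have : h =ᶠ[𝓝 y] fun _ => 0 := by
    filter_upwards [isClosed_Icc.isOpen_compl.mem_nhds hy] with z hz using h0 z hz
  rw [this.deriv_eq]; simp

theorem integral_eq_intervalIntegral {f : ℝ → ℝ} {p q : ℝ} (hpq : p ≤ q)
    (h0 : ∀ y ∉ Set.Icc p q, f y = 0) : ∫ y, f y = ∫ y in p..q, f y := by
  rw [← setIntegral_eq_integral_of_forall_compl_eq_zero h0, integral_Icc_eq_integral_Ioc,
    intervalIntegral.integral_of_le hpq]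

theorem MemH1loc.intervalIntegrable_deriv_mul {u h : ℝ → ℝ} (hu : MemH1loc u) (hh : MemH1loc h)
    {p q : ℝ} (hpq : p ≤ q) : IntervalIntegrable (fun y => deriv u y * deriv h y) volume p q := by
  rw [intervalIntegrable_iff_integrableOn_Icc_of_le hpq]
  exact (hu p q).2.integrable_mul (hh p q).2

theorem omega_eq_intervalIntegral {u h : ℝ → ℝ} (hu : MemH1loc u) (hh : MemH1loc h) {p q : ℝ}
    (hpq : p ≤ q) (h0 : ∀ y ∉ Set.Icc p q, h y = 0) :
    omega u h = ∫ y in p..q, u y * h y + deriv u y * deriv h y := by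
  have hi : IntervalIntegrable (fun y => u y * h y) volume p q :=
    (hu.continuous.mul hh.continuous).intervalIntegrable _ _
  rw [omega, integral_eq_intervalIntegral hpq (f := fun y => u y * h y)
      (fun y hy => by simp [h0 y hy]),
    integral_eq_intervalIntegral hpq (f := fun y => deriv u y * deriv h y)
      (fun y hy => by simp [deriv_eq_zero_of_eq_zero_off h0 hy]),
    intervalIntegral.integral_add hi
      (hu.intervalIntegrable_deriv_mul hh hpq)]

theorem exists_Icc_of_hasCompactSupport {h : ℝ → ℝ} (hh : HasCompactSupport h) :
    ∃ p q, p ≤ q ∧ ∀ y ∉ Set.Icc p q, h y = 0 := by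
  obtain ⟨r, hr⟩ := hh.isCompact.isBounded.subset_closedBall 0
  refine ⟨-|r|, |r|, by linarith [abs_nonneg r], fun y hy => ?_⟩
  by_contra hne
  apply hy
  have h1 := hr (subset_tsupport h hne)
  rw [Metric.mem_closedBall, dist_zero_right, Real.norm_eq_abs] at h1
  exact abs_le.1 (h1.trans (le_abs_self r))

theorem omega_sub {u v h : ℝ → ℝ} (hu : MemH1loc u) (hv : MemH1loc v) (hh : MemH1c h) :
    omega (fun x => u x - v x) h = omega u h - omega v h := by
  obtain ⟨p, q, hpq, h0⟩ := exists_Icc_of_hasCompactSupport hh.2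
  rw [omega_eq_intervalIntegral (hu.sub hv) hh.1 hpq h0, omega_eq_intervalIntegral hu hh.1 hpq h0,
    omega_eq_intervalIntegral hv hh.1 hpq h0, ← intervalIntegral.integral_sub]
  · refine intervalIntegral.integral_congr_ae ?_
    filter_upwards [hu.deriv_sub hv] with x hx _
    rw [hx]; ring
  · exact ((hu.continuous.mul hh.1.continuous).intervalIntegrable _ _).add
      (hu.intervalIntegrable_deriv_mul hh.1 hpq)
  · exact ((hv.continuous.mul hh.1.continuous).intervalIntegrable _ _).add
      (hv.intervalIntegrable_deriv_mul hh.1 hpq)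

/-- Restriction to `[p, q]`, extended by zero. -/
def cutOff (p q : ℝ) (g : ℝ → ℝ) : ℝ → ℝ := (Set.Icc p q).indicator g

theorem deriv_cutOff {p q : ℝ} (g : ℝ → ℝ) :
    deriv (cutOff p q g) =ᵐ[volume] (Set.Icc p q).indicator (deriv g) := by
  have hp : ∀ᵐ y : ℝ, y ≠ p := by simp [ae_iff]
  have hq : ∀ᵐ y : ℝ, y ≠ q := by simp [ae_iff]
  filter_upwards [hp, hq] with y h1 h2
  by_cases hy : y ∈ Set.Icc p q
  · have hy' : y ∈ Set.Ioo p q := ⟨lt_of_le_of_ne hy.1 h1.symm, lt_of_le_of_ne hy.2 h2⟩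
    have : cutOff p q g =ᶠ[𝓝 y] g := by
      filter_upwards [Ioo_mem_nhds hy'.1 hy'.2] with z hz
      exact Set.indicator_of_mem (Set.Ioo_subset_Icc_self hz) _
    rw [this.deriv_eq, Set.indicator_of_mem hy]
  · rw [Set.indicator_of_notMem hy]
    exact deriv_eq_zero_of_eq_zero_off (fun z hz => Set.indicator_of_notMem hz _) hy

/-- The cut-off is the primitive of the truncated derivative: the conditions g p = 0 and g q = 0
make this primitive vanish outside the interval, and primitives are absolutely continuous. -/
theorem cutOff_memH1loc {p q : ℝ} (hpq : p ≤ q) {g : ℝ → ℝ} (hg : MemH1loc g) (hgp : g p = 0)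
    (hgq : g q = 0) : MemH1loc (cutOff p q g) := by
  set k : ℝ → ℝ := (Set.Icc p q).indicator (deriv g) with hk
  have hL : ∀ x y, MemLp k 2 (volume.restrict (Set.Icc x y)) := fun x y =>
    (hg x y).2.indicator measurableSet_Icc
  have hI : ∀ x y, IntervalIntegrable k volume x y := by
    intro x y
    rw [intervalIntegrable_iff]
    exact ((hL (min x y) (max x y)).integrable (by norm_num)).mono_measure
      (Measure.restrict_mono Set.Ioc_subset_Icc_self le_rfl)
  have hprim : ∀ y, ∫ t in p..y, k t = cutOff p q g y := by
    have hin : ∀ y ∈ Set.Icc p q, ∫ t in p..y, k t = g y := by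
      intro y hy
      have : ∫ t in p..y, k t = ∫ t in p..y, deriv g t := by
        refine intervalIntegral.integral_congr fun t ht => ?_
        rw [Set.uIcc_of_le hy.1] at ht
        have hm : t ∈ Set.Icc p q := ⟨ht.1, ht.2.trans hy.2⟩
        show k t = deriv g t
        rw [hk, Set.indicator_of_mem hm]
      rw [this, (hg p y).1.integral_deriv_eq_sub, hgp, sub_zero]
    intro y
    by_cases hy : y ∈ Set.Icc p q
    · rw [hin y hy, cutOff, Set.indicator_of_mem hy]
    · rw [cutOff, Set.indicator_of_notMem hy]
      rcases lt_or_ge y p with h1 | h1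
      · rw [intervalIntegral.integral_congr_ae (g := fun _ => (0 : ℝ))]
        · simp
        · have hp : ∀ᵐ y : ℝ, y ≠ p := by simp [ae_iff]
          filter_upwards [hp] with t ht htt
          rw [Set.uIoc_of_ge h1.le] at htt
          have hn : t ∉ Set.Icc p q := fun hh => ht (le_antisymm htt.2 hh.1)
          rw [hk, Set.indicator_of_notMem hn]
      · have h2 : q < y := by
          by_contra h3; exact hy ⟨h1, not_lt.1 h3⟩
        rw [← intervalIntegral.integral_add_adjacent_intervals (hI p q) (hI q y),
          hin q ⟨hpq, le_rfl⟩, hgq, zero_add, intervalIntegral.integral_congr_ae (g := fun _ => (0 : ℝ))]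
        · simp
        · refine Eventually.of_forall fun t htt => ?_
          rw [Set.uIoc_of_le h2.le] at htt
          have hn : t ∉ Set.Icc p q := fun hh => not_lt.2 hh.2 htt.1
          rw [hk, Set.indicator_of_notMem hn]
  intro x y
  refine ⟨?_, (hL x y).ae_eq (ae_restrict_of_ae (deriv_cutOff g).symm)⟩
  have hac := (hI (min p (min x y)) (max p (max x y))).absolutelyContinuousOnInterval_intervalIntegral
    (c := p) (by rw [Set.uIcc_of_le (by simp)]; simp)
  have hfun : (fun y => ∫ t in p..y, k t) = cutOff p q g := funext hprim
  rw [hfun] at hac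
  refine hac.mono (Set.uIcc_subset_uIcc ?_ ?_) <;>
    · rw [Set.uIcc_of_le (by simp)]; simp

theorem cutOff_memH1c {p q : ℝ} (hpq : p ≤ q) {g : ℝ → ℝ} (hg : MemH1loc g) (hgp : g p = 0)
    (hgq : g q = 0) : MemH1c (cutOff p q g) ∧ tsupport (cutOff p q g) ⊆ Set.Icc p q := by
  have hs : tsupport (cutOff p q g) ⊆ Set.Icc p q :=
    closure_minimal (fun y hy => by
      by_contra h; exact hy (Set.indicator_of_notMem h _)) isClosed_Icc
  exact ⟨⟨cutOff_memH1loc hpq hg hgp hgq, isCompact_Icc.of_isClosed_subset (isClosed_tsupport _) hs⟩,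
    hs⟩

/-- Where `ω` vanishes, `u` solves `u'' = u`. -/
theorem exists_expSol_of_omega_eq_zero {u : ℝ → ℝ} (hu : MemH1loc u) {U : Set ℝ}
    (hU : ∀ h, MemH1c h → tsupport h ⊆ U → omega u h = 0) {p q : ℝ} (hpq : p < q)
    (hsub : Set.Icc p q ⊆ U) : ∃ A B, ∀ y ∈ Set.Icc p q, u y = expSol A B y := by
  -- Compare `u` with the exponential solution having the same boundary values. Their difference,
  -- cut off to the interval, is an admissible test function, and testing with it makes its own H¹
  -- energy vanish.
  obtain ⟨A, B, hA, hB⟩ := exists_expSol hpq (u p) (u q)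
  refine ⟨A, B, ?_⟩
  have hV := memH1loc_of_contDiff (contDiff_expSol A B)
  set g : ℝ → ℝ := fun y => u y - expSol A B y with hg
  have hgH : MemH1loc g := hu.sub hV
  have hgp : g p = 0 := by simp [hg, hA]
  have hgq : g q = 0 := by simp [hg, hB]
  obtain ⟨hc, hs⟩ := cutOff_memH1c hpq.le hgH hgp hgq
  set h := cutOff p q g with hh
  have h0 : ∀ y ∉ Set.Icc p q, h y = 0 := fun y hy => Set.indicator_of_notMem hy _
  have hin : ∀ y ∈ Set.Icc p q, h y = g y := fun y hy => Set.indicator_of_mem hy _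
  have e1 := hU h hc (hs.trans hsub)
  rw [omega_eq_intervalIntegral hu hc.1 hpq.le h0] at e1
  have e2 := integral_expSol_mul (hc.1 p q).1 A B
  rw [hin p ⟨le_rfl, hpq.le⟩, hin q ⟨hpq.le, le_rfl⟩, hgp, hgq, mul_zero, mul_zero, sub_zero] at e2
  have i1 : IntervalIntegrable (fun y => u y * h y + deriv u y * deriv h y) volume p q :=
    ((hu.continuous.mul hc.1.continuous).intervalIntegrable _ _).add
      (hu.intervalIntegrable_deriv_mul hc.1 hpq.le)
  have i2 : IntervalIntegrable (fun y => expSol A B y * h y + expSol A (-B) y * deriv h y)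
      volume p q := by
    refine ((hV.continuous.mul hc.1.continuous).intervalIntegrable _ _).add ?_
    have := hV.intervalIntegrable_deriv_mul hc.1 hpq.le
    rwa [deriv_expSol] at this
  have i3 : IntervalIntegrable (fun y => deriv h y * deriv h y) volume p q :=
    hc.1.intervalIntegrable_deriv_mul hc.1 hpq.le
  have i4 : IntervalIntegrable (fun y => h y * h y) volume p q :=
    (hc.1.continuous.mul hc.1.continuous).intervalIntegrable _ _
  have e3 : ∫ y in p..q, (h y * h y + deriv h y * deriv h y) = 0 := by
    have : ∫ y in p..q, (h y * h y + deriv h y * deriv h y) =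
        ∫ y in p..q, ((u y * h y + deriv u y * deriv h y) -
          (expSol A B y * h y + expSol A (-B) y * deriv h y)) := by
      refine intervalIntegral.integral_congr_ae ?_
      filter_upwards [deriv_cutOff (p := p) (q := q) g, hu.deriv_sub hV] with y h1 h2 hy
      rw [Set.uIoc_of_le hpq.le] at hy
      have hy' : y ∈ Set.Icc p q := ⟨hy.1.le, hy.2⟩
      have h3 : deriv h y = deriv u y - expSol A (-B) y := by
        rw [hh, h1, Set.indicator_of_mem hy', hg, h2, deriv_expSol]
      have h4 : h y = u y - expSol A B y := hin y hy'
      rw [h3, h4]; ring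
    rw [this, intervalIntegral.integral_sub i1 i2, e1, e2, sub_zero]
  rw [intervalIntegral.integral_add i4 i3] at e3
  have n3 : 0 ≤ ∫ y in p..q, deriv h y * deriv h y :=
    intervalIntegral.integral_nonneg hpq.le fun y _ => mul_self_nonneg _
  intro y hy
  by_contra hne
  have : 0 < ∫ y in p..q, h y * h y := by
    refine intervalIntegral.integral_pos hpq (hc.1.continuous.mul hc.1.continuous).continuousOn
      (fun z _ => mul_self_nonneg _) ⟨y, hy, mul_self_pos.2 ?_⟩
    rw [hin y hy]; exact sub_ne_zero.2 hne
  linarith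

/-- A function that solves `u'' = u` on both sides of `x` has an `ω`-mass at `x`, namely the jump
of the derivative. -/
theorem isOmegaMassAt_of_expSol {u : ℝ → ℝ} (hu : MemH1loc u) {x ε A₁ B₁ A₂ B₂ : ℝ} (hε : 0 < ε)
    (h₁ : ∀ y ∈ Set.Icc (x - ε) x, u y = expSol A₁ B₁ y)
    (h₂ : ∀ y ∈ Set.Icc x (x + ε), u y = expSol A₂ B₂ y) :
    IsOmegaMassAt u x (expSol A₁ (-B₁) x - expSol A₂ (-B₂) x) := by
  refine ⟨Set.Ioo (x - ε) (x + ε), isOpen_Ioo, ⟨by linarith, by linarith⟩, fun h hh hs => ?_⟩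
  have h0' : ∀ y ∉ Set.Ioo (x - ε) (x + ε), h y = 0 := fun y hy => by
    by_contra hne; exact hy (hs (subset_tsupport h hne))
  have h0 : ∀ y ∉ Set.Icc (x - ε) (x + ε), h y = 0 := fun y hy =>
    h0' y fun hy' => hy (Set.Ioo_subset_Icc_self hy')
  have hI : ∀ p q, p ≤ q → IntervalIntegrable (fun y => u y * h y + deriv u y * deriv h y)
      volume p q := fun p q hpq => ((hu.continuous.mul hh.1.continuous).intervalIntegrable _ _).add
      (hu.intervalIntegrable_deriv_mul hh.1 hpq)
  have key : ∀ p q A B, p < q → (∀ y ∈ Set.Icc p q, u y = expSol A B y) →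
      ∫ y in p..q, (u y * h y + deriv u y * deriv h y) =
        expSol A (-B) q * h q - expSol A (-B) p * h p := by
    intro p q A B hpq hy
    rw [← integral_expSol_mul (hh.1 p q).1 A B]
    refine intervalIntegral.integral_congr_ae ?_
    have hq : ∀ᵐ y : ℝ, y ≠ q := by simp [ae_iff]
    filter_upwards [hq] with t ht htt
    rw [Set.uIoc_of_le hpq.le] at htt
    have htI : t ∈ Set.Ioo p q := ⟨htt.1, lt_of_le_of_ne htt.2 ht⟩
    have : u =ᶠ[𝓝 t] expSol A B := by
      filter_upwards [Ioo_mem_nhds htI.1 htI.2] with z hz using hy z (Set.Ioo_subset_Icc_self hz)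
    rw [this.deriv_eq, deriv_expSol, hy t (Set.Ioo_subset_Icc_self htI)]
  rw [omega_eq_intervalIntegral hu hh.1 (by linarith) h0,
    ← intervalIntegral.integral_add_adjacent_intervals (hI (x - ε) x (by linarith))
      (hI x (x + ε) (by linarith)), key _ _ _ _ (by linarith) h₁, key _ _ _ _ (by linarith) h₂,
    h0' (x - ε) (by simp), h0' (x + ε) (by simp)]
  ring

/-- The tent function at `x`. -/
def tent (x ε y : ℝ) : ℝ := max 0 (ε - |y - x|)

theorem tent_memH1c {x ε : ℝ} (hε : 0 < ε) : MemH1c (tent x ε) ∧ tent x ε x = ε ∧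
    tsupport (tent x ε) ⊆ Set.Icc (x - ε) (x + ε) := by
  have hs : tsupport (tent x ε) ⊆ Set.Icc (x - ε) (x + ε) := by
    refine closure_minimal (fun y hy => ?_) isClosed_Icc
    by_contra h
    apply hy
    rw [tent, max_eq_left]
    by_contra h'
    push Not at h'
    have := abs_lt.1 (show |y - x| < ε by linarith)
    exact h ⟨by linarith, by linarith⟩
  refine ⟨⟨memH1loc_of_lipschitzWith (K := 1) ?_,
    isCompact_Icc.of_isClosed_subset (isClosed_tsupport _) hs⟩, by simp [tent, hε.le], hs⟩
  refine LipschitzWith.of_dist_le_mul fun y z => ?_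
  simp only [tent, Real.dist_eq, NNReal.coe_one, one_mul]
  refine (abs_max_sub_max_le_max _ _ _ _).trans ?_
  refine max_le (by simp) ?_
  rw [show ε - |y - x| - (ε - |z - x|) = |z - x| - |y - x| by ring]
  refine (abs_abs_sub_abs_le _ _).trans ?_
  rw [abs_sub_comm]; simp

theorem exists_test_function {U : Set ℝ} (hU : IsOpen U) {x : ℝ} (hx : x ∈ U) :
    ∃ h, MemH1c h ∧ tsupport h ⊆ U ∧ h x ≠ 0 := by
  obtain ⟨ε, hε, hb⟩ := Metric.isOpen_iff.1 hU x hx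
  obtain ⟨h1, h2, h3⟩ := tent_memH1c (x := x) (half_pos hε)
  refine ⟨_, h1, h3.trans fun y hy => hb ?_, by rw [h2]; positivity⟩
  rw [Metric.mem_ball, Real.dist_eq, abs_lt]
  exact ⟨by linarith [hy.1], by linarith [hy.2]⟩

theorem IsOmegaMassAt.unique {u : ℝ → ℝ} {x w w' : ℝ} (h : IsOmegaMassAt u x w)
    (h' : IsOmegaMassAt u x w') : w = w' := by
  obtain ⟨U, hU, hx, hw⟩ := h
  obtain ⟨U', hU', hx', hw'⟩ := h'
  obtain ⟨f, hf, hs, hne⟩ := exists_test_function (hU.inter hU') ⟨hx, hx'⟩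
  have e1 := hw f hf (hs.trans Set.inter_subset_left)
  rw [hw' f hf (hs.trans Set.inter_subset_right)] at e1
  exact (mul_right_cancel₀ hne e1).symm

theorem omegaMass_spec {u : ℝ → ℝ} {x : ℝ} (h : ∃ w, IsOmegaMassAt u x w) :
    IsOmegaMassAt u x (omegaMass u x) := Classical.epsilon_spec h

theorem IsOmegaMassAt.omegaMass_eq {u : ℝ → ℝ} {x w : ℝ} (h : IsOmegaMassAt u x w) :
    omegaMass u x = w := (omegaMass_spec ⟨w, h⟩).unique h

theorem notMem_omegaSupport_iff {u : ℝ → ℝ} {x : ℝ} :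
    x ∉ omegaSupport u ↔ IsOmegaMassAt u x 0 := by
  simp only [omegaSupport, Set.mem_ofPred_eq, IsOmegaMassAt, zero_mul]
  push Not
  rfl

theorem isClosed_omegaSupport (u : ℝ → ℝ) : IsClosed (omegaSupport u) := by
  rw [← isOpen_compl_iff, isOpen_iff_mem_nhds]
  intro x hx
  obtain ⟨U, hU, hxU, h⟩ := notMem_omegaSupport_iff.1 hx
  filter_upwards [hU.mem_nhds hxU] with y hy
  exact notMem_omegaSupport_iff.2 ⟨U, hU, hy, by simpa using h⟩

theorem IsOmegaMassAt.eventually_notMem {u : ℝ → ℝ} {x w : ℝ} (h : IsOmegaMassAt u x w) :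
    ∀ᶠ y in 𝓝[≠] x, y ∉ omegaSupport u := by
  obtain ⟨U, hU, hx, hw⟩ := h
  filter_upwards [mem_nhdsWithin_of_mem_nhds (hU.mem_nhds hx), self_mem_nhdsWithin] with y hy hne
  refine notMem_omegaSupport_iff.2 ⟨U ∩ {x}ᶜ, hU.inter isOpen_compl_singleton, ⟨hy, hne⟩,
    fun h hh hs => ?_⟩
  rw [hw h hh (hs.trans Set.inter_subset_left)]
  have : h x = 0 := by
    by_contra h1
    exact (hs (subset_tsupport h h1)).2 rfl
  rw [this]; ring

/-- On an interval that does not meet the support of `ω`, `u` solves `u'' = u`. -/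
theorem exists_expSol_of_disjoint {u : ℝ → ℝ} (hu : MemH1loc u) {α β : ℝ}
    (hd : ∀ y ∈ Set.Ioo α β, y ∉ omegaSupport u) :
    ∃ A B, ∀ y ∈ Set.Ioo α β, u y = expSol A B y := by
  have hloc : ∀ y ∈ Set.Ioo α β, ∃ A B, u =ᶠ[𝓝 y] expSol A B := by
    intro y hy
    obtain ⟨U, hU, hyU, h⟩ := notMem_omegaSupport_iff.1 (hd y hy)
    obtain ⟨ε, hε, hb⟩ := Metric.isOpen_iff.1 hU y hyU
    obtain ⟨A, B, hAB⟩ := exists_expSol_of_omega_eq_zero hu (U := U) (by simpa using h)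
      (p := y - ε / 2) (q := y + ε / 2) (by linarith) (fun z hz => hb (by
        rw [Metric.mem_ball, Real.dist_eq, abs_lt]
        exact ⟨by linarith [hz.1], by linarith [hz.2]⟩))
    refine ⟨A, B, ?_⟩
    filter_upwards [Icc_mem_nhds (show y - ε / 2 < y by linarith) (show y < y + ε / 2 by linarith)]
      with z hz using hAB z hz
  -- The coefficients A and B are read off from u and u' by formulas that do not refer to the
  -- neighbourhood. They are locally constant, hence constant on the whole interval.
  have hcoef : ∀ y ∈ Set.Ioo α β, ∃ A B,
      (fun z => (u z + deriv u z) * Real.exp (-z) / 2) =ᶠ[𝓝 y] (fun _ => A) ∧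
      (fun z => (u z - deriv u z) * Real.exp z / 2) =ᶠ[𝓝 y] (fun _ => B) := by
    intro y hy
    obtain ⟨A, B, hAB⟩ := hloc y hy
    have hd : deriv u =ᶠ[𝓝 y] expSol A (-B) := by
      have := hAB.deriv
      rwa [deriv_expSol] at this
    have he : ∀ z : ℝ, Real.exp z * Real.exp (-z) = 1 := fun z => by
      rw [← Real.exp_add]; simp
    refine ⟨A, B, ?_, ?_⟩
    · filter_upwards [hAB, hd] with z h1 h2
      rw [h1, h2]; simp only [expSol]
      linear_combination A * he z
    · filter_upwards [hAB, hd] with z h1 h2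
      rw [h1, h2]; simp only [expSol]
      linear_combination B * he z
  have hconst : ∀ f : ℝ → ℝ, (∀ y ∈ Set.Ioo α β, ∃ c, f =ᶠ[𝓝 y] fun _ => c) →
      ∃ a, ∀ x ∈ Set.Ioo α β, f x = a := by
    intro f hf
    refine isOpen_Ioo.exists_is_const_of_deriv_eq_zero isPreconnected_Ioo ?_ ?_
    · intro y hy
      obtain ⟨c, hc⟩ := hf y hy
      exact (hc.differentiableAt_iff.2 (differentiableAt_const c)).differentiableWithinAt
    · intro y hy
      obtain ⟨c, hc⟩ := hf y hy
      rw [hc.deriv_eq]; simp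
  obtain ⟨A, hA⟩ := hconst _ fun y hy => (hcoef y hy).imp fun A h => h.choose_spec.1
  obtain ⟨B, hB⟩ := hconst _ fun y hy => by
    obtain ⟨A, B, -, h⟩ := hcoef y hy
    exact ⟨B, h⟩
  refine ⟨A, B, fun y hy => ?_⟩
  have e1 := hA y hy
  have e2 := hB y hy
  have he : Real.exp y * Real.exp (-y) = 1 := by rw [← Real.exp_add]; simp
  rw [expSol, ← e1, ← e2]
  linear_combination (-u y) * he

/-- Around an isolated point of the support, u is an exponential solution on either side, up to the
point by continuity. The jump of u' is the mass. -/
theorem exists_isOmegaMassAt {u : ℝ → ℝ} (hu : MemH1loc u) (hd : IsDiscrete (omegaSupport u))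
    (x : ℝ) : ∃ w, IsOmegaMassAt u x w := by
  by_cases hx : x ∈ omegaSupport u
  · obtain ⟨ε, hε, hb⟩ := Metric.exists_ball_inter_eq_singleton_of_mem_discrete hd hx
    have hn : ∀ y, y ≠ x → |y - x| < ε → y ∉ omegaSupport u := by
      intro y hne hy hmem
      have : y ∈ Metric.ball x ε ∩ omegaSupport u := ⟨by rwa [Metric.mem_ball, Real.dist_eq], hmem⟩
      rw [hb] at this
      exact hne this
    obtain ⟨A₁, B₁, h₁⟩ := exists_expSol_of_disjoint hu (α := x - ε) (β := x) fun y hy =>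
      hn y hy.2.ne (abs_lt.2 ⟨by linarith [hy.1], by linarith [hy.2]⟩)
    obtain ⟨A₂, B₂, h₂⟩ := exists_expSol_of_disjoint hu (α := x) (β := x + ε) fun y hy =>
      hn y hy.1.ne' (abs_lt.2 ⟨by linarith [hy.1], by linarith [hy.2]⟩)
    have hext : ∀ α β A B, α < β → (∀ y ∈ Set.Ioo α β, u y = expSol A B y) →
        ∀ y ∈ Set.Icc α β, u y = expSol A B y := by
      intro α β A B hαβ h
      have : Set.EqOn u (expSol A B) (closure (Set.Ioo α β)) :=
        Set.EqOn.closure h hu.continuous (contDiff_expSol A B).continuous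
      rwa [closure_Ioo hαβ.ne] at this
    exact ⟨_, isOmegaMassAt_of_expSol hu hε (hext _ _ _ _ (by linarith) h₁)
      (hext _ _ _ _ (by linarith) h₂)⟩
  · exact ⟨0, notMem_omegaSupport_iff.1 hx⟩

/-- The difference has no masses, so it is one combination of eʸ and e⁻ʸ on an interval longer than
two periods. Equal values at x, x + ℓ and x + 2ℓ force both coefficients to vanish. -/
theorem eq_of_omegaMass_eq {ℓ : ℝ} (hℓ : 0 < ℓ) {u v : ℝ → ℝ} (hu : MemH1loc u) (hv : MemH1loc v)
    (pu : Function.Periodic u ℓ) (pv : Function.Periodic v ℓ)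
    (h : ∀ x, ∃ w, IsOmegaMassAt u x w ∧ IsOmegaMassAt v x w) : u = v := by
  set d : ℝ → ℝ := fun x => u x - v x with hdef
  have hd : MemH1loc d := hu.sub hv
  have hns : ∀ x, x ∉ omegaSupport d := by
    intro x
    obtain ⟨w, ⟨U, hU, hxU, h1⟩, ⟨V, hV, hxV, h2⟩⟩ := h x
    refine notMem_omegaSupport_iff.2 ⟨U ∩ V, hU.inter hV, ⟨hxU, hxV⟩, fun f hf hs => ?_⟩
    rw [hdef, omega_sub hu hv hf, h1 f hf (hs.trans Set.inter_subset_left),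
      h2 f hf (hs.trans Set.inter_subset_right)]
    ring
  have pd : Function.Periodic d ℓ := fun x => by simp only [hdef, pu x, pv x]
  funext x
  obtain ⟨A, B, hAB⟩ := exists_expSol_of_disjoint hd (α := x - 1) (β := x + 2 * ℓ + 1)
    fun y _ => hns y
  have e0 := hAB x ⟨by linarith, by linarith⟩
  have e1 := hAB (x + ℓ) ⟨by linarith, by linarith⟩
  have e2 := hAB (x + ℓ + ℓ) ⟨by linarith, by linarith⟩
  rw [pd, pd] at e2
  rw [pd] at e1
  simp only [expSol, neg_add, Real.exp_add] at e0 e1 e2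
  set E := Real.exp ℓ with hE
  have hE1 : 1 < E := Real.one_lt_exp_iff.2 hℓ
  have hEi : Real.exp (-ℓ) = E⁻¹ := Real.exp_neg ℓ
  rw [hEi] at e1 e2
  set a := A * Real.exp x with ha
  set b := B * Real.exp (-x) with hb
  have hE0 : E ≠ 0 := by positivity
  have f1 : d x = a * E + b * E⁻¹ := by rw [e1, ha, hb]; ring
  have f2 : d x = a * E ^ 2 + b * E⁻¹ ^ 2 := by rw [e2, ha, hb]; ring
  have g1 : a * E = b := by
    have : (a * E - b) * (E - 1) = 0 := by
      have : a + b - (a * E + b * E⁻¹) = 0 := by rw [← e0, ← f1]; ring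
      field_simp at this
      linear_combination -this
    rcases mul_eq_zero.1 this with h | h
    · linarith
    · linarith
  have g2 : a = 0 := by
    have h3 : a * E + b * E⁻¹ - (a * E ^ 2 + b * E⁻¹ ^ 2) = 0 := by rw [← f1, ← f2]; ring
    have : a * ((E - 1) * (E ^ 2 - 1)) = 0 := by
      rw [← g1] at h3
      field_simp at h3
      linear_combination -h3
    have h4 : (E - 1) * (E ^ 2 - 1) ≠ 0 := by
      have : 1 < E ^ 2 := by nlinarith
      exact mul_ne_zero (by linarith) (by linarith)
    exact (mul_eq_zero.1 this).resolve_right h4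
  have : d x = 0 := by rw [e0, ← g1, g2]; ring
  exact sub_eq_zero.1 this

/-! ### The singular set -/

theorem MemP.finite_inter_Icc {ℓ : ℝ} {p : (ℝ → ℝ) × Measure ℝ} (hp : MemP ℓ p) (x y : ℝ) :
    (singularSet p ∩ Set.Icc x y).Finite := by
  rw [singularSet, Set.union_inter_distrib_right]
  exact ((isCompact_Icc.inter_left (isClosed_omegaSupport _)).finite
    (hp.discrete_omega.mono Set.inter_subset_left)).union
    ((isCompact_Icc.inter_left Measure.isClosed_support).finite
    (hp.discrete_upsilon.mono Set.inter_subset_left))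

theorem MemP.isOmegaMassAt {ℓ : ℝ} {p : (ℝ → ℝ) × Measure ℝ} (hp : MemP ℓ p) (x : ℝ) :
    IsOmegaMassAt p.1 x (omegaMass p.1 x) :=
  omegaMass_spec (exists_isOmegaMassAt hp.memD.memH1loc hp.discrete_omega x)

theorem MemD.upsilon_le {ℓ : ℝ} {p : (ℝ → ℝ) × Measure ℝ} (hp : MemD ℓ p) : upsilon p ≤ p.2 := by
  conv_rhs => rw [upsilon_add_energyMeasure hp]
  exact Measure.le_add_right le_rfl

theorem MemD.isLocallyFinite_upsilon {ℓ : ℝ} {p : (ℝ → ℝ) × Measure ℝ} (hp : MemD ℓ p) :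
    IsLocallyFiniteMeasure (upsilon p) := by
  have := hp.locallyFinite
  refine ⟨fun x => ?_⟩
  obtain ⟨s, hs, hlt⟩ := p.2.finiteAt_nhds x
  exact ⟨s, hs, (hp.upsilon_le s).trans_lt hlt⟩

theorem MemD.upsilon_singleton {ℓ : ℝ} {p : (ℝ → ℝ) × Measure ℝ} (hp : MemD ℓ p) (x : ℝ) :
    upsilon p {x} = ENNReal.ofReal (upsilonMass p x) := by
  have := hp.isLocallyFinite_upsilon
  rw [upsilonMass, ENNReal.ofReal_toReal]
  exact (isCompact_singleton.measure_lt_top).ne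

theorem upsilonMass_nonneg (p : (ℝ → ℝ) × Measure ℝ) (x : ℝ) : 0 ≤ upsilonMass p x :=
  ENNReal.toReal_nonneg

theorem upsilonMass_eq_zero_of_notMem {p : (ℝ → ℝ) × Measure ℝ} {x : ℝ}
    (hx : x ∉ (upsilon p).support) : upsilonMass p x = 0 := by
  have : upsilon p {x} = 0 := measure_mono_null (Set.singleton_subset_iff.2 hx)
    Measure.measure_compl_support
  rw [upsilonMass, this, ENNReal.toReal_zero]

/-- Without mass at an isolated point of the support, a whole ball around it would be a null set. -/
theorem MemP.upsilonMass_ne_zero {ℓ : ℝ} {p : (ℝ → ℝ) × Measure ℝ} (hp : MemP ℓ p) {x : ℝ}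
    (hx : x ∈ (upsilon p).support) : upsilonMass p x ≠ 0 := by
  intro h0
  have hs := hp.memD.upsilon_singleton x
  rw [h0, ENNReal.ofReal_zero] at hs
  obtain ⟨ε, hε, hb⟩ := Metric.exists_ball_inter_eq_singleton_of_mem_discrete hp.discrete_upsilon hx
  have hpos := (Measure.mem_support_iff_forall x).1 hx (Metric.ball x ε) (Metric.ball_mem_nhds x hε)
  have : upsilon p (Metric.ball x ε) = 0 := by
    have hsub : Metric.ball x ε ⊆ {x} ∪ ((upsilon p).support)ᶜ := by
      intro y hy
      by_cases h : y ∈ (upsilon p).support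
      · left; rw [← hb]; exact ⟨hy, h⟩
      · right; exact h
    exact measure_mono_null hsub (measure_union_null hs Measure.measure_compl_support)
  rw [this] at hpos
  exact lt_irrefl _ hpos

theorem MemP.mem_singularSet_iff {ℓ : ℝ} {p : (ℝ → ℝ) × Measure ℝ} (hp : MemP ℓ p) {x : ℝ} :
    x ∈ singularSet p ↔ omegaMass p.1 x ≠ 0 ∨ upsilonMass p x ≠ 0 := by
  constructor
  · rintro (h | h)
    · left
      intro h0
      have := hp.isOmegaMassAt x
      rw [h0] at this
      exact notMem_omegaSupport_iff.2 this h
    · exact Or.inr (hp.upsilonMass_ne_zero h)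
  · rintro (h | h)
    · left
      by_contra h0
      exact h (notMem_omegaSupport_iff.1 h0).omegaMass_eq
    · right
      by_contra h0
      exact h (upsilonMass_eq_zero_of_notMem h0)

theorem eq_sum_dirac_of_countable {ν : Measure ℝ} {s : Set ℝ} (hs : s.Countable)
    (h : ν sᶜ = 0) : ν = Measure.sum fun x : s => ν {(x : ℝ)} • Measure.dirac (x : ℝ) := by
  have h1 : ν.restrict s = ν := Measure.restrict_eq_self_of_ae_mem h
  have h2 := Measure.restrict_biUnion (μ := ν) (T := s) (s := fun x : ℝ => ({x} : Set ℝ)) hs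
    (fun x _ y _ hxy => Set.disjoint_singleton.2 hxy) (fun x => measurableSet_singleton x)
  rw [Set.biUnion_of_singleton, h1] at h2
  conv_lhs => rw [h2]
  simp only [Measure.restrict_singleton]

theorem MemP.upsilon_eq_of_mass_eq {ℓ : ℝ} {p p' : (ℝ → ℝ) × Measure ℝ} (hp : MemP ℓ p)
    (hp' : MemP ℓ p') (h : ∀ x, upsilonMass p x = upsilonMass p' x) : upsilon p = upsilon p' := by
  have hsupp : (upsilon p).support = (upsilon p').support := by
    ext x
    constructor
    · intro hx; by_contra hx'
      exact hp.upsilonMass_ne_zero hx ((h x).trans (upsilonMass_eq_zero_of_notMem hx'))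
    · intro hx; by_contra hx'
      exact hp'.upsilonMass_ne_zero hx ((h x).symm.trans (upsilonMass_eq_zero_of_notMem hx'))
  have hc : (upsilon p).support.Countable := by
    have := hp.discrete_upsilon.to_subtype
    exact Set.countable_coe_iff.1 (TopologicalSpace.separableSpace_iff_countable.1 inferInstance)
  have e1 := eq_sum_dirac_of_countable hc Measure.measure_compl_support
  have e2 := eq_sum_dirac_of_countable (ν := upsilon p') hc
    (by rw [hsupp]; exact Measure.measure_compl_support)
  have e3 : ∀ x : ℝ, upsilon p {x} = upsilon p' {x} := fun x => by
    rw [hp.memD.upsilon_singleton, hp'.memD.upsilon_singleton, h]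
  simp only [← e3] at e2
  exact e1.trans e2.symm

theorem MemP.eq_of_mass_eq {ℓ : ℝ} (hℓ : 0 < ℓ) {p p' : (ℝ → ℝ) × Measure ℝ} (hp : MemP ℓ p)
    (hp' : MemP ℓ p') (hw : ∀ x, omegaMass p.1 x = omegaMass p'.1 x)
    (hv : ∀ x, upsilonMass p x = upsilonMass p' x) : p = p' := by
  have hu : p.1 = p'.1 := eq_of_omegaMass_eq hℓ hp.memD.memH1loc hp'.memD.memH1loc
    hp.memD.periodic_u hp'.memD.periodic_u fun x =>
      ⟨_, hp.isOmegaMassAt x, hw x ▸ hp'.isOmegaMassAt x⟩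
  refine Prod.ext hu ?_
  rw [upsilon_add_energyMeasure hp.memD, upsilon_add_energyMeasure hp'.memD, hu,
    hp.upsilon_eq_of_mass_eq hp' hv]

/-! ### Periodicity -/

theorem MemH1loc.comp_add {h : ℝ → ℝ} (hh : MemH1loc h) (t : ℝ) : MemH1loc fun x => h (x + t) := by
  have hd : deriv (fun x => h (x + t)) = fun x => deriv h (x + t) :=
    funext fun x => deriv_comp_add_const ..
  intro x y
  constructor
  · have hI : IntervalIntegrable (fun s => deriv h (s + t)) volume x y := by
      have := (hh (x + t) (y + t)).1.intervalIntegrable_deriv.comp_add_right t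
      simpa using this
    have hac := hI.absolutelyContinuousOnInterval_intervalIntegral (c := x) (by simp)
    have hc : AbsolutelyContinuousOnInterval (fun _ : ℝ => h (x + t)) x y :=
      (contDiff_const (n := 1)).contDiffOn.absolutelyContinuousOnInterval
    have he : (fun y => h (y + t)) = fun y => h (x + t) + ∫ s in x..y, deriv h (s + t) := by
      funext y
      rw [intervalIntegral.integral_comp_add_right, (hh _ _).1.integral_deriv_eq_sub]
      ring
    rw [he]
    exact hc.fun_add hac
  · rw [hd]
    have hmp := (measurePreserving_add_right volume t).restrict_preimage
      (measurableSet_Icc (a := x + t) (b := y + t))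
    have : (fun z : ℝ => z + t) ⁻¹' Set.Icc (x + t) (y + t) = Set.Icc x y := by
      ext z; simp
    rw [this] at hmp
    exact (hh (x + t) (y + t)).2.comp_measurePreserving hmp

theorem omega_comp_add {u h : ℝ → ℝ} {ℓ : ℝ} (hu : Function.Periodic u ℓ) :
    omega u (fun x => h (x + ℓ)) = omega u h := by
  have hd : deriv (fun x => h (x + ℓ)) = fun x => deriv h (x + ℓ) :=
    funext fun x => deriv_comp_add_const ..
  have hdu : ∀ x, deriv u (x + ℓ) = deriv u x := fun x => by
    rw [← deriv_comp_add_const]; congr 1; exact funext hu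
  rw [omega, omega, hd, ← integral_add_right_eq_self (fun x => u x * h x) ℓ,
    ← integral_add_right_eq_self (fun x => deriv u x * deriv h x) ℓ]
  simp only [hu _, hdu]

theorem IsOmegaMassAt.add_period {u : ℝ → ℝ} {ℓ x w : ℝ} (hu : Function.Periodic u ℓ)
    (h : IsOmegaMassAt u x w) : IsOmegaMassAt u (x + ℓ) w := by
  obtain ⟨U, hU, hx, hw⟩ := h
  refine ⟨(fun y => y - ℓ) ⁻¹' U, hU.preimage (by fun_prop), by simpa using hx, fun f hf hs => ?_⟩
  rw [← omega_comp_add hu, hw (fun x => f (x + ℓ))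
    ⟨hf.1.comp_add ℓ, hf.2.comp_homeomorph (Homeomorph.addRight ℓ)⟩]
  refine (tsupport_comp_subset_preimage f (f := fun x => x + ℓ) (by fun_prop)).trans fun y hy => ?_
  simpa using hs hy

theorem MemP.periodic_omegaMass {ℓ : ℝ} {p : (ℝ → ℝ) × Measure ℝ} (hp : MemP ℓ p) :
    Function.Periodic (omegaMass p.1) ℓ := fun x =>
  ((hp.isOmegaMassAt x).add_period hp.memD.periodic_u).omegaMass_eq

theorem MemD.upsilonMass_eq {ℓ : ℝ} {p : (ℝ → ℝ) × Measure ℝ} (hp : MemD ℓ p) (x : ℝ) :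
    upsilonMass p x = (p.2 {x}).toReal := by
  have : energyMeasure p.1 {x} = 0 := withDensity_absolutelyContinuous _ _ (by simp)
  conv_rhs => rw [upsilon_add_energyMeasure hp]
  rw [Measure.add_apply, this, add_zero, upsilonMass]

theorem MemP.periodic_upsilonMass {ℓ : ℝ} {p : (ℝ → ℝ) × Measure ℝ} (hp : MemP ℓ p) :
    Function.Periodic (upsilonMass p) ℓ := fun x => by
  rw [hp.memD.upsilonMass_eq, hp.memD.upsilonMass_eq]
  congr 1
  conv_lhs => rw [← hp.memD.periodic_mu]
  rw [Measure.map_apply (by fun_prop) (measurableSet_singleton _)]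
  congr 1
  ext y; simp

/-! ### Solutions as local transfers -/

open scoped MatrixGroups

/-- The coefficient `z ω({x}) + z² υ({x})`. -/
def massCoeff (p : (ℝ → ℝ) × Measure ℝ) (z : ℂ) (x : ℝ) : ℂ :=
  z * omegaMass p.1 x + z ^ 2 * upsilonMass p x

theorem MemP.massCoeff_eq_zero {ℓ : ℝ} {p : (ℝ → ℝ) × Measure ℝ} (hp : MemP ℓ p) {x : ℝ}
    (hx : x ∉ singularSet p) (z : ℂ) : massCoeff p z x = 0 := by
  have := mt hp.mem_singularSet_iff.2 hx
  push Not at this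
  simp [massCoeff, this]

/-- Transfer over a mass-free interval of length `t`. -/
def transC (t : ℝ) (F : ℂ × ℂ) : ℂ × ℂ :=
  (Real.cosh (t / 2) * F.1 + 2 * Real.sinh (t / 2) * F.2,
   Real.sinh (t / 2) / 2 * F.1 + Real.cosh (t / 2) * F.2)

/-- The jump at a point mass with coefficient `q`. -/
def kickC (q : ℂ) (F : ℂ × ℂ) : ℂ × ℂ := (F.1, F.2 - q * F.1)

theorem transC_zero (F : ℂ × ℂ) : transC 0 F = F := by simp [transC]

theorem kickC_zero (F : ℂ × ℂ) : kickC 0 F = F := by simp [kickC]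

theorem hasDerivAt_transC (F : ℂ × ℂ) (x₀ y : ℝ) :
    HasDerivAt (fun y : ℝ => (transC (y - x₀) F).1) (transC (y - x₀) F).2 y ∧
    HasDerivAt (fun y : ℝ => (transC (y - x₀) F).2) ((transC (y - x₀) F).1 / 4) y := by
  have h1 : HasDerivAt (fun y : ℝ => (y - x₀) / 2) (1 / 2) y :=
    ((hasDerivAt_id y).sub_const x₀).div_const 2
  have hc := h1.cosh.ofReal_comp
  have hs := h1.sinh.ofReal_comp
  constructor
  · refine ((hc.mul_const F.1).add ((hs.const_mul 2).mul_const F.2)).congr_deriv ?_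
    simp only [transC]; push_cast; ring
  · refine (((hs.div_const 2).mul_const F.1).add (hc.mul_const F.2)).congr_deriv ?_
    simp only [transC]; push_cast; ring

theorem tendsto_transC (F : ℂ × ℂ) (x₀ : ℝ) :
    Tendsto (fun y : ℝ => (transC (y - x₀) F).1) (𝓝 x₀) (𝓝 F.1) ∧
    Tendsto (fun y : ℝ => (transC (y - x₀) F).2) (𝓝 x₀) (𝓝 F.2) := by
  have h := hasDerivAt_transC F x₀ x₀
  have h1 := h.1.continuousAt.tendsto
  have h2 := h.2.continuousAt.tendsto
  simp only [sub_self, transC_zero] at h1 h2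
  exact ⟨h1, h2⟩

/-- A function that is locally given by transfer from each point is a solution. -/
theorem MemP.isSolution_of_local {ℓ : ℝ} {p : (ℝ → ℝ) × Measure ℝ} (hp : MemP ℓ p) {z : ℂ}
    {F : ℝ → ℂ × ℂ} (h : ∀ x₀, (∀ᶠ y in 𝓝[<] x₀, F y = transC (y - x₀) (F x₀)) ∧
      ∀ᶠ y in 𝓝[>] x₀, F y = transC (y - x₀) (kickC (massCoeff p z x₀) (F x₀))) :
    IsSolution p z (fun x => (F x).1) (fun x => (F x).2) := by
  have hl : ∀ x₀, Tendsto F (𝓝[<] x₀) (𝓝 (F x₀)) := fun x₀ => by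
    have := ((tendsto_transC (F x₀) x₀).1.prodMk_nhds (tendsto_transC (F x₀) x₀).2).mono_left
      (nhdsWithin_le_nhds (s := Set.Iio x₀))
    exact this.congr' ((h x₀).1.mono fun y hy => hy.symm)
  have hr : ∀ x₀, Tendsto F (𝓝[>] x₀) (𝓝 (kickC (massCoeff p z x₀) (F x₀))) := fun x₀ => by
    set G := kickC (massCoeff p z x₀) (F x₀)
    have := ((tendsto_transC G x₀).1.prodMk_nhds (tendsto_transC G x₀).2).mono_left
      (nhdsWithin_le_nhds (s := Set.Ioi x₀))
    exact this.congr' ((h x₀).2.mono fun y hy => hy.symm)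
  have hreg : ∀ x ∉ singularSet p, F =ᶠ[𝓝 x] fun y => transC (y - x) (F x) := by
    intro x hx
    have h2 := (h x).2
    rw [hp.massCoeff_eq_zero hx, kickC_zero] at h2
    rw [EventuallyEq, ← nhdsNE_sup_pure, eventually_sup, ← nhdsLT_sup_nhdsGT, eventually_sup]
    exact ⟨⟨(h x).1, h2⟩, by simp [transC_zero]⟩
  refine ⟨?_, ?_, ?_, ?_, ?_⟩
  · rw [continuous_iff_continuousAt]
    intro x
    rw [continuousAt_iff_continuous_left'_right']
    exact ⟨(continuous_fst.tendsto _).comp (hl x),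
      (continuous_fst.tendsto (kickC (massCoeff p z x) (F x))).comp (hr x)⟩
  · intro x hx
    have := (hasDerivAt_transC (F x) x x).1
    rw [sub_self, transC_zero] at this
    exact this.congr_of_eventuallyEq ((hreg x hx).fun_comp Prod.fst)
  · intro x hx
    have := (hasDerivAt_transC (F x) x x).2
    rw [sub_self, transC_zero] at this
    exact this.congr_of_eventuallyEq ((hreg x hx).fun_comp Prod.snd)
  · intro x _
    exact (continuous_snd.tendsto _).comp (hl x)
  · intro x _
    exact (continuous_snd.tendsto _).comp (hr x)

/-! ### Existence of solutions -/

/-- Transfer matrices. -/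
def transSL (t : ℝ) : SL(2, ℂ) :=
  ⟨!![(Real.cosh (t / 2) : ℂ), 2 * Real.sinh (t / 2); Real.sinh (t / 2) / 2, Real.cosh (t / 2)], by
    rw [Matrix.det_fin_two_of]
    have h := Real.cosh_sq_sub_sinh_sq (t / 2)
    have h' : (Real.cosh (t / 2) : ℂ) ^ 2 - (Real.sinh (t / 2) : ℂ) ^ 2 = 1 := by exact_mod_cast h
    linear_combination h'⟩

/-- Jump matrices. -/
def kickSL (q : ℂ) : SL(2, ℂ) := ⟨!![1, 0; -q, 1], by simp [Matrix.det_fin_two_of]⟩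

/-- The action of a matrix on pairs. -/
def actPair (M : SL(2, ℂ)) (F : ℂ × ℂ) : ℂ × ℂ :=
  (M.1 0 0 * F.1 + M.1 0 1 * F.2, M.1 1 0 * F.1 + M.1 1 1 * F.2)

theorem actPair_mul (M N : SL(2, ℂ)) (F : ℂ × ℂ) : actPair (M * N) F = actPair M (actPair N F) := by
  simp only [actPair, Matrix.SpecialLinearGroup.coe_mul, Matrix.mul_apply, Fin.sum_univ_two,
    Prod.mk.injEq]
  constructor <;> ring

theorem actPair_one (F : ℂ × ℂ) : actPair 1 F = F := by simp [actPair]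

theorem actPair_transSL (t : ℝ) (F : ℂ × ℂ) : actPair (transSL t) F = transC t F := by
  simp [actPair, transSL, transC]

theorem actPair_kickSL (q : ℂ) (F : ℂ × ℂ) : actPair (kickSL q) F = kickC q F := by
  simp [actPair, kickSL, kickC]; ring

theorem transSL_add (s t : ℝ) : transSL (s + t) = transSL s * transSL t := by
  apply Subtype.ext
  have e : (s + t) / 2 = s / 2 + t / 2 := by ring
  rw [Matrix.SpecialLinearGroup.coe_mul]
  simp only [transSL, e, Real.cosh_add, Real.sinh_add]
  push_cast
  rw [Matrix.mul_fin_two]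
  congr! 3 <;> ring_nf

theorem transSL_sub (s t : ℝ) : transSL (s - t) = transSL s * (transSL t)⁻¹ := by
  rw [eq_mul_inv_iff_mul_eq, ← transSL_add, sub_add_cancel]

section Propagator

variable {S : Set ℝ} (hS : ∀ x y, (S ∩ Set.Icc x y).Finite) (K : ℝ → SL(2, ℂ))

/-- The points of `S` in `[x, y)`. -/
def icoFinset (hS : ∀ x y, (S ∩ Set.Icc x y).Finite) (x y : ℝ) : Finset ℝ :=
  ((hS x y).subset (Set.inter_subset_inter_right S Set.Ico_subset_Icc_self)).toFinset

theorem mem_icoFinset {x y t : ℝ} : t ∈ icoFinset hS x y ↔ t ∈ S ∧ x ≤ t ∧ t < y := by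
  simp [icoFinset]

/-- The ordered product of the matrices `K s` over `s ∈ S ∩ [x, y)`, increasing from right to
left. -/
def orderedProd (x y : ℝ) : SL(2, ℂ) := (((icoFinset hS x y).sort (· ≥ ·)).map K).prod

theorem orderedProd_mul {x y t : ℝ} (hxy : x ≤ y) (hyt : y ≤ t) :
    orderedProd hS K x t = orderedProd hS K y t * orderedProd hS K x y := by
  have : (icoFinset hS x t).sort (· ≥ ·) =
      (icoFinset hS y t).sort (· ≥ ·) ++ (icoFinset hS x y).sort (· ≥ ·) := by
    refine List.Perm.eq_of_pairwise' (r := (· ≥ ·)) (Finset.pairwise_sort _ _) ?_ ?_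
    · rw [List.pairwise_append]
      refine ⟨Finset.pairwise_sort _ _, Finset.pairwise_sort _ _, fun b hb c hc => ?_⟩
      rw [Finset.mem_sort, mem_icoFinset] at hb hc
      exact (hc.2.2.trans_le hb.2.1).le
    · rw [List.perm_ext_iff_of_nodup (Finset.sort_nodup _ _)]
      · intro b
        simp only [List.mem_append, Finset.mem_sort, mem_icoFinset]
        constructor
        · rintro ⟨h1, h2, h3⟩
          rcases lt_or_ge b y with h | h
          · exact Or.inr ⟨h1, h2, h⟩
          · exact Or.inl ⟨h1, h, h3⟩
        · rintro (⟨h1, h2, h3⟩ | ⟨h1, h2, h3⟩)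
          · exact ⟨h1, hxy.trans h2, h3⟩
          · exact ⟨h1, h2, h3.trans_le hyt⟩
      · refine List.nodup_append'.2 ⟨Finset.sort_nodup _ _, Finset.sort_nodup _ _, fun b hb hc => ?_⟩
        rw [Finset.mem_sort, mem_icoFinset] at hb hc
        exact absurd hc.2.2 (not_lt.2 hb.2.1)
  rw [orderedProd, this, List.map_append, List.prod_append]
  rfl

theorem orderedProd_eq_one {x y : ℝ} (h : ∀ t ∈ S, x ≤ t → ¬ t < y) : orderedProd hS K x y = 1 := by
  have : icoFinset hS x y = ∅ := by
    ext t; rw [mem_icoFinset]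
    simpa using fun h1 h2 => not_lt.1 (h t h1 h2)
  rw [orderedProd, this]; simp

theorem orderedProd_eq_self {x y : ℝ} (hxy : x < y) (hK : x ∉ S → K x = 1)
    (h : ∀ t ∈ S, x < t → ¬ t < y) : orderedProd hS K x y = K x := by
  by_cases hx : x ∈ S
  · have : icoFinset hS x y = {x} := by
      ext t; rw [mem_icoFinset, Finset.mem_singleton]
      constructor
      · rintro ⟨h1, h2, h3⟩
        by_contra hne
        exact h t h1 (lt_of_le_of_ne h2 (Ne.symm hne)) h3
      · rintro rfl; exact ⟨hx, le_rfl, hxy⟩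
    rw [orderedProd, this]; simp
  · rw [hK hx, orderedProd_eq_one]
    intro t ht hxt
    exact h t ht (lt_of_le_of_ne hxt (by rintro rfl; exact hx ht))

/-- The ordered product from `a` to `x`, in both directions. -/
def propagator (a x : ℝ) : SL(2, ℂ) :=
  if a ≤ x then orderedProd hS K a x else (orderedProd hS K x a)⁻¹

theorem propagator_eq {a x y : ℝ} (hxy : x ≤ y) :
    propagator hS K a y = orderedProd hS K x y * propagator hS K a x := by
  unfold propagator
  split_ifs with h1 h2 h2
  · exact orderedProd_mul hS K h2 hxy
  · rw [eq_mul_inv_iff_mul_eq]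
    exact (orderedProd_mul hS K (not_le.1 h2).le h1).symm
  · exact absurd (h2.trans hxy) h1
  · rw [eq_mul_inv_iff_mul_eq, inv_mul_eq_iff_eq_mul]
    exact orderedProd_mul hS K hxy (not_le.1 h1).le

theorem propagator_self (a : ℝ) : propagator hS K a a = 1 := by
  rw [propagator, if_pos le_rfl]
  exact orderedProd_eq_one hS K fun t _ h1 h2 => absurd h2 (not_lt.2 h1)

end Propagator

theorem eventually_notMem_of_finite {S : Set ℝ} (hS : ∀ x y, (S ∩ Set.Icc x y).Finite) (x₀ : ℝ) :
    ∃ δ > 0, ∀ y ∈ S, y ≠ x₀ → δ ≤ |y - x₀| := by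
  have hfin : ((S ∩ Set.Icc (x₀ - 1) (x₀ + 1)) \ {x₀}).Finite :=
    (hS (x₀ - 1) (x₀ + 1)).subset Set.sdiff_subset
  have hopen : ((S ∩ Set.Icc (x₀ - 1) (x₀ + 1)) \ {x₀})ᶜ ∈ 𝓝 x₀ :=
    hfin.isClosed.isOpen_compl.mem_nhds (by simp)
  obtain ⟨ε, hε, hb⟩ := Metric.mem_nhds_iff.1 hopen
  refine ⟨min ε 1, by positivity, fun y hy hne => ?_⟩
  by_contra! hlt
  have h1 := hlt.trans_le (min_le_left _ _)
  have h2 := abs_lt.1 (hlt.trans_le (min_le_right _ _))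
  exact hb (by rwa [Metric.mem_ball, Real.dist_eq]) ⟨⟨hy, by linarith, by linarith⟩, hne⟩

/-- Variation of constants: after conjugation with the free transfer the solution is constant
between masses, and each mass multiplies it by the matrix `K x`. The ordered product over half-open
intervals [x, y) leaves out the jump at the right end, which makes f' left-continuous. -/
theorem MemP.exists_isSolution {ℓ : ℝ} {p : (ℝ → ℝ) × Measure ℝ} (hp : MemP ℓ p) (a : ℝ)
    (z f₀ f₁ : ℂ) : ∃ F : ℝ → ℂ × ℂ,
      IsSolution p z (fun x => (F x).1) (fun x => (F x).2) ∧ F a = (f₀, f₁) := by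
  have hS := hp.finite_inter_Icc
  let K : ℝ → SL(2, ℂ) := fun x => (transSL x)⁻¹ * kickSL (massCoeff p z x) * transSL x
  have hK : ∀ x, x ∉ singularSet p → K x = 1 := by
    intro x hx
    have : kickSL 0 = 1 := by
      ext i j; fin_cases i <;> fin_cases j <;> simp [kickSL]
    simp only [K, hp.massCoeff_eq_zero hx, this]
    group
  let Ψ : ℝ → SL(2, ℂ) := fun x => transSL x * propagator hS K a x * (transSL a)⁻¹
  refine ⟨fun x => actPair (Ψ x) (f₀, f₁), hp.isSolution_of_local fun x₀ => ?_, ?_⟩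
  · obtain ⟨δ, hδ, hδS⟩ := eventually_notMem_of_finite hS x₀
    constructor
    · filter_upwards [Ioo_mem_nhdsLT (show x₀ - δ < x₀ by linarith)] with y hy
      have h1 : propagator hS K a x₀ = propagator hS K a y := by
        rw [propagator_eq hS K hy.2.le, orderedProd_eq_one, one_mul]
        intro t ht h1 h2
        have := hδS t ht h2.ne
        rw [abs_of_neg (by linarith)] at this
        linarith [hy.1]
      rw [← actPair_transSL, ← actPair_mul]
      congr 1
      simp only [Ψ, h1, transSL_sub]
      group
    · filter_upwards [Ioo_mem_nhdsGT (show x₀ < x₀ + δ by linarith)] with y hy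
      have h1 : propagator hS K a y = K x₀ * propagator hS K a x₀ := by
        rw [propagator_eq hS K hy.1.le, orderedProd_eq_self hS K hy.1 (hK x₀)]
        intro t ht h1 h2
        have := hδS t ht h1.ne'
        rw [abs_of_pos (by linarith)] at this
        linarith [hy.2]
      rw [← actPair_kickSL, ← actPair_transSL, ← actPair_mul, ← actPair_mul]
      congr 1
      simp only [Ψ, h1, transSL_sub, K]
      group
  · simp only [Ψ, propagator_self, mul_one, mul_inv_cancel, actPair_one]

theorem MemP.ivp_spec {ℓ : ℝ} {p : (ℝ → ℝ) × Measure ℝ} (hp : MemP ℓ p) (a : ℝ) (z f₀ f₁ : ℂ) :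
    IsSolution p z (fun x => (ivp p a z f₀ f₁ x).1) (fun x => (ivp p a z f₀ f₁ x).2) ∧
      ivp p a z f₀ f₁ a = (f₀, f₁) :=
  Classical.epsilon_spec (hp.exists_isSolution a z f₀ f₁)

/-! ### Uniqueness of solutions -/

theorem IsSolution.tendsto_left {p : (ℝ → ℝ) × Measure ℝ} {z : ℂ} {f f' : ℝ → ℂ}
    (h : IsSolution p z f f') (x : ℝ) : Tendsto f' (𝓝[<] x) (𝓝 (f' x)) := by
  by_cases hx : x ∈ singularSet p
  · exact h.left_limit x hx
  · exact (h.hasDerivAt_deriv x hx).continuousAt.tendsto.mono_left nhdsWithin_le_nhds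

theorem MemP.tendsto_right {ℓ : ℝ} {p : (ℝ → ℝ) × Measure ℝ} (hp : MemP ℓ p) {z : ℂ}
    {f f' : ℝ → ℂ} (h : IsSolution p z f f') (x : ℝ) :
    Tendsto f' (𝓝[>] x) (𝓝 (f' x - massCoeff p z x * f x)) := by
  by_cases hx : x ∈ singularSet p
  · exact h.right_limit x hx
  · rw [hp.massCoeff_eq_zero hx, zero_mul, sub_zero]
    exact (h.hasDerivAt_deriv x hx).continuousAt.tendsto.mono_left nhdsWithin_le_nhds

theorem MemP.countable_singularSet {ℓ : ℝ} {p : (ℝ → ℝ) × Measure ℝ} (hp : MemP ℓ p) :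
    (singularSet p).Countable := by
  have : singularSet p ⊆ ⋃ n : ℕ, singularSet p ∩ Set.Icc (-(n : ℝ)) n := by
    intro x hx
    obtain ⟨n, hn⟩ := exists_nat_ge |x|
    exact Set.mem_iUnion.2 ⟨n, hx, abs_le.1 hn⟩
  exact (Set.countable_iUnion fun n => (hp.finite_inter_Icc _ _).countable).mono this

/-- The jumps of f g' and f' g cancel, so the Wronskian is continuous, and its derivative vanishes
off a countable set. -/
theorem MemP.wronskian_const {ℓ : ℝ} {p : (ℝ → ℝ) × Measure ℝ} (hp : MemP ℓ p) {z : ℂ}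
    {f f' g g' : ℝ → ℂ} (hf : IsSolution p z f f') (hg : IsSolution p z g g') (a x : ℝ) :
    f x * g' x - f' x * g x = f a * g' a - f' a * g a := by
  set W : ℝ → ℂ := fun x => f x * g' x - f' x * g x with hW
  have hc : Continuous W := by
    rw [continuous_iff_continuousAt]
    intro y
    rw [continuousAt_iff_continuous_left'_right']
    have cf : ∀ s, Tendsto f (𝓝[s] y) (𝓝 (f y)) := fun s =>
      hf.continuous.continuousAt.tendsto.mono_left nhdsWithin_le_nhds
    have cg : ∀ s, Tendsto g (𝓝[s] y) (𝓝 (g y)) := fun s =>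
      hg.continuous.continuousAt.tendsto.mono_left nhdsWithin_le_nhds
    constructor
    · exact ((cf _).mul (hg.tendsto_left y)).sub ((hf.tendsto_left y).mul (cg _))
    · have := ((cf _).mul (hp.tendsto_right hg y)).sub ((hp.tendsto_right hf y).mul (cg _))
      have e : f y * (g' y - massCoeff p z y * g y) - (f' y - massCoeff p z y * f y) * g y =
          W y := by simp only [hW]; ring
      rw [e] at this
      exact this
  have hd : ∀ y ∈ Set.Ioo (min a x) (max a x) \ singularSet p, HasDerivAt W 0 y := by
    intro y hy
    have := ((hf.hasDerivAt y hy.2).mul (hg.hasDerivAt_deriv y hy.2)).sub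
      ((hf.hasDerivAt_deriv y hy.2).mul (hg.hasDerivAt y hy.2))
    exact this.congr_deriv (by ring)
  have := integral_eq_of_hasDerivAt_off_countable W (fun _ => 0) hp.countable_singularSet
    hc.continuousOn hd (by simp)
  simp only [intervalIntegral.integral_zero] at this
  exact (sub_eq_zero.1 this.symm)

/-- Cramer's rule: the Wronskians of f with a fundamental system vanish at a, hence everywhere,
while the system itself has Wronskian one. -/
theorem MemP.solution_eq_zero {ℓ : ℝ} {p : (ℝ → ℝ) × Measure ℝ} (hp : MemP ℓ p) {z : ℂ}
    {f f' : ℝ → ℂ} (hf : IsSolution p z f f') {a : ℝ} (h0 : f a = 0) (h1 : f' a = 0) : f = 0 := by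
  obtain ⟨F, hF, hFa⟩ := hp.exists_isSolution a z 1 0
  obtain ⟨G, hG, hGa⟩ := hp.exists_isSolution a z 0 1
  funext x
  have w1 := hp.wronskian_const hF hG a x
  have w2 := hp.wronskian_const hf hG a x
  have w3 := hp.wronskian_const hf hF a x
  simp only [hFa, hGa, h0, h1] at w1 w2 w3
  simp only [Pi.zero_apply]
  linear_combination (-f x) * w1 + (F x).1 * w2 - (G x).1 * w3

/-- Transfer of a solution over an interval without masses in its interior. -/
theorem MemP.solution_step {ℓ : ℝ} {p : (ℝ → ℝ) × Measure ℝ} (hp : MemP ℓ p) {z : ℂ}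
    {f f' : ℝ → ℂ} (hf : IsSolution p z f f') {x b : ℝ} (hxb : x < b)
    (hS : ∀ y ∈ Set.Ioo x b, y ∉ singularSet p) :
    (f b, f' b) = transC (b - x) (kickC (massCoeff p z x) (f x, f' x)) := by
  -- For ε = ±1/2 the function (f' + ε f) exp(-ε x) is constant where f'' = f/4. One-sided limits
  -- carry this to both end points, on the left with f' after the jump.
  have key : ∀ ε : ℝ, ε ^ 2 = 1 / 4 →
      (f' x - massCoeff p z x * f x + ε * f x) * Real.exp (-(ε * x)) =
      (f' b + ε * f b) * Real.exp (-(ε * b)) := by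
    intro ε hε
    have hε' : (ε : ℂ) ^ 2 = 1 / 4 := by
      rw [← Complex.ofReal_pow, hε]; push_cast; rfl
    set g : ℝ → ℂ := fun y => (f' y + ε * f y) * Real.exp (-(ε * y)) with hg
    have hd : ∀ y ∈ Set.Ioo x b, HasDerivAt g 0 y := by
      intro y hy
      have h1 := (hf.hasDerivAt_deriv y (hS y hy)).add
        ((hf.hasDerivAt y (hS y hy)).const_mul (ε : ℂ))
      have h2 : HasDerivAt (fun y : ℝ => -(ε * y)) (-(ε * 1)) y :=
        ((hasDerivAt_id y).const_mul ε).neg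
      refine (h1.mul h2.exp.ofReal_comp).congr_deriv ?_
      simp only [Pi.add_apply]
      push_cast
      linear_combination (-(f y) * Complex.exp (-(ε * y))) * hε'
    obtain ⟨c, hc⟩ := isOpen_Ioo.exists_is_const_of_deriv_eq_zero (𝕜 := ℝ) isPreconnected_Ioo
      (fun y hy => (hd y hy).differentiableAt.differentiableWithinAt)
      (fun y hy => (hd y hy).deriv)
    have ce : ∀ s y, Tendsto (fun y : ℝ => ((Real.exp (-(ε * y)) : ℝ) : ℂ)) (𝓝[s] y)
        (𝓝 ((Real.exp (-(ε * y)) : ℝ) : ℂ)) := fun s y => by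
      have : Continuous fun y : ℝ => ((Real.exp (-(ε * y)) : ℝ) : ℂ) := by fun_prop
      exact this.continuousAt.tendsto.mono_left nhdsWithin_le_nhds
    have cf : ∀ s y, Tendsto f (𝓝[s] y) (𝓝 (f y)) := fun s y =>
      hf.continuous.continuousAt.tendsto.mono_left nhdsWithin_le_nhds
    have t1 : Tendsto g (𝓝[>] x)
        (𝓝 ((f' x - massCoeff p z x * f x + ε * f x) * Real.exp (-(ε * x)))) :=
      ((hp.tendsto_right hf x).add ((cf _ x).const_mul _)).mul (ce _ x)
    have t2 : Tendsto g (𝓝[<] b) (𝓝 ((f' b + ε * f b) * Real.exp (-(ε * b)))) :=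
      ((hf.tendsto_left b).add ((cf _ b).const_mul _)).mul (ce _ b)
    have t1' : Tendsto g (𝓝[>] x) (𝓝 c) := tendsto_const_nhds.congr' (by
      filter_upwards [Ioo_mem_nhdsGT hxb] with y hy using (hc y hy).symm)
    have t2' : Tendsto g (𝓝[<] b) (𝓝 c) := tendsto_const_nhds.congr' (by
      filter_upwards [Ioo_mem_nhdsLT hxb] with y hy using (hc y hy).symm)
    exact (tendsto_nhds_unique t1 t1').trans (tendsto_nhds_unique t2 t2').symm
  have k1 := key (1 / 2) (by norm_num)
  have k2 := key (-(1 / 2)) (by norm_num)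
  have hexp : ∀ s t : ℝ, Real.exp (s + t) = Real.exp s * Real.exp t := Real.exp_add
  set X := f' x - massCoeff p z x * f x with hX
  have e1 : (f' b + 1 / 2 * f b) = (X + 1 / 2 * f x) * Real.exp ((b - x) / 2) := by
    have : (Real.exp (-(1 / 2 * x)) : ℂ) * Real.exp (1 / 2 * b) = Real.exp ((b - x) / 2) := by
      rw [← Complex.ofReal_mul, ← Real.exp_add]; congr 2; ring
    have h2 : (Real.exp (-(1 / 2 * b)) : ℂ) * Real.exp (1 / 2 * b) = 1 := by
      rw [← Complex.ofReal_mul, ← Real.exp_add]; simp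
    have k := congrArg (· * (Real.exp (1 / 2 * b) : ℂ)) k1
    rw [← this]
    push_cast at k h2 ⊢
    linear_combination -k - (f' b + 1 / 2 * f b) * h2
  have e2 : (f' b - 1 / 2 * f b) = (X - 1 / 2 * f x) * Real.exp (-((b - x) / 2)) := by
    have : (Real.exp (-(-(1 / 2) * x)) : ℂ) * Real.exp (-(1 / 2) * b) =
        Real.exp (-((b - x) / 2)) := by
      rw [← Complex.ofReal_mul, ← Real.exp_add]; congr 2; ring
    have h2 : (Real.exp (-(-(1 / 2) * b)) : ℂ) * Real.exp (-(1 / 2) * b) = 1 := by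
      rw [← Complex.ofReal_mul, ← Real.exp_add]; simp
    have k := congrArg (· * (Real.exp (-(1 / 2) * b) : ℂ)) k2
    rw [← this]
    push_cast at k h2 ⊢
    linear_combination -k - (f' b - 1 / 2 * f b) * h2
  simp only [transC, kickC, ← hX, Real.cosh_eq, Real.sinh_eq, Prod.mk.injEq]
  push_cast at e1 e2 ⊢
  constructor
  · linear_combination e1 - e2
  · linear_combination (1 / 2) * e1 + (1 / 2) * e2

/-! ### The monodromy over one period in terms of mass lists -/

/-- The list contains exactly the points of `(a, b)` at which `w` or `v` is non-zero, from right to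
left, with the corresponding values. -/
def MassList (w v : ℝ → ℝ) (a : ℝ) : List (ℝ × ℝ × ℝ) → ℝ → Prop
  | [], b => a < b ∧ ∀ y ∈ Set.Ioo a b, w y = 0 ∧ v y = 0
  | m :: L, b => m.1 < b ∧ m.2 = (w m.1, v m.1) ∧ (w m.1 ≠ 0 ∨ v m.1 ≠ 0) ∧
      (∀ y ∈ Set.Ioo m.1 b, w y = 0 ∧ v y = 0) ∧ MassList w v a L m.1

theorem MassList.validChain {w v : ℝ → ℝ} {a : ℝ} (hv : ∀ x, 0 ≤ v x) :
    ∀ {L : List (ℝ × ℝ × ℝ)} {b : ℝ}, MassList w v a L b → ValidChain a L b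
  | [], _, h => h.1
  | m :: _, _, h => ⟨h.1, by rw [h.2.1]; exact hv _, by rw [h.2.1]; exact h.2.2.1,
      MassList.validChain hv h.2.2.2.2⟩

theorem MassList.eq_on {w v w' v' : ℝ → ℝ} {a : ℝ} {L : List (ℝ × ℝ × ℝ)} {b : ℝ}
    (h : MassList w v a L b) (h' : MassList w' v' a L b) :
    ∀ y ∈ Set.Ioo a b, w y = w' y ∧ v y = v' y := by
  induction L generalizing b with
  | nil =>
    intro y hy
    rw [(h.2 y hy).1, (h.2 y hy).2, (h'.2 y hy).1, (h'.2 y hy).2]; simp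
  | cons m L ih =>
    intro y hy
    rcases lt_trichotomy y m.1 with h1 | h1 | h1
    · exact ih h.2.2.2.2 h'.2.2.2.2 y ⟨hy.1, h1⟩
    · have := h.2.1.symm.trans h'.2.1
      rw [h1]; simpa using this
    · have e := h.2.2.2.1 y ⟨h1, hy.2⟩
      have e' := h'.2.2.2.1 y ⟨h1, hy.2⟩
      rw [e.1, e.2, e'.1, e'.2]; simp

theorem exists_massList {w v : ℝ → ℝ} {a b : ℝ} (hab : a < b)
    (hfin : ({x | w x ≠ 0 ∨ v x ≠ 0} ∩ Set.Ioo a b).Finite) : ∃ L, MassList w v a L b := by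
  induction hn : hfin.toFinset.card using Nat.strong_induction_on generalizing b with
  | _ n ih =>
    by_cases hne : hfin.toFinset.Nonempty
    · set x := hfin.toFinset.max' hne with hx
      have hmem := hfin.toFinset.max'_mem hne
      rw [← hx, Set.Finite.mem_toFinset] at hmem
      have hsub : {x | w x ≠ 0 ∨ v x ≠ 0} ∩ Set.Ioo a x ⊆ {x | w x ≠ 0 ∨ v x ≠ 0} ∩ Set.Ioo a b :=
        fun y hy => ⟨hy.1, hy.2.1, hy.2.2.trans hmem.2.2⟩
      have hfin' := hfin.subset hsub
      have hlt : hfin'.toFinset.card < n := by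
        rw [← hn]
        refine Finset.card_lt_card (Finset.ssubset_iff_of_subset ?_ |>.2 ⟨x, ?_, ?_⟩)
        · simpa using hsub
        · simpa using hmem
        · simp
      obtain ⟨L, hL⟩ := ih _ hlt hmem.2.1 hfin' rfl
      refine ⟨(x, w x, v x) :: L, hmem.2.2, rfl, hmem.1, fun y hy => ?_, hL⟩
      by_contra hcon
      have h1 : w y ≠ 0 ∨ v y ≠ 0 := by tauto
      have : y ∈ hfin.toFinset := by
        rw [Set.Finite.mem_toFinset]; exact ⟨h1, hmem.2.1.trans hy.1, hy.2⟩
      exact absurd (hfin.toFinset.le_max' y this) (not_le.2 hy.1)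
    · refine ⟨[], hab, fun y hy => ?_⟩
      by_contra hcon
      have h1 : w y ≠ 0 ∨ v y ≠ 0 := by tauto
      exact hne ⟨y, by rw [Set.Finite.mem_toFinset]; exact ⟨h1, hy⟩⟩

theorem MemP.exists_massList {ℓ : ℝ} {p : (ℝ → ℝ) × Measure ℝ} (hp : MemP ℓ p) {a b : ℝ}
    (hab : a < b) : ∃ L, MassList (omegaMass p.1) (upsilonMass p) a L b := by
  refine PeriodicPeakon.exists_massList hab ((hp.finite_inter_Icc a b).subset ?_)
  exact fun y hy => ⟨hp.mem_singularSet_iff.2 hy.1, Set.Ioo_subset_Icc_self hy.2⟩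

/-- Evaluation of pairs of polynomials. -/
def aevalPair (z : ℂ) (F : ℝ[X] × ℝ[X]) : ℂ × ℂ := (aeval z F.1, aeval z F.2)

theorem aevalPair_transP (z : ℂ) (t : ℝ) (F : ℝ[X] × ℝ[X]) :
    aevalPair z (transP t F) = transC t (aevalPair z F) := by
  simp [aevalPair, transP, transC]

theorem aevalPair_kickP (z : ℂ) (w v : ℝ) (F : ℝ[X] × ℝ[X]) :
    aevalPair z (kickP w v F) = kickC (z * w + z ^ 2 * v) (aevalPair z F) := by
  simp only [aevalPair, kickP, kickC, map_sub, map_mul, map_add, aeval_C, aeval_X, map_pow,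
    Complex.coe_algebraMap, mul_comm]

/-- A mass list covers only the open interval, so the polynomial data must start just to the right
of a possible mass at a. This is why the hypothesis contains a kick. -/
theorem MemP.solution_eq_chainP {ℓ : ℝ} {p : (ℝ → ℝ) × Measure ℝ} (hp : MemP ℓ p) {z : ℂ}
    {f f' : ℝ → ℂ} (hf : IsSolution p z f f') {a : ℝ} {F : ℝ[X] × ℝ[X]}
    (hF : aevalPair z F = kickC (massCoeff p z a) (f a, f' a)) {L : List (ℝ × ℝ × ℝ)} {b : ℝ}
    (hL : MassList (omegaMass p.1) (upsilonMass p) a L b) :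
    (f b, f' b) = aevalPair z (chainP a F L b) := by
  have hns : ∀ y, omegaMass p.1 y = 0 ∧ upsilonMass p y = 0 → y ∉ singularSet p := by
    intro y hy h
    rcases hp.mem_singularSet_iff.1 h with h | h
    · exact h hy.1
    · exact h hy.2
  induction L generalizing b with
  | nil =>
    rw [chainP, aevalPair_transP, hF]
    exact hp.solution_step hf hL.1 fun y hy => hns y (hL.2 y hy)
  | cons m L ih =>
    rw [chainP, aevalPair_transP, aevalPair_kickP, ← ih hL.2.2.2.2,
      hp.solution_step hf hL.1 fun y hy => hns y (hL.2.2.2.1 y hy), hL.2.1]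
    rfl

/-- Twice the Floquet discriminant, for the masses `w`, `v` at `a` and the masses `L` in the
interior of the period. -/
def chainTrace (a : ℝ) (L : List (ℝ × ℝ × ℝ)) (b w v : ℝ) : ℝ[X] :=
  (chainP a (1, 0) L b).1 + (chainP a (0, 1) L b).2 -
    (C w * X + C v * X ^ 2) * (chainP a (0, 1) L b).1

section

variable {ℓ : ℝ} {p : (ℝ → ℝ) × Measure ℝ} {a : ℝ} {L : List (ℝ × ℝ × ℝ)}

theorem MemP.ivp_zero_one (hp : MemP ℓ p)
    (hL : MassList (omegaMass p.1) (upsilonMass p) a L (a + ℓ)) (z : ℂ) :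
    ivp p a z 0 1 (a + ℓ) = aevalPair z (chainP a (0, 1) L (a + ℓ)) := by
  obtain ⟨h1, h2⟩ := hp.ivp_spec a z 0 1
  refine hp.solution_eq_chainP h1 ?_ hL
  simp [aevalPair, kickC, h2]

theorem MemP.discriminant_eq (hp : MemP ℓ p)
    (hL : MassList (omegaMass p.1) (upsilonMass p) a L (a + ℓ)) (z : ℂ) :
    discriminant ℓ a p z =
      aeval z (chainTrace a L (a + ℓ) (omegaMass p.1 a) (upsilonMass p a)) / 2 := by
  obtain ⟨h1, h2⟩ := hp.ivp_spec a z 1 0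
  set q : ℝ[X] := C (omegaMass p.1 a) * X + C (upsilonMass p a) * X ^ 2 with hq
  -- Behind the mass at a the data (1, 0) become (1, -q), whereas (0, 1) passes unchanged. This
  -- difference produces the last term of `chainTrace`.
  have hc : ivp p a z 1 0 (a + ℓ) = aevalPair z (chainP a (1, -q) L (a + ℓ)) := by
    refine hp.solution_eq_chainP h1 ?_ hL
    simp [aevalPair, kickC, h2, hq, massCoeff]
    ring
  have hlin := chainP_linear a 1 (-q) (1, 0) (0, 1) L (a + ℓ)
  simp only [mul_one, one_mul, mul_zero, add_zero, zero_add] at hlin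
  rw [discriminant, monodromy, Matrix.trace_fin_two_of, hc, hp.ivp_zero_one hL, hlin, chainTrace,
    ← hq]
  simp only [aevalPair, map_add, map_sub, map_mul, map_neg]
  ring

theorem MemP.mem_dirichletSpectrum_iff (hp : MemP ℓ p)
    (hL : MassList (omegaMass p.1) (upsilonMass p) a L (a + ℓ)) (z : ℂ) :
    z ∈ dirichletSpectrum ℓ a p ↔ aeval z (chainP a (0, 1) L (a + ℓ)).1 = 0 := by
  constructor
  · rintro ⟨f, f', hf, hne, h0, h1⟩
    have hf'a : f' a ≠ 0 := fun h => hne (hp.solution_eq_zero hf h0 h)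
    obtain ⟨h2, h3⟩ := hp.ivp_spec a z 0 1
    -- Both f and s vanish at a, so their Wronskian is zero. At a + ℓ it equals -f' s.
    have w := hp.wronskian_const hf h2 a (a + ℓ)
    have hs := hp.ivp_zero_one hL z
    simp only [h3, h0, h1, mul_one, mul_zero, sub_zero, zero_mul, zero_sub, hs, aevalPair,
      neg_eq_zero, mul_eq_zero] at w
    have hf'b : f' (a + ℓ) ≠ 0 := fun h => hne (hp.solution_eq_zero hf h1 h)
    exact w.resolve_left hf'b
  · intro hz
    obtain ⟨h2, h3⟩ := hp.ivp_spec a z 0 1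
    refine ⟨_, _, h2, ?_, by rw [h3], by rw [hp.ivp_zero_one hL]; exact hz⟩
    intro hzero
    -- Just to the right of a there are no masses, so s is 2 sinh((x - a)/2) there and cannot
    -- vanish.
    obtain ⟨δ, hδ, hδS⟩ := eventually_notMem_of_finite hp.finite_inter_Icc a
    have hstep := hp.solution_step h2 (x := a) (b := a + δ) (by linarith) fun y hy hyS => by
      have := hδS y hyS hy.1.ne'
      rw [abs_of_pos (by linarith [hy.1])] at this
      linarith [hy.2]
    have e := congrArg Prod.fst hstep
    have e0 := congrFun hzero (a + δ)
    simp only [Pi.zero_apply] at e0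
    simp only [e0, h3, transC, kickC] at e
    simp at e
    have hs : Real.sinh (δ / 2) ≠ 0 := by
      have : 0 < Real.sinh (δ / 2) := Real.sinh_pos_iff.2 (by linarith)
      exact this.ne'
    exact hs (by rw [← Complex.ofReal_inj]; push_cast; exact e)

end

theorem polynomial_eq_of_aeval {P Q : ℝ[X]} (h : ∀ z : ℂ, aeval z P = aeval z Q) : P = Q := by
  refine Polynomial.funext fun x => ?_
  have := h x
  rw [aeval_ofReal, aeval_ofReal] at this
  exact_mod_cast this

/-! ### Construction of pairs with prescribed periodic masses -/

/-- On both sides of `x` the function `u` is locally a combination of `eʸ` and `e⁻ʸ`, and its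
derivative jumps down by `J` at `x`. -/
def HasExpJump (u : ℝ → ℝ) (x J : ℝ) : Prop :=
  ∃ ε > 0, ∃ A₁ B₁ A₂ B₂ : ℝ, (∀ y ∈ Set.Icc (x - ε) x, u y = expSol A₁ B₁ y) ∧
    (∀ y ∈ Set.Icc x (x + ε), u y = expSol A₂ B₂ y) ∧
    J = expSol A₁ (-B₁) x - expSol A₂ (-B₂) x

theorem HasExpJump.isOmegaMassAt {u : ℝ → ℝ} (hu : MemH1loc u) {x J : ℝ} (h : HasExpJump u x J) :
    IsOmegaMassAt u x J := by
  obtain ⟨ε, hε, A₁, B₁, A₂, B₂, h₁, h₂, rfl⟩ := h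
  exact isOmegaMassAt_of_expSol hu hε h₁ h₂

theorem HasExpJump.const_mul {u : ℝ → ℝ} {x J : ℝ} (h : HasExpJump u x J) (c : ℝ) :
    HasExpJump (fun y => c * u y) x (c * J) := by
  obtain ⟨ε, hε, A₁, B₁, A₂, B₂, h₁, h₂, rfl⟩ := h
  refine ⟨ε, hε, c * A₁, c * B₁, c * A₂, c * B₂, fun y hy => ?_, fun y hy => ?_, ?_⟩
  · simp only [h₁ y hy, expSol]; ring
  · simp only [h₂ y hy, expSol]; ring
  · simp only [expSol]; ring

theorem HasExpJump.add {u v : ℝ → ℝ} {x J J' : ℝ} (h : HasExpJump u x J) (h' : HasExpJump v x J') :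
    HasExpJump (fun y => u y + v y) x (J + J') := by
  obtain ⟨ε, hε, A₁, B₁, A₂, B₂, h₁, h₂, rfl⟩ := h
  obtain ⟨δ, hδ, C₁, D₁, C₂, D₂, k₁, k₂, rfl⟩ := h'
  have l₁ := min_le_left ε δ
  have l₂ := min_le_right ε δ
  refine ⟨min ε δ, lt_min hε hδ, A₁ + C₁, B₁ + D₁, A₂ + C₂, B₂ + D₂, fun y hy => ?_,
    fun y hy => ?_, ?_⟩
  · beta_reduce
    rw [h₁ y ⟨by linarith [hy.1], hy.2⟩, k₁ y ⟨by linarith [hy.1], hy.2⟩]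
    simp only [expSol]; ring
  · beta_reduce
    rw [h₂ y ⟨hy.1, by linarith [hy.2]⟩, k₂ y ⟨hy.1, by linarith [hy.2]⟩]
    simp only [expSol]; ring
  · simp only [expSol]; ring

theorem HasExpJump.sum {ι : Type*} (F : Finset ι) {u : ι → ℝ → ℝ} {x : ℝ} {J : ι → ℝ}
    (h : ∀ i ∈ F, HasExpJump (u i) x (J i)) :
    HasExpJump (fun y => ∑ i ∈ F, u i y) x (∑ i ∈ F, J i) := by
  classical
  induction F using Finset.induction_on with
  | empty =>
    exact ⟨1, one_pos, 0, 0, 0, 0, by simp [expSol], by simp [expSol], by simp [expSol]⟩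
  | insert i F hi ih =>
    simp only [Finset.sum_insert hi]
    exact (h i (Finset.mem_insert_self _ _)).add
      (ih fun j hj => h j (Finset.mem_insert_of_mem hj))

/-- The `ℓ`-periodic Green's function of `1 - d²/dx²`. -/
def periodicGreen (ℓ x : ℝ) : ℝ :=
  Real.cosh (ℓ / 2 - ‖(x : AddCircle ℓ)‖) / (2 * Real.sinh (ℓ / 2))

theorem periodicGreen_periodic (ℓ : ℝ) : Function.Periodic (periodicGreen ℓ) ℓ := fun x => by
  simp [periodicGreen]

theorem periodicGreen_of_mem_Icc {ℓ : ℝ} (hℓ : 0 < ℓ) {x : ℝ} (hx : x ∈ Set.Icc 0 ℓ) :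
    periodicGreen ℓ x = Real.cosh (x - ℓ / 2) / (2 * Real.sinh (ℓ / 2)) := by
  unfold periodicGreen
  congr 1
  rcases le_total x (ℓ / 2) with h | h
  · have : ‖(x : AddCircle ℓ)‖ = |x| := by
      rw [AddCircle.norm_coe_eq_abs_iff ℓ hℓ.ne', abs_of_nonneg hx.1, abs_of_pos hℓ]; exact h
    rw [this, abs_of_nonneg hx.1, ← Real.cosh_neg]; ring_nf
  · have h0 : ((x - ℓ : ℝ) : AddCircle ℓ) = (x : AddCircle ℓ) := by simp
    have : ‖(x : AddCircle ℓ)‖ = |x - ℓ| := by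
      rw [← h0, AddCircle.norm_coe_eq_abs_iff ℓ hℓ.ne', abs_of_pos hℓ,
        abs_of_nonpos (by linarith [hx.2])]
      linarith
    rw [this, abs_of_nonpos (by linarith [hx.2])]; ring_nf

theorem periodicGreen_lipschitz {ℓ : ℝ} (hℓ : 0 < ℓ) : ∃ K, LipschitzWith K (periodicGreen ℓ) := by
  have hc : ContDiff ℝ 1 fun t : ℝ => Real.cosh (ℓ / 2 - t) / (2 * Real.sinh (ℓ / 2)) := by
    fun_prop
  obtain ⟨K, hK⟩ := hc.contDiffOn.exists_lipschitzOnWith one_ne_zero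
    (convex_Icc (0 : ℝ) (ℓ / 2)) isCompact_Icc
  have hn : LipschitzWith 1 fun x : ℝ => ‖(x : AddCircle ℓ)‖ := by
    refine LipschitzWith.of_dist_le_mul fun x y => ?_
    rw [Real.dist_eq, NNReal.coe_one, one_mul, Real.dist_eq]
    refine (abs_norm_sub_norm_le _ _).trans ?_
    rw [← AddCircle.coe_sub]
    exact QuotientAddGroup.norm_mk_le_norm
  refine ⟨K * 1, lipschitzOnWith_univ.1 ?_⟩
  refine (hK.comp (lipschitzOnWith_univ.2 hn) fun x _ => ⟨norm_nonneg _, ?_⟩ : )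
  have := AddCircle.norm_le_half_period ℓ hℓ.ne' (x := (x : AddCircle ℓ))
  rwa [abs_of_pos hℓ] at this

theorem cosh_add_eq_expSol (k c y : ℝ) :
    Real.cosh (y + c) / k = expSol (Real.exp c / (2 * k)) (Real.exp (-c) / (2 * k)) y := by
  rw [expSol, Real.cosh_eq, neg_add, Real.exp_add, Real.exp_add]; ring

theorem sinh_add_eq_expSol (k c y : ℝ) :
    Real.sinh (y + c) / k = expSol (Real.exp c / (2 * k)) (-(Real.exp (-c) / (2 * k))) y := by
  rw [expSol, Real.sinh_eq, neg_add, Real.exp_add, Real.exp_add]; ring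

/-- Over one period the function is a multiple of cosh(x - ℓ/2), smooth inside. At the period point
its derivative drops from 1/2 to -1/2, which is the unit mass. -/
theorem periodicGreen_hasExpJump {ℓ : ℝ} (hℓ : 0 < ℓ) {x : ℝ} (hx : x ∈ Set.Ico 0 ℓ) :
    HasExpJump (periodicGreen ℓ) x (if x = 0 then 1 else 0) := by
  set k := 2 * Real.sinh (ℓ / 2) with hk
  have hk0 : 0 < k := by
    have := Real.sinh_pos_iff.2 (half_pos hℓ)
    positivity
  split_ifs with h0
  · subst h0
    refine ⟨ℓ, hℓ, Real.exp (ℓ - ℓ / 2) / (2 * k), Real.exp (-(ℓ - ℓ / 2)) / (2 * k),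
      Real.exp (-(ℓ / 2)) / (2 * k), Real.exp (-(-(ℓ / 2))) / (2 * k), fun y hy => ?_,
      fun y hy => ?_, ?_⟩
    · rw [← periodicGreen_periodic ℓ y, periodicGreen_of_mem_Icc hℓ
        ⟨by linarith [hy.1], by linarith [hy.2]⟩, ← hk, add_sub_assoc]
      exact cosh_add_eq_expSol k _ y
    · rw [periodicGreen_of_mem_Icc hℓ ⟨by linarith [hy.1], by linarith [hy.2]⟩, ← hk,
        sub_eq_add_neg]
      exact cosh_add_eq_expSol k _ y
    · rw [← sinh_add_eq_expSol, ← sinh_add_eq_expSol, zero_add, zero_add, Real.sinh_neg,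
        show ℓ - ℓ / 2 = ℓ / 2 by ring]
      field_simp
      rw [hk]; ring
  · have hx0 : 0 < x := lt_of_le_of_ne hx.1 (Ne.symm h0)
    refine ⟨min x (ℓ - x), lt_min hx0 (by linarith [hx.2]), Real.exp (-(ℓ / 2)) / (2 * k),
      Real.exp (-(-(ℓ / 2))) / (2 * k), Real.exp (-(ℓ / 2)) / (2 * k),
      Real.exp (-(-(ℓ / 2))) / (2 * k), fun y hy => ?_, fun y hy => ?_, ?_⟩
    · have := min_le_left x (ℓ - x)
      rw [periodicGreen_of_mem_Icc hℓ ⟨by linarith [hy.1], by linarith [hy.2, hx.2]⟩, ← hk,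
        sub_eq_add_neg]
      exact cosh_add_eq_expSol k _ y
    · have := min_le_right x (ℓ - x)
      rw [periodicGreen_of_mem_Icc hℓ ⟨by linarith [hy.1], by linarith [hy.2, hx.2]⟩, ← hk,
        sub_eq_add_neg]
      exact cosh_add_eq_expSol k _ y
    · rw [sub_self]

theorem HasExpJump.comp_sub {u : ℝ → ℝ} {x J : ℝ} (h : HasExpJump u x J) (t : ℝ) :
    HasExpJump (fun y => u (y - t)) (x + t) J := by
  obtain ⟨ε, hε, A₁, B₁, A₂, B₂, h₁, h₂, rfl⟩ := h
  have key : ∀ A B y, expSol A B (y - t) = expSol (A * Real.exp (-t)) (B * Real.exp t) y := by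
    intro A B y
    simp only [expSol, mul_assoc, ← Real.exp_add]; ring_nf
  refine ⟨ε, hε, A₁ * Real.exp (-t), B₁ * Real.exp t, A₂ * Real.exp (-t), B₂ * Real.exp t,
    fun y hy => ?_, fun y hy => ?_, ?_⟩
  · rw [← key]; exact h₁ _ ⟨by linarith [hy.1], by linarith [hy.2]⟩
  · rw [← key]; exact h₂ _ ⟨by linarith [hy.1], by linarith [hy.2]⟩
  · rw [← neg_mul, ← neg_mul, ← key, ← key, add_sub_cancel_right]

theorem periodicGreen_sub_hasExpJump {ℓ : ℝ} (hℓ : 0 < ℓ) (a x : ℝ) {y : ℝ}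
    (hy : y ∈ Set.Ico a (a + ℓ)) :
    HasExpJump (fun t => periodicGreen ℓ (t - y)) x (if y = toIcoMod hℓ a x then 1 else 0) := by
  have h := (periodicGreen_hasExpJump hℓ (by simpa using toIcoMod_mem_Ico hℓ 0 (x - y))).comp_sub
    (y + toIcoDiv hℓ 0 (x - y) • ℓ)
  have hx : toIcoMod hℓ 0 (x - y) + (y + toIcoDiv hℓ 0 (x - y) • ℓ) = x := by
    have := toIcoMod_add_toIcoDiv_zsmul hℓ 0 (x - y)
    linarith
  rw [hx] at h
  convert h using 2
  · rename_i t
    rw [← sub_sub]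
    exact ((periodicGreen_periodic ℓ).sub_zsmul_eq _).symm
  · constructor
    · intro e
      have : x - y = toIcoDiv hℓ a x • ℓ := by
        rw [e]; exact self_sub_toIcoMod hℓ a x
      rw [this]
      rw [← zero_add (toIcoDiv hℓ a x • ℓ), toIcoMod_add_zsmul, toIcoMod_apply_left]
    · intro e
      rw [e, zero_add] at hx
      rw [← hx, toIcoMod_add_zsmul]
      exact ((toIcoMod_eq_self hℓ).2 hy).symm

theorem finite_inter_Icc_of_periodic {ℓ a : ℝ} (hℓ : 0 < ℓ) {S : Set ℝ}
    (hS : ∀ x, x ∈ S → toIcoMod hℓ a x ∈ S)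
    (hfin : (S ∩ Set.Ico a (a + ℓ)).Finite) (c d : ℝ) : (S ∩ Set.Icc c d).Finite := by
  refine ((hfin.prod (Set.finite_Icc (toIcoDiv hℓ a c) (toIcoDiv hℓ a d))).image
    fun q : ℝ × ℤ => q.1 + q.2 • ℓ).subset ?_
  rintro x ⟨hx, hxc, hxd⟩
  refine ⟨(toIcoMod hℓ a x, toIcoDiv hℓ a x), ⟨⟨hS x hx, toIcoMod_mem_Ico hℓ a x⟩, ?_, ?_⟩,
    toIcoMod_add_toIcoDiv_zsmul hℓ a x⟩
  · have h1 := (toIcoMod_mem_Ico hℓ a c).1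
    have h2 := (toIcoMod_mem_Ico hℓ a x).2
    rw [toIcoMod, zsmul_eq_mul] at h1 h2
    have : (toIcoDiv hℓ a c : ℝ) < toIcoDiv hℓ a x + 1 := by
      by_contra hcon
      nlinarith
    have : toIcoDiv hℓ a c < toIcoDiv hℓ a x + 1 := by exact_mod_cast this
    dsimp only; omega
  · have h1 := (toIcoMod_mem_Ico hℓ a x).1
    have h2 := (toIcoMod_mem_Ico hℓ a d).2
    rw [toIcoMod, zsmul_eq_mul] at h1 h2
    have : (toIcoDiv hℓ a x : ℝ) < toIcoDiv hℓ a d + 1 := by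
      by_contra hcon
      nlinarith
    have : toIcoDiv hℓ a x < toIcoDiv hℓ a d + 1 := by exact_mod_cast this
    dsimp only; omega

/-- The measure with point masses `v y`. -/
def pointMeasure (v : ℝ → ℝ) : Measure ℝ :=
  Measure.sum fun y => ENNReal.ofReal (v y) • Measure.dirac y

theorem pointMeasure_apply (v : ℝ → ℝ) {B : Set ℝ} (hB : MeasurableSet B) :
    pointMeasure v B = ∑' y, ENNReal.ofReal (v y) * B.indicator 1 y := by
  simp [pointMeasure, Measure.sum_apply _ hB, Measure.dirac_apply' _ hB]

theorem pointMeasure_singleton (v : ℝ → ℝ) (x : ℝ) :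
    pointMeasure v {x} = ENNReal.ofReal (v x) := by
  rw [pointMeasure_apply v (measurableSet_singleton x), tsum_eq_single x]
  · simp
  · intro y hy; simp [hy]

theorem pointMeasure_eq_zero {v : ℝ → ℝ} {B : Set ℝ} (hB : MeasurableSet B)
    (h : ∀ x ∈ B, v x = 0) : pointMeasure v B = 0 := by
  rw [pointMeasure_apply v hB, ENNReal.tsum_eq_zero]
  intro y
  by_cases hy : y ∈ B
  · simp [h y hy]
  · simp [hy]

theorem pointMeasure_lt_top {v : ℝ → ℝ} {B : Set ℝ} (hB : MeasurableSet B)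
    (h : ({x | v x ≠ 0} ∩ B).Finite) : pointMeasure v B < ⊤ := by
  rw [pointMeasure_apply v hB, tsum_eq_sum (s := h.toFinset)]
  · refine ENNReal.sum_lt_top.2 fun y _ => ENNReal.mul_lt_top ENNReal.ofReal_lt_top ?_
    by_cases hy : y ∈ B <;> simp [hy]
  · intro y hy
    by_cases hyB : y ∈ B
    · have : v y = 0 := by
        by_contra hcon
        exact hy (by simpa using ⟨hcon, hyB⟩)
      simp [this]
    · simp [hyB]

theorem map_pointMeasure {v : ℝ → ℝ} {ℓ : ℝ} (hv : Function.Periodic v ℓ) :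
    (pointMeasure v).map (fun x => x + ℓ) = pointMeasure v := by
  ext B hB
  have hm : Measurable fun x : ℝ => x + ℓ := measurable_add_const ℓ
  rw [Measure.map_apply hm hB, pointMeasure_apply v (hm hB), pointMeasure_apply v hB,
    ← (Equiv.addRight ℓ).tsum_eq fun y => ENNReal.ofReal (v y) * B.indicator 1 y]
  refine tsum_congr fun y => ?_
  rw [Equiv.coe_addRight, hv y]
  rfl

theorem map_energyMeasure {u : ℝ → ℝ} {ℓ : ℝ} (hu : Function.Periodic u ℓ) :
    (energyMeasure u).map (fun x => x + ℓ) = energyMeasure u := by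
  ext B hB
  have hm : Measurable fun x : ℝ => x + ℓ := measurable_add_const ℓ
  have hu' : ∀ x, deriv u (x + ℓ) = deriv u x := fun x => by
    rw [← deriv_comp_add_const]
    congr 1
    exact funext hu
  rw [Measure.map_apply hm hB, energyMeasure, withDensity_apply _ (hm hB), withDensity_apply _ hB,
    ← (measurePreserving_add_right volume ℓ).setLIntegral_comp_preimage_emb
      (measurableEmbedding_addRight ℓ) _ B]
  simp only [hu _, hu']

theorem isLocallyFiniteMeasure_energyMeasure {u : ℝ → ℝ} {K : NNReal} (hu : LipschitzWith K u) :
    IsLocallyFiniteMeasure (energyMeasure u) := by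
  have hc : Continuous fun x => u x ^ 2 + (K : ℝ) ^ 2 := by
    have := hu.continuous
    fun_prop
  have := IsLocallyFiniteMeasure.withDensity_ofReal (μ := (volume : Measure ℝ)) hc
  refine @Measure.isLocallyFiniteMeasure_of_le _ _ _ _ _ this
    (withDensity_mono (ae_of_all _ fun x => ?_))
  refine ENNReal.ofReal_le_ofReal (add_le_add le_rfl ?_)
  rw [← sq_abs (deriv u x)]
  exact pow_le_pow_left₀ (abs_nonneg _) (norm_deriv_le_of_lipschitz hu) 2

/-- Superpose the periodic Green's functions of the masses `w` in one period to get u, and take for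
μ the point masses `v` plus the energy of u. -/
theorem exists_memP {ℓ a : ℝ} (hℓ : 0 < ℓ) {w v : ℝ → ℝ} (hw : Function.Periodic w ℓ)
    (hv : Function.Periodic v ℓ) (hv0 : ∀ x, 0 ≤ v x)
    (hfin : ({x | w x ≠ 0 ∨ v x ≠ 0} ∩ Set.Ico a (a + ℓ)).Finite) :
    ∃ p, MemP ℓ p ∧ ∀ x, omegaMass p.1 x = w x ∧ upsilonMass p x = v x := by
  classical
  obtain ⟨K, hK⟩ := periodicGreen_lipschitz hℓ
  have hmod : ∀ {f : ℝ → ℝ}, Function.Periodic f ℓ → ∀ x, f (toIcoMod hℓ a x) = f x := by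
    intro f hf x
    rw [toIcoMod, hf.sub_zsmul_eq]
  set u : ℝ → ℝ := fun x => ∑ y ∈ hfin.toFinset, w y * periodicGreen ℓ (x - y) with hu
  have hper : Function.Periodic u ℓ := fun x => by
    simp only [hu]
    refine Finset.sum_congr rfl fun y _ => ?_
    rw [add_sub_right_comm, periodicGreen_periodic ℓ]
  have hlip : ∃ K', LipschitzWith K' u := by
    have : ∀ F : Finset ℝ,
        ∃ K', LipschitzWith K' fun x => ∑ y ∈ F, w y * periodicGreen ℓ (x - y) := by
      intro F
      induction F using Finset.induction_on with
      | empty => exact ⟨0, by simp⟩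
      | insert y F hy ih =>
        obtain ⟨K', hK'⟩ := ih
        simp only [Finset.sum_insert hy]
        refine ⟨_, LipschitzWith.add (Kf := ‖w y‖₊ * K) ?_ hK'⟩
        refine LipschitzWith.of_dist_le_mul fun s t => ?_
        rw [dist_eq_norm, ← mul_sub, norm_mul, NNReal.coe_mul, coe_nnnorm, mul_assoc,
          ← dist_eq_norm]
        refine mul_le_mul_of_nonneg_left ?_ (norm_nonneg _)
        have := hK.dist_le_mul (s - y) (t - y)
        rwa [dist_sub_right] at this
    exact this _
  obtain ⟨K', hK'⟩ := hlip
  have hH := memH1loc_of_lipschitzWith hK'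
  have hmass : ∀ x, IsOmegaMassAt u x (w x) := by
    intro x
    refine HasExpJump.isOmegaMassAt hH ?_
    have h := HasExpJump.sum hfin.toFinset (x := x) fun y hy =>
      (periodicGreen_sub_hasExpJump hℓ a x ((Set.Finite.mem_toFinset hfin).1 hy).2).const_mul (w y)
    convert h using 1
    simp only [mul_ite, mul_one, mul_zero]
    rw [Finset.sum_ite_eq', ← hmod hw x]
    split_ifs with h0
    · rfl
    · by_contra hcon
      exact h0 (by simpa using ⟨Or.inl hcon, (toIcoMod_mem_Ico hℓ a x)⟩)
  have hfin' : ∀ c d, ({x | v x ≠ 0} ∩ Set.Icc c d).Finite := by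
    refine finite_inter_Icc_of_periodic (a := a) hℓ (fun x hx => ?_)
      (hfin.subset fun x hx => ⟨Or.inr hx.1, hx.2⟩)
    simpa [hmod hv x] using hx
  have hlfE := isLocallyFiniteMeasure_energyMeasure hK'
  set p : (ℝ → ℝ) × Measure ℝ := (u, pointMeasure v + energyMeasure u) with hp
  have hD : MemD ℓ p := by
    refine ⟨hper, hH, ⟨fun x => ?_⟩, ?_, ?_⟩
    · obtain ⟨s, hs, hs'⟩ := hlfE.finiteAtNhds x
      refine ⟨s ∩ Set.Icc (x - 1) (x + 1), inter_mem hs (Icc_mem_nhds (by simp) (by simp)), ?_⟩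
      simp only [hp, Measure.add_apply]
      refine ENNReal.add_lt_top.2 ⟨?_, (measure_mono Set.inter_subset_left).trans_lt hs'⟩
      exact (measure_mono Set.inter_subset_right).trans_lt
        (pointMeasure_lt_top measurableSet_Icc (hfin' _ _))
    · simp only [hp]
      rw [Measure.map_add _ _ (measurable_add_const ℓ), map_pointMeasure hv, map_energyMeasure hper]
    · exact Measure.le_add_left le_rfl
  have hE0 : ∀ x, energyMeasure u {x} = 0 := fun x => by
    rw [energyMeasure, withDensity_apply _ (measurableSet_singleton x)]
    exact setLIntegral_measure_zero _ _ (by simp)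
  refine ⟨p, ⟨hD, ?_, ?_⟩, fun x => ⟨(hmass x).omegaMass_eq, ?_⟩⟩
  · rw [isDiscrete_iff_nhdsNE]
    intro x _
    rw [← disjoint_iff, disjoint_principal_right]
    exact (hmass x).eventually_notMem
  · rw [isDiscrete_iff_nhdsNE]
    intro x _
    rw [← disjoint_iff, disjoint_principal_right]
    have hnhd : ∀ᶠ y in 𝓝[≠] x, v y = 0 := by
      have h1 : (({x | v x ≠ 0} ∩ Set.Icc (x - 1) (x + 1)) \ {x})ᶜ ∈ 𝓝 x :=
        ((hfin' (x - 1) (x + 1)).subset Set.sdiff_subset).isClosed.isOpen_compl.mem_nhds (by simp)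
      have h2 : Set.Icc (x - 1) (x + 1) ∈ 𝓝 x := Icc_mem_nhds (by simp) (by simp)
      filter_upwards [mem_nhdsWithin_of_mem_nhds h1, mem_nhdsWithin_of_mem_nhds h2,
        self_mem_nhdsWithin] with y hy1 hy2 hy3
      by_contra hcon
      exact hy1 ⟨⟨hcon, hy2⟩, hy3⟩
    obtain ⟨U, hU, hxU, hUv⟩ := mem_nhdsWithin.1 hnhd
    refine mem_nhdsWithin.2 ⟨U, hU, hxU, fun y hy => ?_⟩
    have hV : IsOpen ((U ∩ {x}ᶜ) ∩ Set.Ioo (y - 1) (y + 1)) :=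
      (hU.inter isOpen_compl_singleton).inter isOpen_Ioo
    refine Measure.notMem_support_iff_exists.2
      ⟨(U ∩ {x}ᶜ) ∩ Set.Ioo (y - 1) (y + 1), hV.mem_nhds ⟨hy, by simp, by simp⟩, ?_⟩
    -- As υ is defined by subtraction of measures, its value here is read off from μ = υ + energy.
    -- The energy of a bounded set is finite and cancels.
    have h1 := congrArg (fun m : Measure ℝ => m ((U ∩ {x}ᶜ) ∩ Set.Ioo (y - 1) (y + 1)))
      (upsilon_add_energyMeasure hD)
    simp only [hp, Measure.add_apply] at h1
    rw [pointMeasure_eq_zero hV.measurableSet fun t ht => hUv ht.1, zero_add] at h1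
    have hlt : energyMeasure u ((U ∩ {x}ᶜ) ∩ Set.Ioo (y - 1) (y + 1)) < ⊤ :=
      (measure_mono (Set.inter_subset_right.trans Set.Ioo_subset_Icc_self)).trans_lt
        isCompact_Icc.measure_lt_top
    by_contra hcon
    exact (ENNReal.lt_add_right hlt.ne hcon).ne (h1.trans (add_comm _ _))
  · rw [hD.upsilonMass_eq]
    simp only [hp, Measure.add_apply, hE0, add_zero, pointMeasure_singleton]
    exact ENNReal.toReal_ofReal (hv0 x)

/-- The masses recorded in a list, as a function of the position. -/
def chainMass : List (ℝ × ℝ × ℝ) → ℝ → ℝ × ℝ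
  | [], _ => 0
  | m :: L, y => if y = m.1 then m.2 else chainMass L y

theorem chainMass_eq_zero_of_le {a : ℝ} :
    ∀ {L : List (ℝ × ℝ × ℝ)} {b : ℝ}, ValidChain a L b → ∀ {y}, b ≤ y → chainMass L y = 0
  | [], _, _, _, _ => rfl
  | m :: L, b, h, y, hy => by
    have h1 : m.1 < y := h.1.trans_le hy
    rw [chainMass, if_neg h1.ne', chainMass_eq_zero_of_le h.2.2.2 h1.le]

theorem chainMass_nonneg {a : ℝ} :
    ∀ {L : List (ℝ × ℝ × ℝ)} {b : ℝ}, ValidChain a L b → ∀ y, 0 ≤ (chainMass L y).2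
  | [], _, _, _ => le_rfl
  | m :: L, b, h, y => by
    rw [chainMass]
    split_ifs
    · exact h.2.1
    · exact chainMass_nonneg h.2.2.2 y

theorem finite_chainMass_ne_zero : ∀ L : List (ℝ × ℝ × ℝ), {y | chainMass L y ≠ 0}.Finite
  | [] => by simp [chainMass]
  | m :: L => by
    refine ((finite_chainMass_ne_zero L).insert m.1).subset fun y hy => ?_
    rw [Set.mem_ofPred_eq, chainMass] at hy
    split_ifs at hy with h
    · exact Or.inl h
    · exact Or.inr hy

theorem massList_of_chainMass {w v : ℝ → ℝ} {a : ℝ} :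
    ∀ {L : List (ℝ × ℝ × ℝ)} {b : ℝ}, ValidChain a L b →
      (∀ y ∈ Set.Ioo a b, (w y, v y) = chainMass L y) → MassList w v a L b
  | [], _, h, h' => ⟨h, fun y hy => by simpa [chainMass] using h' y hy⟩
  | m :: L, b, h, h' => by
    have hm : (w m.1, v m.1) = m.2 := by
      rw [h' m.1 ⟨h.2.2.2.lt, h.1⟩, chainMass, if_pos rfl]
    refine ⟨h.1, hm.symm, ?_, fun y hy => ?_, massList_of_chainMass h.2.2.2 fun y hy => ?_⟩
    · have := h.2.2.1
      rwa [← hm] at this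
    · have := h' y ⟨h.2.2.2.lt.trans hy.1, hy.2⟩
      rw [chainMass, if_neg hy.1.ne', chainMass_eq_zero_of_le h.2.2.2 hy.1.le] at this
      simpa using this
    · rw [h' y ⟨hy.1, hy.2.trans h.1⟩, chainMass, if_neg hy.2.ne]

theorem exists_memP_of_validChain {ℓ a : ℝ} (hℓ : 0 < ℓ) {L : List (ℝ × ℝ × ℝ)}
    (hL : ValidChain a L (a + ℓ)) (w₀ : ℝ) {v₀ : ℝ} (hv₀ : 0 ≤ v₀) :
    ∃ p, MemP ℓ p ∧ MassList (omegaMass p.1) (upsilonMass p) a L (a + ℓ) ∧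
      omegaMass p.1 a = w₀ ∧ upsilonMass p a = v₀ := by
  set f : ℝ → ℝ × ℝ := fun x =>
    if toIcoMod hℓ a x = a then (w₀, v₀) else chainMass L (toIcoMod hℓ a x) with hf
  have hper : Function.Periodic f ℓ := fun x => by simp [hf, toIcoMod_add_right]
  have hIco : ∀ x ∈ Set.Ico a (a + ℓ), toIcoMod hℓ a x = x := fun x hx => (toIcoMod_eq_self hℓ).2 hx
  obtain ⟨p, hp, hm⟩ := exists_memP (a := a) hℓ (w := fun x => (f x).1) (v := fun x => (f x).2)
    (fun x => congrArg Prod.fst (hper x)) (fun x => congrArg Prod.snd (hper x)) (fun x => by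
      simp only [hf]
      split_ifs
      · exact hv₀
      · exact chainMass_nonneg hL _) (by
      refine ((finite_chainMass_ne_zero L).insert a).subset ?_
      rintro x ⟨hx, hx'⟩
      by_cases hxa : x = a
      · exact Or.inl hxa
      · refine Or.inr fun h0 => ?_
        simp only [hf, Set.mem_ofPred_eq, hIco x hx', if_neg hxa, h0] at hx
        simp at hx)
  have hfa : f a = (w₀, v₀) := by simp [hf]
  refine ⟨p, hp, massList_of_chainMass hL fun y hy => ?_, ?_, ?_⟩
  · rw [(hm y).1, (hm y).2]
    simp only [hf, hIco y ⟨hy.1.le, hy.2⟩, if_neg hy.1.ne', Prod.mk.eta]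
  · rw [(hm a).1, hfa]
  · rw [(hm a).2, hfa]

/-! ### Bands of Δ and the zeros of Δ² - 1 -/

/-- The properties of `Δ` that determine the structure of its spectral gaps. -/
structure IsHillPoly (Δ : ℝ[X]) : Prop where
  im_eq_zero : ∀ z : ℂ, aeval z Δ = 0 → z.im = 0
  simple : ∀ x : ℝ, Δ.eval x = 0 → Δ.derivative.eval x ≠ 0
  one_lt : 1 < Δ.eval 0
  crit : ∀ x : ℝ, Δ.derivative.eval x = 0 → 1 ≤ |Δ.eval x|

theorem exists_first_eq_one {f : ℝ → ℝ} (hf : Continuous f) {x : ℝ} (hx : f x < 1)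
    (h : ∃ y, x ≤ y ∧ 1 ≤ f y) : ∃ c, x < c ∧ f c = 1 ∧ ∀ y ∈ Set.Ico x c, f y < 1 := by
  set S : Set ℝ := Set.Ici x ∩ f ⁻¹' Set.Ici 1 with hS
  have hcl : IsClosed S := isClosed_Ici.inter (isClosed_Ici.preimage hf)
  have hbdd : BddBelow S := ⟨x, fun y hy => hy.1⟩
  have hmem := hcl.csInf_mem h hbdd
  have hlt : ∀ y ∈ Set.Ico x (sInf S), f y < 1 := fun y hy => by
    by_contra hcon
    exact absurd (csInf_le hbdd ⟨hy.1, not_lt.1 hcon⟩) (not_le.2 hy.2)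
  have hxlt : x < sInf S := lt_of_le_of_ne hmem.1 fun e => by
    have := hmem.2
    rw [← e] at this
    exact absurd hx (not_lt.2 this)
  refine ⟨sInf S, hxlt, ?_, hlt⟩
  obtain ⟨y, hy, hy1⟩ := intermediate_value_Icc hmem.1 hf.continuousOn ⟨hx.le, hmem.2⟩
  rcases hy.2.lt_or_eq with h1 | h1
  · exact absurd hy1 (hlt y ⟨hy.1, h1⟩).ne
  · rw [← h1, hy1]

namespace IsHillPoly

variable {Δ : ℝ[X]}

theorem ne_zero (h : IsHillPoly Δ) : Δ ≠ 0 := by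
  rintro rfl
  simpa using h.one_lt.trans' one_pos

theorem comp_neg_X (h : IsHillPoly Δ) : IsHillPoly (Δ.comp (-X)) where
  im_eq_zero z hz := by
    rw [aeval_comp, map_neg, aeval_X] at hz
    simpa using h.im_eq_zero _ hz
  simple x hx := by
    rw [eval_comp, eval_neg, eval_X] at hx
    simpa [derivative_comp] using h.simple _ hx
  one_lt := by simpa using h.one_lt
  crit x hx := by
    have : Δ.derivative.eval (-x) = 0 := by simpa [derivative_comp] using hx
    simpa using h.crit _ this

theorem exists_right (h : IsHillPoly Δ) {x : ℝ} (hx : |Δ.eval x| < 1) :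
    ∃ c, x < c ∧ |Δ.eval c| = 1 ∧ ∀ y ∈ Set.Ico x c, |Δ.eval y| < 1 := by
  refine exists_first_eq_one (f := fun y => |Δ.eval y|) Δ.continuous.abs hx ?_
  have hdeg : 0 < Δ.degree := by
    by_contra hcon
    have h0 := eq_C_of_degree_le_zero (not_lt.1 hcon)
    have h1 := h.one_lt
    rw [h0, eval_C] at hx h1
    exact absurd (h1.trans_le (le_abs_self _)) hx.not_gt
  have ht := Δ.abs_tendsto_atTop hdeg
  obtain ⟨y, hy1, hy2⟩ := ((ht.eventually_ge_atTop 1).and (eventually_ge_atTop x)).exists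
  exact ⟨y, hy2, hy1⟩

theorem exists_band (h : IsHillPoly Δ) {x : ℝ} (hx : |Δ.eval x| < 1) :
    ∃ b c, (b < x ∧ x < c) ∧ (|Δ.eval b| = 1 ∧ |Δ.eval c| = 1) ∧
      ∀ y ∈ Set.Ioo b c, |Δ.eval y| < 1 := by
  obtain ⟨c, hc, hc1, hc2⟩ := h.exists_right hx
  obtain ⟨b, hb, hb1, hb2⟩ := h.comp_neg_X.exists_right (x := -x) (by simpa using hx)
  refine ⟨-b, c, ⟨by linarith, hc⟩, ⟨by simpa using hb1, hc1⟩, fun y hy => ?_⟩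
  rcases le_total x y with h1 | h1
  · exact hc2 y ⟨h1, hy.2⟩
  · simpa using hb2 (-y) ⟨by linarith, by linarith [hy.1]⟩

/-- Rolle's theorem provides a critical point, to which `crit` applies. -/
theorem exists_one_le_abs (h : IsHillPoly Δ) {x y : ℝ} (hxy : x < y)
    (he : Δ.eval x = Δ.eval y) : ∃ t ∈ Set.Ioo x y, 1 ≤ |Δ.eval t| := by
  obtain ⟨t, ht, ht'⟩ := exists_deriv_eq_zero hxy Δ.continuous.continuousOn he
  exact ⟨t, ht, h.crit t (by simpa using ht')⟩

/-- The components of `{|Δ| < 1}`, indexed by the roots they contain. -/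
theorem exists_bands (h : IsHillPoly Δ) : ∃ α β : ℝ → ℝ,
    (∀ ρ, Δ.eval ρ = 0 → (β ρ < ρ ∧ ρ < α ρ) ∧ (|Δ.eval (β ρ)| = 1 ∧ |Δ.eval (α ρ)| = 1) ∧
      ∀ y ∈ Set.Ioo (β ρ) (α ρ), |Δ.eval y| < 1) ∧
    (∀ ρ ρ', Δ.eval ρ = 0 → Δ.eval ρ' = 0 → ρ < ρ' → α ρ ≤ β ρ') ∧
    ∀ x, |Δ.eval x| < 1 → ∃ ρ, Δ.eval ρ = 0 ∧ x ∈ Set.Ioo (β ρ) (α ρ) := by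
  have : ∀ ρ, Δ.eval ρ = 0 → ∃ b c, (b < ρ ∧ ρ < c) ∧ (|Δ.eval b| = 1 ∧ |Δ.eval c| = 1) ∧
      ∀ y ∈ Set.Ioo b c, |Δ.eval y| < 1 := fun ρ hρ => h.exists_band (by simp [hρ])
  choose! β α hband using this
  refine ⟨α, β, hband, fun ρ ρ' hρ hρ' hlt => ?_, fun x hx => ?_⟩
  · obtain ⟨t, ht, ht1⟩ := h.exists_one_le_abs hlt (hρ.trans hρ'.symm)
    have h1 : α ρ ≤ t := by
      by_contra hcon
      exact absurd ((hband ρ hρ).2.2 t ⟨(hband ρ hρ).1.1.trans ht.1, not_le.1 hcon⟩) (not_lt.2 ht1)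
    have h2 : t ≤ β ρ' := by
      by_contra hcon
      exact absurd ((hband ρ' hρ').2.2 t ⟨not_le.1 hcon, ht.2.trans (hband ρ' hρ').1.2⟩)
        (not_lt.2 ht1)
    exact h1.trans h2
  · obtain ⟨b, c, hbc, ⟨hb, hc⟩, hlt⟩ := h.exists_band hx
    -- At the ends of a band Δ takes the values 1 and -1 in some order, since equal values would put
    -- a point with |Δ| ≥ 1 inside.
    have hroot : ∃ ρ ∈ Set.Ioo b c, Δ.eval ρ = 0 := by
      by_contra! hcon
      have hbc' : b < c := hbc.1.trans hbc.2
      have he : Δ.eval b ≠ Δ.eval c := fun he => by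
        obtain ⟨t, ht, ht1⟩ := h.exists_one_le_abs hbc' he
        exact absurd (hlt t ht) (not_lt.2 ht1)
      have hcont : ContinuousOn (fun y => Δ.eval y) (Set.Icc b c) := Δ.continuous.continuousOn
      rcases eq_or_eq_neg_of_abs_eq hb with h1 | h1 <;> rcases eq_or_eq_neg_of_abs_eq hc with h2 | h2
      · exact he (h1.trans h2.symm)
      · obtain ⟨t, ht, ht0⟩ := intermediate_value_Ioo' hbc'.le hcont
          (show (0 : ℝ) ∈ _ from ⟨by simp [h2], by simp [h1]⟩)
        exact hcon t ht ht0
      · obtain ⟨t, ht, ht0⟩ := intermediate_value_Ioo hbc'.le hcont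
          (show (0 : ℝ) ∈ _ from ⟨by simp [h1], by simp [h2]⟩)
        exact hcon t ht ht0
      · exact he (h1.trans h2.symm)
    obtain ⟨ρ, hρ, hρ0⟩ := hroot
    obtain ⟨⟨k1, k2⟩, ⟨k3, k4⟩, k5⟩ := hband ρ hρ0
    refine ⟨ρ, hρ0, ?_, ?_⟩
    · by_contra hcon
      exact (hlt (β ρ) ⟨hbc.1.trans_le (not_lt.1 hcon), k1.trans hρ.2⟩).ne k3
    · by_contra hcon
      exact (hlt (α ρ) ⟨hρ.1.trans k2, (not_lt.1 hcon).trans_lt hbc.2⟩).ne k4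

/-- Every band supplies two end points. A point where two bands meet is a local maximum of Δ², hence
a multiple zero of Δ² - 1, so the end points count with multiplicity. There are 2 deg Δ of them,
which exhausts the degree. -/
theorem roots_sq_sub_one (h : IsHillPoly Δ) {α β : ℝ → ℝ}
    (hband : ∀ ρ, Δ.eval ρ = 0 → (β ρ < ρ ∧ ρ < α ρ) ∧ (|Δ.eval (β ρ)| = 1 ∧ |Δ.eval (α ρ)| = 1) ∧
      ∀ y ∈ Set.Ioo (β ρ) (α ρ), |Δ.eval y| < 1)
    (hlt : ∀ ρ ρ', Δ.eval ρ = 0 → Δ.eval ρ' = 0 → ρ < ρ' → α ρ ≤ β ρ') :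
    (Δ ^ 2 - 1).roots = Δ.roots.toFinset.val.map α + Δ.roots.toFinset.val.map β := by
  have hne : Δ ^ 2 - 1 ≠ 0 := fun h0 => by
    have := congrArg (eval 0) h0
    simp only [eval_sub, eval_pow, eval_one, eval_zero] at this
    nlinarith [h.one_lt]
  have hR : ∀ ρ, ρ ∈ Δ.roots.toFinset ↔ Δ.eval ρ = 0 := fun ρ => mem_rootsFinset h.ne_zero
  have hαinj : Set.InjOn α {ρ | Δ.eval ρ = 0} := by
    intro ρ hρ ρ' hρ' he
    rcases lt_trichotomy ρ ρ' with h1 | h1 | h1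
    · linarith [hlt ρ ρ' hρ hρ' h1, (hband ρ' hρ').1]
    · exact h1
    · linarith [hlt ρ' ρ hρ' hρ h1, (hband ρ hρ).1]
  have hβinj : Set.InjOn β {ρ | Δ.eval ρ = 0} := by
    intro ρ hρ ρ' hρ' he
    rcases lt_trichotomy ρ ρ' with h1 | h1 | h1
    · linarith [hlt ρ ρ' hρ hρ' h1, (hband ρ hρ).1]
    · exact h1
    · linarith [hlt ρ' ρ hρ' hρ h1, (hband ρ' hρ').1]
  have hroot : ∀ y, |Δ.eval y| = 1 → (Δ ^ 2 - 1).IsRoot y := fun y hy => by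
    rw [IsRoot, eval_sub, eval_pow, ← sq_abs, hy]; simp
  have hAn : (Δ.roots.toFinset.val.map α).Nodup :=
    Multiset.Nodup.map_on (fun x hx y hy => hαinj ((hR x).1 hx) ((hR y).1 hy))
      Δ.roots.toFinset.nodup
  have hBn : (Δ.roots.toFinset.val.map β).Nodup :=
    Multiset.Nodup.map_on (fun x hx y hy => hβinj ((hR x).1 hx) ((hR y).1 hy))
      Δ.roots.toFinset.nodup
  symm
  refine Multiset.eq_of_le_of_card_le ?_ ?_
  · classical
    rw [Multiset.le_iff_count]
    intro y
    rw [Multiset.count_add, count_roots]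
    have hA1 := Multiset.nodup_iff_count_le_one.1 hAn y
    have hB1 := Multiset.nodup_iff_count_le_one.1 hBn y
    by_cases hA : y ∈ Δ.roots.toFinset.val.map α
    · obtain ⟨ρ, hρ, rfl⟩ := Multiset.mem_map.1 hA
      have hρ0 := (hR ρ).1 hρ
      have hy1 := (hband ρ hρ0).2.1.2
      by_cases hB : α ρ ∈ Δ.roots.toFinset.val.map β
      · obtain ⟨ρ', hρ', he⟩ := Multiset.mem_map.1 hB
        have hρ0' := (hR ρ').1 hρ'
        have hmax : IsLocalMax (fun x => (Δ ^ 2).eval x) (α ρ) := by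
          have hU : Set.Ioo (β ρ) (α ρ') ∈ 𝓝 (α ρ) :=
            Ioo_mem_nhds ((hband ρ hρ0).1.1.trans (hband ρ hρ0).1.2)
              (he ▸ (hband ρ' hρ0').1.1.trans (hband ρ' hρ0').1.2)
          filter_upwards [hU] with x hx
          simp only [eval_pow]
          rw [sq_le_sq, hy1]
          rcases lt_trichotomy x (α ρ) with h1 | h1 | h1
          · exact ((hband ρ hρ0).2.2 x ⟨hx.1, h1⟩).le
          · rw [h1, hy1]
          · exact ((hband ρ' hρ0').2.2 x ⟨he ▸ h1, hx.2⟩).le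
        have hd : (Δ ^ 2).derivative.eval (α ρ) = 0 := by
          have := hmax.deriv_eq_zero
          rwa [Polynomial.deriv] at this
        have : 1 < (Δ ^ 2 - 1).rootMultiplicity (α ρ) := by
          rw [one_lt_rootMultiplicity_iff_isRoot hne]
          exact ⟨hroot _ hy1, by rw [IsRoot, derivative_sub, derivative_one, sub_zero, hd]⟩
        omega
      · rw [Multiset.count_eq_zero_of_notMem hB]
        have : 0 < (Δ ^ 2 - 1).rootMultiplicity (α ρ) :=
          (rootMultiplicity_pos hne).2 (hroot _ hy1)
        omega
    · rw [Multiset.count_eq_zero_of_notMem hA]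
      by_cases hB : y ∈ Δ.roots.toFinset.val.map β
      · obtain ⟨ρ, hρ, rfl⟩ := Multiset.mem_map.1 hB
        have : 0 < (Δ ^ 2 - 1).rootMultiplicity (β ρ) :=
          (rootMultiplicity_pos hne).2 (hroot _ (hband ρ ((hR ρ).1 hρ)).2.1.1)
        omega
      · rw [Multiset.count_eq_zero_of_notMem hB]; omega
  · refine (card_roots' _).trans ?_
    rw [Multiset.card_add, Multiset.card_map, Multiset.card_map]
    have h1 : Δ.roots.toFinset.val.card = Δ.natDegree := card_roots_eq_natDegree h.im_eq_zero h.simple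
    rw [h1]
    refine (natDegree_sub_le _ _).trans ?_
    rw [natDegree_one, natDegree_pow]
    exact max_le (by omega) (by omega)

end IsHillPoly

/-! ### Counting band edges and ordering the zeros -/

/-- Counting the end points of ordered disjoint intervals `(β ρ, α ρ)` to the left of a point `x`. -/
theorem card_endpoints (S : Finset ℝ) {α β : ℝ → ℝ} (hβ : ∀ ρ ∈ S, β ρ < ρ) (hα : ∀ ρ ∈ S, ρ < α ρ)
    (hlt : ∀ ρ ∈ S, ∀ ρ' ∈ S, ρ < ρ' → α ρ ≤ β ρ') (x : ℝ) (i : ℕ) :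
    (2 * i ≤ (S.filter (α · ≤ x)).card + (S.filter (β · ≤ x)).card ∧
      (S.filter (α · < x)).card + (S.filter (β · < x)).card ≤ 2 * i) ↔
    ((S.filter (· < x)).card = i ∧ ∀ ρ ∈ S, x ∉ Set.Ioo (β ρ) (α ρ)) := by
  by_cases hx : ∃ ρ ∈ S, x ∈ Set.Ioo (β ρ) (α ρ)
  -- Inside a band one more left end than right end lies below x, and x itself is no end point. The
  -- total is odd, so it cannot be 2i.
  · obtain ⟨ρ, hρ, hxρ⟩ := hx
    have e1 : S.filter (α · ≤ x) = S.filter (· < ρ) := by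
      refine Finset.filter_congr fun t ht => ⟨fun h => ?_, fun h => ?_⟩
      · by_contra hcon
        rcases (not_lt.1 hcon).eq_or_lt with h1 | h1
        · rw [← h1] at h; linarith [hxρ.2]
        · linarith [hlt ρ hρ t ht h1, hβ t ht, hα t ht, hxρ.2]
      · linarith [hlt t ht ρ hρ h, hxρ.1]
    have e2 : S.filter (α · < x) = S.filter (· < ρ) := by
      refine Finset.filter_congr fun t ht => ⟨fun h => ?_, fun h => ?_⟩
      · by_contra hcon
        rcases (not_lt.1 hcon).eq_or_lt with h1 | h1
        · rw [← h1] at h; linarith [hxρ.2]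
        · linarith [hlt ρ hρ t ht h1, hβ t ht, hα t ht, hxρ.2]
      · linarith [hlt t ht ρ hρ h, hxρ.1]
    have e3 : S.filter (β · ≤ x) = insert ρ (S.filter (· < ρ)) := by
      ext t
      simp only [Finset.mem_filter, Finset.mem_insert]
      constructor
      · rintro ⟨ht, h⟩
        rcases lt_trichotomy t ρ with h1 | h1 | h1
        · exact Or.inr ⟨ht, h1⟩
        · exact Or.inl h1
        · linarith [hlt ρ hρ t ht h1, hxρ.2]
      · rintro (rfl | ⟨ht, h⟩)
        · exact ⟨hρ, hxρ.1.le⟩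
        · exact ⟨ht, by linarith [hlt t ht ρ hρ h, hβ t ht, hα t ht, hxρ.1]⟩
    have e4 : S.filter (β · < x) = insert ρ (S.filter (· < ρ)) := by
      ext t
      simp only [Finset.mem_filter, Finset.mem_insert]
      constructor
      · rintro ⟨ht, h⟩
        rcases lt_trichotomy t ρ with h1 | h1 | h1
        · exact Or.inr ⟨ht, h1⟩
        · exact Or.inl h1
        · linarith [hlt ρ hρ t ht h1, hxρ.2]
      · rintro (rfl | ⟨ht, h⟩)
        · exact ⟨hρ, hxρ.1⟩
        · exact ⟨ht, by linarith [hlt t ht ρ hρ h, hβ t ht, hα t ht, hxρ.1]⟩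
    rw [e1, e2, e3, e4, Finset.card_insert_of_notMem (by simp)]
    refine ⟨fun h => by omega, fun h => absurd hxρ (h.2 ρ hρ)⟩
  -- Off the bands, each root below x contributes both its ends (weakly for the right one). At x
  -- itself at most one left and one right end can sit, which limits the gap between strict and weak
  -- counts.
  · push Not at hx
    have hx' : ∀ ρ ∈ S, α ρ ≤ x ∨ x ≤ β ρ := fun ρ hρ => by
      have := hx ρ hρ
      rw [Set.mem_Ioo, not_and_or, not_lt, not_lt] at this
      exact this.symm
    have e1 : S.filter (α · ≤ x) = S.filter (· < x) :=
      Finset.filter_congr fun t ht => ⟨fun h => (hα t ht).trans_le h, fun h => by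
        rcases hx' t ht with h1 | h1
        · exact h1
        · linarith [hβ t ht]⟩
    have e2 : S.filter (β · < x) = S.filter (· < x) :=
      Finset.filter_congr fun t ht => ⟨fun h => by
        rcases hx' t ht with h1 | h1
        · linarith [hα t ht]
        · linarith, fun h => (hβ t ht).trans h⟩
    have e3 : (S.filter (α · ≤ x)).card ≤ (S.filter (α · < x)).card + 1 := by
      have hsub : S.filter (α · ≤ x) ⊆ S.filter (α · < x) ∪ S.filter (α · = x) := fun t ht => by
        simp only [Finset.mem_union, Finset.mem_filter] at ht ⊢
        rcases ht.2.lt_or_eq with h1 | h1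
        · exact Or.inl ⟨ht.1, h1⟩
        · exact Or.inr ⟨ht.1, h1⟩
      have hone : (S.filter (α · = x)).card ≤ 1 := Finset.card_le_one.2 fun t ht t' ht' => by
        rw [Finset.mem_filter] at ht ht'
        rcases lt_trichotomy t t' with h1 | h1 | h1
        · linarith [hlt t ht.1 t' ht'.1 h1, hβ t' ht'.1, hα t' ht'.1]
        · exact h1
        · linarith [hlt t' ht'.1 t ht.1 h1, hβ t ht.1, hα t ht.1]
      exact (Finset.card_le_card hsub).trans ((Finset.card_union_le _ _).trans (by omega))
    have e4 : (S.filter (β · ≤ x)).card ≤ (S.filter (β · < x)).card + 1 := by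
      have hsub : S.filter (β · ≤ x) ⊆ S.filter (β · < x) ∪ S.filter (β · = x) := fun t ht => by
        simp only [Finset.mem_union, Finset.mem_filter] at ht ⊢
        rcases ht.2.lt_or_eq with h1 | h1
        · exact Or.inl ⟨ht.1, h1⟩
        · exact Or.inr ⟨ht.1, h1⟩
      have hone : (S.filter (β · = x)).card ≤ 1 := Finset.card_le_one.2 fun t ht t' ht' => by
        rw [Finset.mem_filter] at ht ht'
        rcases lt_trichotomy t t' with h1 | h1 | h1
        · linarith [hlt t ht.1 t' ht'.1 h1, hβ t ht.1, hα t ht.1]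
        · exact h1
        · linarith [hlt t' ht'.1 t ht.1 h1, hβ t' ht'.1, hα t' ht'.1]
      exact (Finset.card_le_card hsub).trans ((Finset.card_union_le _ _).trans (by omega))
    have e5 : (S.filter (β · < x)).card ≤ (S.filter (β · ≤ x)).card :=
      Finset.card_le_card (Finset.monotone_filter_right _ fun _ _ h => le_of_lt h)
    have e6 : (S.filter (α · < x)).card ≤ (S.filter (α · ≤ x)).card :=
      Finset.card_le_card (Finset.monotone_filter_right _ fun _ _ h => le_of_lt h)
    rw [e1] at e3 e6 ⊢
    rw [e2] at e4 e5 ⊢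
    refine ⟨fun h => ⟨by omega, hx⟩, fun h => by omega⟩

theorem getD_le_iff_lt_countP {l : List ℝ} (hl : l.Pairwise (· ≤ ·)) {k : ℕ} (hk : k < l.length)
    (x d : ℝ) : l.getD k d ≤ x ↔ k < l.countP (· ≤ x) := by
  induction l generalizing k with
  | nil => simp at hk
  | cons y l ih =>
    rw [List.pairwise_cons] at hl
    rw [List.countP_cons]
    by_cases hy : y ≤ x
    · cases k with
      | zero => simp [hy]
      | succ k =>
        rw [List.getD_cons_succ, ih hl.2 (by simpa using hk)]
        simp [hy]
    · have h0 : l.countP (· ≤ x) = 0 := by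
        rw [List.countP_eq_zero]
        intro t ht
        simpa using (not_le.1 hy).trans_le (hl.1 t ht)
      rw [h0]
      cases k with
      | zero => simp [hy]
      | succ k =>
        rw [List.getD_cons_succ, ih hl.2 (by simpa using hk), h0]
        simp [hy]

theorem le_getD_iff_countP_le {l : List ℝ} (hl : l.Pairwise (· ≤ ·)) {k : ℕ} (hk : k < l.length)
    (x d : ℝ) : x ≤ l.getD k d ↔ l.countP (· < x) ≤ k := by
  induction l generalizing k with
  | nil => simp at hk
  | cons y l ih =>
    rw [List.pairwise_cons] at hl
    rw [List.countP_cons]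
    by_cases hy : y < x
    · cases k with
      | zero => simp [hy]
      | succ k =>
        rw [List.getD_cons_succ, ih hl.2 (by simpa using hk)]
        simp [hy]
    · have h0 : l.countP (· < x) = 0 := by
        rw [List.countP_eq_zero]
        intro t ht
        simpa using (not_lt.1 hy).trans (hl.1 t ht)
      rw [h0]
      cases k with
      | zero => simp
      | succ k =>
        rw [List.getD_cons_succ, ih hl.2 (by simpa using hk), h0]
        simp [hy]

/-- The positive roots of a polynomial. -/
def posZeros (f : ℝ[X]) : Finset ℝ := f.roots.toFinset.filter (0 < ·)

theorem mem_posZeros {f : ℝ[X]} (hf : f ≠ 0) {x : ℝ} : x ∈ posZeros f ↔ f.eval x = 0 ∧ 0 < x := by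
  rw [posZeros, Finset.mem_filter, mem_rootsFinset hf]

namespace IsHillPoly

variable {Δ : ℝ[X]}

/-- As Δ(0) > 1, no closed band contains 0, so the positive zeros of Δ² - 1 are the ends of the
bands around positive zeros of Δ. The two inequalities in the second part encode λ_{2i} ≤ x ≤
λ_{2i+1}. -/
theorem posRoots_spec (h : IsHillPoly Δ) : (posRoots Δ).card = 2 * (posZeros Δ).card ∧
    ∀ (x : ℝ) (i : ℕ), (2 * i ≤ (posRoots Δ).countP (· ≤ x) ∧ (posRoots Δ).countP (· < x) ≤ 2 * i) ↔
      (((posZeros Δ).filter (· < x)).card = i ∧ (0 < x → 1 ≤ |Δ.eval x|)) := by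
  obtain ⟨α, β, hband, hlt, hex⟩ := h.exists_bands
  have hroots := h.roots_sq_sub_one hband hlt
  have hR : ∀ ρ, ρ ∈ Δ.roots.toFinset ↔ Δ.eval ρ = 0 := fun ρ => mem_rootsFinset h.ne_zero
  have hz : ∀ ρ, Δ.eval ρ = 0 → ((0 < ρ → 0 < β ρ) ∧ (ρ ≤ 0 → α ρ < 0)) := by
    intro ρ hρ
    have h0 : (0 : ℝ) ∉ Set.Ioo (β ρ) (α ρ) := fun h0 =>
      absurd ((hband ρ hρ).2.2 0 h0) (not_lt.2 (h.one_lt.le.trans (le_abs_self _)))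
    have hβ0 : β ρ ≠ 0 := fun e => by
      have := (hband ρ hρ).2.1.1
      rw [e] at this
      exact absurd (h.one_lt.trans_le (le_abs_self _)) this.not_gt
    have hα0 : α ρ ≠ 0 := fun e => by
      have := (hband ρ hρ).2.1.2
      rw [e] at this
      exact absurd (h.one_lt.trans_le (le_abs_self _)) this.not_gt
    rw [Set.mem_Ioo, not_and_or, not_lt, not_lt] at h0
    have := (hband ρ hρ).1
    constructor
    · intro h1
      rcases h0 with h0 | h0
      · exact lt_of_le_of_ne h0 hβ0.symm
      · linarith
    · intro h1
      rcases h0 with h0 | h0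
      · linarith
      · exact lt_of_le_of_ne h0 hα0
  have hpos : posRoots Δ = (posZeros Δ).val.map α + (posZeros Δ).val.map β := by
    rw [posRoots, hroots, Multiset.filter_add, Multiset.filter_map, Multiset.filter_map, posZeros,
      Finset.filter_val]
    congr 2
    · refine Multiset.filter_congr fun ρ hρ => ?_
      have hρ0 := (hR ρ).1 hρ
      have := (hband ρ hρ0).1
      refine ⟨fun h1 => ?_, fun h1 => ?_⟩
      · by_contra hcon
        exact absurd ((hz ρ hρ0).2 (not_lt.1 hcon)) (not_lt.2 (le_of_lt h1))
      · exact h1.trans this.2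
    · refine Multiset.filter_congr fun ρ hρ => ?_
      have hρ0 := (hR ρ).1 hρ
      have := (hband ρ hρ0).1
      exact ⟨fun h1 => lt_trans h1 this.1, fun h1 => (hz ρ hρ0).1 h1⟩
  have hS : ∀ ρ ∈ posZeros Δ, Δ.eval ρ = 0 ∧ 0 < ρ := fun ρ hρ => (mem_posZeros h.ne_zero).1 hρ
  refine ⟨?_, fun x i => ?_⟩
  · rw [hpos, Multiset.card_add, Multiset.card_map, Multiset.card_map, Finset.card_val, two_mul]
  · have key := card_endpoints (posZeros Δ) (fun ρ hρ => (hband ρ (hS ρ hρ).1).1.1)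
      (fun ρ hρ => (hband ρ (hS ρ hρ).1).1.2)
      (fun ρ hρ ρ' hρ' => hlt ρ ρ' (hS ρ hρ).1 (hS ρ' hρ').1) x i
    have hc : ∀ (P : ℝ → Prop) [DecidablePred P] (g : ℝ → ℝ),
        ((posZeros Δ).val.map g).countP P = ((posZeros Δ).filter (fun ρ => P (g ρ))).card := by
      intro P _ g
      rw [Multiset.countP_map]; rfl
    rw [hpos, Multiset.countP_add, Multiset.countP_add, hc, hc, hc, hc, key]
    refine and_congr_right fun _ => ⟨fun h1 hx0 => ?_, fun h1 ρ hρ hx => ?_⟩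
    · by_contra hcon
      obtain ⟨ρ, hρ, hx⟩ := hex x (not_le.1 hcon)
      have hρ0 : 0 < ρ := by
        by_contra hneg
        linarith [(hz ρ hρ).2 (not_lt.1 hneg), hx.2]
      exact h1 ρ ((mem_posZeros h.ne_zero).2 ⟨hρ, hρ0⟩) hx
    · have hρ0 := hS ρ hρ
      exact absurd ((hband ρ hρ0.1).2.2 x hx)
        (not_lt.2 (h1 (((hz ρ hρ0.1).1 hρ0.2).trans hx.1)))

theorem numPos_eq (h : IsHillPoly Δ) : numPos Δ = (posZeros Δ).card := by
  rw [numPos, h.posRoots_spec.1]; simp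

/-- The upper bound is conditional because λ_{2i+1} does not exist for i = I₊, where the gap is
unbounded. -/
theorem lam_spec (h : IsHillPoly Δ) {i : ℕ} (hi : 0 < i) (hi' : i ≤ numPos Δ) (x : ℝ) :
    (lam Δ (2 * i) ≤ x ∧ (i < numPos Δ → x ≤ lam Δ (2 * i + 1))) ↔
      ((posZeros Δ).filter (· < x)).card = i ∧ 1 ≤ |Δ.eval x| := by
  have hlen : ((posRoots Δ).sort (· ≤ ·)).length = 2 * numPos Δ := by
    rw [Multiset.length_sort, h.posRoots_spec.1, h.numPos_eq]
  have hcnt : ∀ (P : ℝ → Prop) [DecidablePred P],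
      ((posRoots Δ).sort (· ≤ ·)).countP (fun t => decide (P t)) = (posRoots Δ).countP P := by
    intro P _
    conv_rhs => rw [← Multiset.sort_eq (posRoots Δ) (· ≤ ·)]
    rw [Multiset.coe_countP]
  have hsort : ((posRoots Δ).sort (· ≤ ·)).Pairwise (· ≤ ·) := Multiset.pairwise_sort _ _
  have e1 : lam Δ (2 * i) ≤ x ↔ 2 * i ≤ (posRoots Δ).countP (· ≤ x) := by
    rw [lam, if_pos (by omega), getD_le_iff_lt_countP hsort (by omega), hcnt]
    omega
  have e2 : (i < numPos Δ → x ≤ lam Δ (2 * i + 1)) ↔ (posRoots Δ).countP (· < x) ≤ 2 * i := by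
    by_cases hlt : i < numPos Δ
    · rw [lam, if_pos (by omega), le_getD_iff_countP_le hsort (by omega), hcnt]
      simp only [hlt, true_imp_iff]
      omega
    · have := Multiset.countP_le_card (· < x) (posRoots Δ)
      rw [h.posRoots_spec.1, ← h.numPos_eq] at this
      simp only [hlt, false_imp_iff, true_iff]
      omega
  rw [e1, e2, h.posRoots_spec.2 x i]
  refine and_congr_right fun hc => ⟨fun h1 => h1 ?_, fun h1 _ => h1⟩
  obtain ⟨ρ, hρ⟩ := Finset.card_pos.1 (hc ▸ hi)
  rw [Finset.mem_filter, mem_posZeros h.ne_zero] at hρ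
  exact hρ.1.2.trans hρ.2

end IsHillPoly

/-! ### Signs of polynomials from zeros counted between 0 and a point -/

/-- The elements of `S` that lie strictly between `0` and `x`. -/
def between (S : Finset ℝ) (x : ℝ) : Finset ℝ :=
  S.filter fun κ => (0 < κ ∧ κ < x) ∨ (x < κ ∧ κ < 0)

theorem between_of_pos (S : Finset ℝ) {x : ℝ} (hx : 0 < x) :
    between S x = (S.filter (0 < ·)).filter (· < x) := by
  ext κ
  simp only [between, Finset.mem_filter, and_assoc]
  refine and_congr_right fun _ => ⟨?_, Or.inl⟩
  rintro (h | h)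
  · exact h
  · linarith

theorem card_between_image_neg (S : Finset ℝ) (x : ℝ) :
    (between (S.image (-·)) (-x)).card = (between S x).card := by
  have : between (S.image (-·)) (-x) = (between S x).image (-·) := by
    ext κ
    simp only [between, Finset.mem_filter, Finset.mem_image]
    constructor
    · rintro ⟨⟨t, ht, rfl⟩, h⟩
      refine ⟨t, ⟨ht, ?_⟩, rfl⟩
      rcases h with h | h
      · exact Or.inr ⟨by linarith, by linarith⟩
      · exact Or.inl ⟨by linarith, by linarith⟩
    · rintro ⟨t, ⟨ht, h⟩, rfl⟩
      refine ⟨⟨t, ht, rfl⟩, ?_⟩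
      rcases h with h | h
      · exact Or.inr ⟨by linarith, by linarith⟩
      · exact Or.inl ⟨by linarith, by linarith⟩
  rw [this, Finset.card_image_of_injective _ neg_injective]

theorem between_mono (S : Finset ℝ) {x y : ℝ} (hx : 0 < x) (hxy : x ≤ y) :
    (between S x).card ≤ (between S y).card := by
  refine Finset.card_le_card fun κ hκ => ?_
  simp only [between, Finset.mem_filter] at hκ ⊢
  refine ⟨hκ.1, Or.inl ?_⟩
  rcases hκ.2 with h | h
  · exact ⟨h.1, h.2.trans_le hxy⟩
  · linarith

theorem card_between_lt_card {S : Finset ℝ} {x y : ℝ} (hx : 0 < x) (hxS : x ∈ S) (hxy : x < y) :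
    (between S x).card < (between S y).card := by
  refine Finset.card_lt_card (Finset.ssubset_iff_of_subset ?_ |>.2 ⟨x, ?_, ?_⟩)
  · intro κ hκ
    simp only [between, Finset.mem_filter] at hκ ⊢
    refine ⟨hκ.1, Or.inl ?_⟩
    rcases hκ.2 with h | h
    · exact ⟨h.1, h.2.trans hxy⟩
    · linarith
  · simp [between, hxS, hx, hxy]
  · simp [between]

/-- An element of `S` is determined by its sign and the number of elements between `0` and it. -/
theorem eq_of_card_between_eq {S : Finset ℝ} {x y : ℝ} (hx : x ∈ S) (hy : y ∈ S) (hxy : 0 < x * y)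
    (h : (between S x).card = (between S y).card) : x = y := by
  have key : ∀ {S : Finset ℝ} {x y : ℝ}, x ∈ S → y ∈ S → 0 < x → 0 < y →
      (between S x).card = (between S y).card → x = y := by
    intro S x y hx hy hx0 hy0 h
    rcases lt_trichotomy x y with h1 | h1 | h1
    · exact absurd h (card_between_lt_card hx0 hx h1).ne
    · exact h1
    · exact absurd h (card_between_lt_card hy0 hy h1).ne'
  rcases pos_and_pos_or_neg_and_neg_of_mul_pos hxy with h0 | h0
  · exact key hx hy h0.1 h0.2 h
  · refine neg_injective (key (S := S.image (-·)) (Finset.mem_image_of_mem _ hx)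
      (Finset.mem_image_of_mem _ hy) (by simpa using h0.1) (by simpa using h0.2) ?_)
    simpa only [card_between_image_neg] using h

/-- The polynomial with roots `S` and value `1` at `0`. -/
def unitPoly (S : Finset ℝ) : ℝ[X] := ∏ κ ∈ S, (1 - C κ⁻¹ * X)

theorem eval_unitPoly (S : Finset ℝ) (x : ℝ) : (unitPoly S).eval x = ∏ κ ∈ S, (1 - κ⁻¹ * x) := by
  simp [unitPoly, eval_prod]

theorem eval_zero_unitPoly (S : Finset ℝ) : (unitPoly S).eval 0 = 1 := by
  simp [eval_unitPoly]

theorem unitPoly_ne_zero (S : Finset ℝ) : unitPoly S ≠ 0 := fun h => by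
  simpa [h] using eval_zero_unitPoly S

theorem eval_unitPoly_eq_zero_iff {S : Finset ℝ} (h0 : (0 : ℝ) ∉ S) {x : ℝ} :
    (unitPoly S).eval x = 0 ↔ x ∈ S := by
  rw [eval_unitPoly, Finset.prod_eq_zero_iff]
  constructor
  · rintro ⟨κ, hκ, h⟩
    have hκ0 : κ ≠ 0 := fun e => h0 (e ▸ hκ)
    have : x = κ := by field_simp at h; linarith
    exact this ▸ hκ
  · intro hx
    have hx0 : x ≠ 0 := fun e => h0 (e ▸ hx)
    exact ⟨x, hx, by field_simp; ring⟩

theorem aeval_unitPoly_im {S : Finset ℝ} {z : ℂ} (hz : aeval z (unitPoly S) = 0) : z.im = 0 := by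
  rw [unitPoly, map_prod, Finset.prod_eq_zero_iff] at hz
  obtain ⟨κ, _, h⟩ := hz
  simp only [map_sub, map_one, map_mul, aeval_C, aeval_X, Complex.coe_algebraMap] at h
  have h1 := congrArg Complex.re h
  have h2 := congrArg Complex.im h
  simp at h1 h2
  rcases h2 with h2 | h2
  · simp [h2] at h1
  · exact h2

theorem unitPoly_eq_C_mul_prod {S : Finset ℝ} (h0 : (0 : ℝ) ∉ S) :
    unitPoly S = C (∏ κ ∈ S, (-κ⁻¹)) * ∏ κ ∈ S, (X - C κ) := by
  rw [map_prod, ← Finset.prod_mul_distrib, unitPoly]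
  refine Finset.prod_congr rfl fun κ hκ => ?_
  have hκ0 : κ ≠ 0 := fun e => h0 (e ▸ hκ)
  rw [mul_sub, ← C_mul, neg_mul, inv_mul_cancel₀ hκ0]
  simp; ring

theorem natDegree_unitPoly {S : Finset ℝ} (h0 : (0 : ℝ) ∉ S) : (unitPoly S).natDegree = S.card := by
  rw [unitPoly_eq_C_mul_prod h0, natDegree_C_mul, natDegree_prod_of_monic _ _
    fun κ _ => monic_X_sub_C κ]
  · simp
  · refine Finset.prod_ne_zero_iff.2 fun κ hκ => ?_
    have hκ0 : κ ≠ 0 := fun e => h0 (e ▸ hκ)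
    simpa using hκ0

theorem leadingCoeff_unitPoly {S : Finset ℝ} (h0 : (0 : ℝ) ∉ S) :
    (unitPoly S).leadingCoeff = ∏ κ ∈ S, (-κ⁻¹) := by
  rw [unitPoly_eq_C_mul_prod h0, leadingCoeff_mul, leadingCoeff_C,
    (monic_prod_of_monic _ _ fun κ _ => monic_X_sub_C κ).leadingCoeff, mul_one]

theorem prod_neg_one_pow {S : Finset ℝ} (P : ℝ → Prop) [DecidablePred P] {f : ℝ → ℝ}
    (h1 : ∀ κ ∈ S, P κ → f κ < 0) (h2 : ∀ κ ∈ S, ¬ P κ → 0 < f κ) :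
    0 < (-1) ^ (S.filter P).card * ∏ κ ∈ S, f κ := by
  rw [← Finset.prod_filter_mul_prod_filter_not S P f, ← mul_assoc, ← Finset.prod_const,
    ← Finset.prod_mul_distrib]
  refine mul_pos (Finset.prod_pos fun κ hκ => ?_) (Finset.prod_pos fun κ hκ => ?_)
  · rw [Finset.mem_filter] at hκ
    linarith [h1 κ hκ.1 hκ.2]
  · rw [Finset.mem_filter] at hκ
    exact h2 κ hκ.1 hκ.2

theorem sign_leadingCoeff_unitPoly {S : Finset ℝ} (h0 : (0 : ℝ) ∉ S) :
    0 < (-1) ^ (S.filter (0 < ·)).card * (unitPoly S).leadingCoeff := by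
  rw [leadingCoeff_unitPoly h0]
  refine prod_neg_one_pow _ (fun κ _ h => by simpa using h) fun κ hκ h => ?_
  have hκ0 : κ ≠ 0 := fun e => h0 (e ▸ hκ)
  simpa using lt_of_le_of_ne (not_lt.1 h) hκ0

/-- The factor 1 - x/κ is negative precisely for κ strictly between 0 and x. -/
theorem sign_eval_unitPoly {S : Finset ℝ} (h0 : (0 : ℝ) ∉ S) {x : ℝ} (hx : x ∉ S) :
    0 < (-1) ^ (between S x).card * (unitPoly S).eval x := by
  rw [eval_unitPoly, between]
  refine prod_neg_one_pow _ (fun κ hκ h => ?_) fun κ hκ h => ?_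
  · rcases h with h | h
    · have : 1 < κ⁻¹ * x := by rw [inv_mul_eq_div, one_lt_div h.1]; exact h.2
      linarith
    · have : 1 < κ⁻¹ * x := by rw [inv_mul_eq_div, one_lt_div_of_neg h.2]; exact h.1
      linarith
  · have hκ0 : κ ≠ 0 := fun e => h0 (e ▸ hκ)
    have hne : κ ≠ x := fun e => hx (e ▸ hκ)
    rw [not_or, not_and, not_and, not_lt, not_lt] at h
    have : κ⁻¹ * x < 1 := by
      rcases lt_or_gt_of_ne hκ0 with h1 | h1
      · rw [inv_mul_eq_div, div_lt_one_of_neg h1]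
        by_contra hcon
        exact absurd h1 (not_lt.2 (h.2 (lt_of_le_of_ne (not_lt.1 hcon) hne.symm)))
      · rw [inv_mul_eq_div, div_lt_one h1]
        exact lt_of_le_of_ne (h.1 h1) hne.symm
    linarith

/-- Splitting off the factor 1 - X/κ shows that κ times the derivative at κ is minus the value of
the remaining product. -/
theorem sign_derivative_unitPoly {S : Finset ℝ} (h0 : (0 : ℝ) ∉ S) {κ : ℝ} (hκ : κ ∈ S) :
    (-1) ^ (between S κ).card * (κ * (unitPoly S).derivative.eval κ) < 0 := by
  have hκ0 : κ ≠ 0 := fun e => h0 (e ▸ hκ)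
  have e : unitPoly S = (1 - C κ⁻¹ * X) * unitPoly (S.erase κ) :=
    (Finset.mul_prod_erase S (fun κ => 1 - C κ⁻¹ * X) hκ).symm
  have e2 : κ * (unitPoly S).derivative.eval κ = -(unitPoly (S.erase κ)).eval κ := by
    rw [e, derivative_mul]
    simp
    field_simp
    ring
  have e3 : between S κ = between (S.erase κ) κ := by
    ext t
    simp only [between, Finset.mem_filter, Finset.mem_erase]
    constructor
    · rintro ⟨h1, h2⟩
      refine ⟨⟨?_, h1⟩, h2⟩
      rintro rfl
      simp at h2
    · rintro ⟨h1, h2⟩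
      exact ⟨h1.2, h2⟩
  rw [e2, e3]
  have := sign_eval_unitPoly (S := S.erase κ) (fun h => h0 (Finset.mem_of_mem_erase h))
    (Finset.notMem_erase κ S)
  linarith

theorem eq_C_mul_unitPoly {f : ℝ[X]} (h : ∀ z : ℂ, aeval z f = 0 → z.im = 0)
    (hs : ∀ x : ℝ, f.eval x = 0 → f.derivative.eval x ≠ 0) (h0 : f.eval 0 ≠ 0) :
    f = C (f.eval 0) * unitPoly f.roots.toFinset := by
  have hf : f ≠ 0 := fun e => h0 (by simp [e])
  have hS : (0 : ℝ) ∉ f.roots.toFinset := fun hm => h0 ((mem_rootsFinset hf).1 hm)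
  have e := eq_C_mul_nodal h hs
  rw [Lagrange.nodal] at e
  simp only [id] at e
  have hu := unitPoly_eq_C_mul_prod hS
  set c := ∏ κ ∈ f.roots.toFinset, (-κ⁻¹) with hc
  have hc0 : c ≠ 0 := Finset.prod_ne_zero_iff.2 fun κ hκ => by
    have hκ0 : κ ≠ 0 := fun e => hS (e ▸ hκ)
    simpa using hκ0
  have e2 : f = C (f.leadingCoeff * c⁻¹) * unitPoly f.roots.toFinset := by
    rw [hu, ← mul_assoc, ← C_mul, mul_assoc, inv_mul_cancel₀ hc0, mul_one]
    exact e
  have e3 : f.eval 0 = f.leadingCoeff * c⁻¹ := by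
    conv_lhs => rw [e2]
    simp [eval_zero_unitPoly]
  rw [e3]
  exact e2

/-! ### From parity to interlacing -/

theorem card_le_card_filter_lt_max'_add_one {K : Finset ℝ} (hne : K.Nonempty) :
    K.card ≤ (K.filter (· < K.max' hne)).card + 1 := by
  have : K ⊆ insert (K.max' hne) (K.filter (· < K.max' hne)) := fun t ht => by
    rw [Finset.mem_insert, Finset.mem_filter]
    rcases (K.le_max' t ht).eq_or_lt with h | h
    · exact Or.inl h
    · exact Or.inr ⟨ht, h⟩
  exact (Finset.card_le_card this).trans (Finset.card_insert_le _ _)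

/-- If the numbers of elements of `K` and of `R` below the points of `K` have different parity, then
there are at least as many elements of `R` as of `K`. -/
theorem card_lt_of_parity {K R : Finset ℝ}
    (h : ∀ κ ∈ K, (R.filter (· < κ)).card % 2 = ((K.filter (· < κ)).card + 1) % 2) :
    ∀ κ ∈ K, (K.filter (· < κ)).card + 1 ≤ (R.filter (· < κ)).card := by
  induction K using Finset.induction_on_max with
  | empty => simp
  | insert m K hm ih =>
    have hmK : m ∉ K := fun hmem => lt_irrefl _ (hm m hmem)
    have e1 : (insert m K).filter (· < m) = K := by
      rw [Finset.filter_insert, if_neg (lt_irrefl m), Finset.filter_true_of_mem hm]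
    have e2 : ∀ κ ∈ K, (insert m K).filter (· < κ) = K.filter (· < κ) := fun κ hκ => by
      rw [Finset.filter_insert, if_neg (hm κ hκ).not_gt]
    have ih' := ih fun κ hκ => by
      rw [h κ (Finset.mem_insert_of_mem hκ), e2 κ hκ]
    intro κ hκ
    rcases Finset.mem_insert.1 hκ with rfl | hκK
    · have hpar := h κ (Finset.mem_insert_self _ _)
      rw [e1] at hpar ⊢
      -- The bound at the previous point of `K` gives at least `K.card` elements of `R` below the
      -- new maximum. The parity condition then improves this by one.
      have : K.card ≤ (R.filter (· < κ)).card := by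
        rcases K.eq_empty_or_nonempty with rfl | hne
        · simp
        · have hmax := K.max'_mem hne
          have h1 := ih' _ hmax
          have h2 := card_le_card_filter_lt_max'_add_one hne
          have h3 : (R.filter (· < K.max' hne)).card ≤ (R.filter (· < κ)).card :=
            Finset.card_le_card (Finset.monotone_filter_right _ fun t _ ht => lt_trans ht (hm _ hmax))
          omega
      omega
    · rw [e2 κ hκK]
      exact ih' κ hκK

theorem card_le_of_parity {K R : Finset ℝ}
    (h : ∀ κ ∈ K, (R.filter (· < κ)).card % 2 = ((K.filter (· < κ)).card + 1) % 2) :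
    K.card ≤ R.card := by
  rcases K.eq_empty_or_nonempty with rfl | hne
  · simp
  · have h1 := card_lt_of_parity h _ (K.max'_mem hne)
    exact (card_le_card_filter_lt_max'_add_one hne).trans (h1.trans (Finset.card_filter_le _ _))

/-- Parity gives the lower bound of `card_lt_of_parity`, and the bound on `R.card` leaves no slack
at the largest point of `K`. Discarding the part of `R` above that point preserves the hypotheses
for the induction. -/
theorem card_eq_of_parity {K R : Finset ℝ}
    (h : ∀ κ ∈ K, (R.filter (· < κ)).card % 2 = ((K.filter (· < κ)).card + 1) % 2)
    (hc : R.card ≤ K.card + 1) :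
    ∀ κ ∈ K, (R.filter (· < κ)).card = (K.filter (· < κ)).card + 1 := by
  induction K using Finset.induction_on_max generalizing R with
  | empty => simp
  | insert m K hm ih =>
    have hmK : m ∉ K := fun hmem => lt_irrefl _ (hm m hmem)
    have e1 : (insert m K).filter (· < m) = K := by
      rw [Finset.filter_insert, if_neg (lt_irrefl m), Finset.filter_true_of_mem hm]
    have e2 : ∀ κ ∈ K, (insert m K).filter (· < κ) = K.filter (· < κ) := fun κ hκ => by
      rw [Finset.filter_insert, if_neg (hm κ hκ).not_gt]
    have hmR : (R.filter (· < m)).card = K.card + 1 := by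
      have h1 := card_lt_of_parity h m (Finset.mem_insert_self _ _)
      have h2 := h m (Finset.mem_insert_self _ _)
      rw [e1] at h1 h2
      have h3 := Finset.card_filter_le R (· < m)
      rw [Finset.card_insert_of_notMem hmK] at hc
      omega
    have e3 : ∀ κ ∈ K, (R.filter (· < m)).filter (· < κ) = R.filter (· < κ) := fun κ hκ => by
      rw [Finset.filter_filter]
      exact Finset.filter_congr fun t _ => ⟨And.right, fun ht => ⟨ht.trans (hm κ hκ), ht⟩⟩
    intro κ hκ
    rcases Finset.mem_insert.1 hκ with rfl | hκK
    · rw [e1, hmR]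
    · rw [e2 κ hκK, ← e3 κ hκK]
      refine ih (fun t ht => ?_) hmR.le κ hκK
      rw [e3 t ht, h t (Finset.mem_insert_of_mem ht), e2 t ht]

/-! ### Reflection and the description of the gaps -/

theorem toFinset_roots_comp_neg_X (f : ℝ[X]) :
    (f.comp (-X)).roots.toFinset = f.roots.toFinset.image (-·) := by
  rw [roots_comp_neg_X, Multiset.toFinset_map]

theorem card_filter_pos_image_neg (S : Finset ℝ) :
    ((S.image (-·)).filter (0 < ·)).card = (S.filter (· < 0)).card := by
  rw [Finset.filter_image, Finset.card_image_of_injective _ neg_injective]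
  simp

theorem negRoots_eq (Δ : ℝ[X]) : negRoots Δ = (posRoots (Δ.comp (-X))).map (-·) := by
  have : Δ.comp (-X) ^ 2 - 1 = (Δ ^ 2 - 1).comp (-X) := by simp
  rw [posRoots, this, roots_comp_neg_X, Multiset.filter_map, Multiset.map_map, negRoots]
  simp

theorem numNeg_eq (Δ : ℝ[X]) : numNeg Δ = numPos (Δ.comp (-X)) := by
  rw [numNeg, negRoots_eq, Multiset.card_map, numPos]

theorem lam_neg (Δ : ℝ[X]) {j : ℤ} (hj : 0 < j) : lam Δ (-j) = -lam (Δ.comp (-X)) j := by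
  have hsort : (negRoots Δ).sort (· ≥ ·) = ((posRoots (Δ.comp (-X))).sort (· ≤ ·)).map (-·) := by
    refine List.Perm.eq_of_pairwise (le := (· ≥ ·)) (fun a b _ _ h h' => le_antisymm h' h)
      (Multiset.pairwise_sort _ _) ?_ ?_
    · rw [List.pairwise_map]
      exact (Multiset.pairwise_sort _ _).imp fun h => neg_le_neg h
    · rw [← Multiset.coe_eq_coe, Multiset.sort_eq, ← Multiset.map_coe, Multiset.sort_eq, negRoots_eq]
  rw [lam, lam, if_neg (by omega), if_pos hj, hsort, neg_neg, ← neg_zero, List.getD_map, neg_zero]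

namespace IsHillPoly

variable {Δ : ℝ[X]}

theorem numPos_eq_card (h : IsHillPoly Δ) :
    numPos Δ = (Δ.roots.toFinset.filter (0 < ·)).card := h.numPos_eq

theorem numNeg_eq_card (h : IsHillPoly Δ) :
    numNeg Δ = (Δ.roots.toFinset.filter (· < 0)).card := by
  rw [numNeg_eq, h.comp_neg_X.numPos_eq_card, toFinset_roots_comp_neg_X, card_filter_pos_image_neg]

/-- The gaps, in terms of the number of roots of `Δ` between `0` and a point. -/
theorem coe_mem_gap_iff (h : IsHillPoly Δ) (i : GapIndex Δ) (x : ℝ) :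
    (x : EReal) ∈ gap Δ i ↔ 0 < x * i.1 ∧ (between Δ.roots.toFinset x).card = i.1.natAbs ∧
      1 ≤ |Δ.eval x| := by
  obtain ⟨i, hi0, hi1, hi2⟩ := i
  have main : ∀ {Δ : ℝ[X]}, IsHillPoly Δ → ∀ {j : ℕ}, 0 < j → j ≤ numPos Δ → ∀ x,
      ((lam Δ (2 * j) ≤ x ∧ (j < numPos Δ → x ≤ lam Δ (2 * j + 1))) ↔
        0 < x ∧ (between Δ.roots.toFinset x).card = j ∧ 1 ≤ |Δ.eval x|) := by
    intro Δ h j hj hj' x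
    rw [h.lam_spec hj hj' x]
    constructor
    · rintro ⟨h1, h2⟩
      have hx : 0 < x := by
        obtain ⟨ρ, hρ⟩ := Finset.card_pos.1 (h1 ▸ hj)
        rw [Finset.mem_filter, mem_posZeros h.ne_zero] at hρ
        exact hρ.1.2.trans hρ.2
      exact ⟨hx, by rw [between_of_pos _ hx]; exact h1, h2⟩
    · rintro ⟨hx, h1, h2⟩
      rw [between_of_pos _ hx] at h1
      exact ⟨h1, h2⟩
  rcases lt_or_gt_of_ne hi0 with hneg | hpos
  · have hx : 0 < x * (i : ℝ) ↔ 0 < -x := by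
      have : (i : ℝ) < 0 := by exact_mod_cast hneg
      exact ⟨fun h => by by_contra hc; nlinarith, fun h => by nlinarith⟩
    have hcast : ((i.natAbs : ℕ) : ℤ) = -i := by omega
    -- Gaps with negative index are the reflections of those of Δ(-X) with index |i|.
    have key := main h.comp_neg_X (j := i.natAbs) (by omega) (by rw [← numNeg_eq]; omega) (-x)
    rw [toFinset_roots_comp_neg_X, card_between_image_neg, ← hx] at key
    have e1 : lam Δ (2 * i) = -lam (Δ.comp (-X)) (2 * (i.natAbs : ℕ)) := by
      rw [← lam_neg Δ (by omega)]; congr 1; omega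
    have e2 : lam Δ (2 * i - 1) = -lam (Δ.comp (-X)) (2 * (i.natAbs : ℕ) + 1) := by
      rw [← lam_neg Δ (by omega)]; congr 1; omega
    have e3 : (Δ.comp (-X)).eval (-x) = Δ.eval x := by simp
    rw [e3] at key
    rw [← key, gap, ← numNeg_eq]
    dsimp only
    rw [e1, e2]
    split_ifs with h1
    · simp only [Set.mem_Icc, bot_le, true_and, EReal.coe_le_coe_iff]
      have : ¬ i.natAbs < numNeg Δ := by omega
      simp only [this, false_imp_iff, and_true]
      exact le_neg
    · simp only [Set.mem_Icc, EReal.coe_le_coe_iff]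
      have : i.natAbs < numNeg Δ := by omega
      simp only [this, true_imp_iff]
      rw [and_comm, le_neg, neg_le]
  · have hx : 0 < x * (i : ℝ) ↔ 0 < x := by
      have : (0 : ℝ) < i := by exact_mod_cast hpos
      exact mul_pos_iff_of_pos_right this
    have key := main h (j := i.natAbs) (by omega) (by omega) x
    have e1 : (2 * (i.natAbs : ℕ) : ℤ) = 2 * i := by omega
    rw [← hx, e1] at key
    rw [← key, gap]
    dsimp only
    rw [if_neg (by omega), if_neg (by omega)]
    split_ifs with h1
    · simp only [Set.mem_Icc, EReal.coe_le_coe_iff]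
      have : i.natAbs < numPos Δ := by omega
      simp only [this, true_imp_iff]
    · simp only [Set.mem_Icc, EReal.coe_le_coe_iff, le_top, and_true]
      have : ¬ i.natAbs < numPos Δ := by omega
      simp only [this, false_imp_iff, and_true]

theorem top_mem_gap_iff (i : GapIndex Δ) : ⊤ ∈ gap Δ i ↔ i.1 = numPos Δ := by
  obtain ⟨i, hi0, hi1, hi2⟩ := i
  rw [gap]
  dsimp only
  split_ifs with h1 h2 h3
  · simp only [Set.mem_Icc, top_le_iff, EReal.coe_ne_top, and_false, false_iff]; omega
  · simp only [Set.mem_Icc, top_le_iff, EReal.coe_ne_top, and_false, false_iff]; omega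
  · simp only [Set.mem_Icc, top_le_iff, EReal.coe_ne_top, and_false, false_iff]; omega
  · simp only [Set.mem_Icc, le_top, le_refl, and_true, true_iff]; omega

theorem bot_mem_gap_iff (i : GapIndex Δ) : ⊥ ∈ gap Δ i ↔ i.1 = -(numNeg Δ : ℤ) := by
  obtain ⟨i, hi0, hi1, hi2⟩ := i
  rw [gap]
  dsimp only
  split_ifs with h1 h2 h3
  · simp [h1]
  · simp [h1]
  · simp [h1]
  · simp [h1]

end IsHillPoly

/-! ### Interlacing on both sides of 0 -/

theorem parity_filter_pos {K R : Finset ℝ}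
    (h : ∀ κ ∈ K, (between R κ).card % 2 = ((between K κ).card + 1) % 2) :
    ∀ κ ∈ K.filter (0 < ·), ((R.filter (0 < ·)).filter (· < κ)).card % 2 =
      (((K.filter (0 < ·)).filter (· < κ)).card + 1) % 2 := by
  intro κ hκ
  rw [Finset.mem_filter] at hκ
  rw [← between_of_pos _ hκ.2, ← between_of_pos _ hκ.2]
  exact h κ hκ.1

theorem parity_image_neg {K R : Finset ℝ}
    (h : ∀ κ ∈ K, (between R κ).card % 2 = ((between K κ).card + 1) % 2) :
    ∀ κ ∈ K.image (-·), (between (R.image (-·)) κ).card % 2 =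
      ((between (K.image (-·)) κ).card + 1) % 2 := by
  intro κ hκ
  obtain ⟨t, ht, rfl⟩ := Finset.mem_image.1 hκ
  rw [card_between_image_neg, card_between_image_neg]
  exact h t ht

theorem card_filter_le_of_parity {K R : Finset ℝ}
    (h : ∀ κ ∈ K, (between R κ).card % 2 = ((between K κ).card + 1) % 2) :
    (K.filter (0 < ·)).card ≤ (R.filter (0 < ·)).card ∧
      (K.filter (· < 0)).card ≤ (R.filter (· < 0)).card := by
  refine ⟨card_le_of_parity (parity_filter_pos h), ?_⟩
  have := card_le_of_parity (parity_filter_pos (parity_image_neg h))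
  rwa [card_filter_pos_image_neg, card_filter_pos_image_neg] at this

theorem card_between_of_parity {K R : Finset ℝ} (h0 : (0 : ℝ) ∉ K)
    (h : ∀ κ ∈ K, (between R κ).card % 2 = ((between K κ).card + 1) % 2)
    (hpos : (R.filter (0 < ·)).card ≤ (K.filter (0 < ·)).card + 1)
    (hneg : (R.filter (· < 0)).card ≤ (K.filter (· < 0)).card + 1) :
    ∀ κ ∈ K, (between R κ).card = (between K κ).card + 1 := by
  have key : ∀ {K R : Finset ℝ},
      (∀ κ ∈ K, (between R κ).card % 2 = ((between K κ).card + 1) % 2) →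
      (R.filter (0 < ·)).card ≤ (K.filter (0 < ·)).card + 1 → ∀ κ ∈ K, 0 < κ →
      (between R κ).card = (between K κ).card + 1 := by
    intro K R h hpos κ hκ hκ0
    rw [between_of_pos _ hκ0, between_of_pos _ hκ0]
    exact card_eq_of_parity (parity_filter_pos h) hpos κ (Finset.mem_filter.2 ⟨hκ, hκ0⟩)
  intro κ hκ
  rcases lt_trichotomy κ 0 with h1 | h1 | h1
  · have := key (parity_image_neg h) (by
      rwa [card_filter_pos_image_neg, card_filter_pos_image_neg]) (-κ)
      (Finset.mem_image_of_mem _ hκ) (by linarith)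
    rwa [card_between_image_neg, card_between_image_neg] at this
  · exact absurd (h1 ▸ hκ) h0
  · exact key h hpos κ hκ h1

theorem exists_card_filter_lt_eq (K : Finset ℝ) {j : ℕ} (hj : j < K.card) :
    ∃ κ ∈ K, (K.filter (· < κ)).card = j := by
  have hmaps : ∀ κ ∈ K, (K.filter (· < κ)).card ∈ Finset.range K.card := fun κ hκ => by
    rw [Finset.mem_range]
    exact Finset.card_lt_card (Finset.filter_ssubset.2 ⟨κ, hκ, lt_irrefl κ⟩)
  have hinj : Set.InjOn (fun κ => (K.filter (· < κ)).card) K := by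
    have key : ∀ x ∈ K, ∀ y, x < y → (K.filter (· < x)).card < (K.filter (· < y)).card := by
      intro x hx y hxy
      refine Finset.card_lt_card (Finset.ssubset_iff_of_subset ?_ |>.2 ⟨x, ?_, ?_⟩)
      · exact Finset.monotone_filter_right _ fun t _ ht => lt_trans ht hxy
      · simp [hx, hxy]
      · simp
    intro x hx y hy he
    rcases lt_trichotomy x y with h1 | h1 | h1
    · exact absurd he (key x hx y h1).ne
    · exact h1
    · exact absurd he (key y hy x h1).ne'
  obtain ⟨κ, hκ, he⟩ := Finset.surj_on_of_inj_on_of_card_le (fun κ _ => (K.filter (· < κ)).card)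
    hmaps (fun x y hx hy he => hinj hx hy he) (by simp) j (Finset.mem_range.2 hj)
  exact ⟨κ, hκ, he.symm⟩

theorem exists_card_between_eq (K : Finset ℝ) {i : ℤ} (hi : i ≠ 0)
    (hpos : i ≤ (K.filter (0 < ·)).card) (hneg : -i ≤ (K.filter (· < 0)).card) :
    ∃ κ ∈ K, 0 < κ * i ∧ (between K κ).card + 1 = i.natAbs := by
  have key : ∀ (K : Finset ℝ) {j : ℕ}, 0 < j → j ≤ (K.filter (0 < ·)).card →
      ∃ κ ∈ K, 0 < κ ∧ (between K κ).card + 1 = j := by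
    intro K j hj hj'
    obtain ⟨κ, hκ, he⟩ := exists_card_filter_lt_eq (K.filter (0 < ·)) (j := j - 1) (by omega)
    rw [Finset.mem_filter] at hκ
    exact ⟨κ, hκ.1, hκ.2, by rw [between_of_pos _ hκ.2]; omega⟩
  rcases lt_or_gt_of_ne hi with h1 | h1
  · obtain ⟨κ, hκ, hκ0, he⟩ := key (K.image (-·)) (j := i.natAbs) (by omega)
      (by rw [card_filter_pos_image_neg]; omega)
    obtain ⟨t, ht, rfl⟩ := Finset.mem_image.1 hκ
    rw [card_between_image_neg] at he
    have : (i : ℝ) < 0 := by exact_mod_cast h1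
    exact ⟨t, ht, by nlinarith, he⟩
  · obtain ⟨κ, hκ, hκ0, he⟩ := key K (j := i.natAbs) (by omega) (by omega)
    have : (0 : ℝ) < i := by exact_mod_cast h1
    exact ⟨κ, hκ, by positivity, he⟩

theorem card_filter_pos_add_card_filter_neg {S : Finset ℝ} (h0 : (0 : ℝ) ∉ S) :
    (S.filter (0 < ·)).card + (S.filter (· < 0)).card = S.card := by
  rw [← Finset.card_filter_add_card_filter_not (s := S) (0 < ·)]
  congr 2
  refine Finset.filter_congr fun κ hκ => ?_
  have hκ0 : κ ≠ 0 := fun e => h0 (e ▸ hκ)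
  rw [not_lt]
  exact ⟨le_of_lt, fun h => lt_of_le_of_ne h hκ0⟩

namespace IsHillPoly

variable {Δ : ℝ[X]}

theorem zero_notMem (h : IsHillPoly Δ) : (0 : ℝ) ∉ Δ.roots.toFinset := fun hm => by
  have := (mem_rootsFinset h.ne_zero).1 hm
  linarith [h.one_lt]

theorem eq_unitPoly (h : IsHillPoly Δ) : Δ = C (Δ.eval 0) * unitPoly Δ.roots.toFinset :=
  eq_C_mul_unitPoly h.im_eq_zero h.simple (by linarith [h.one_lt])

theorem sign_eval (h : IsHillPoly Δ) {x : ℝ} (hx : Δ.eval x ≠ 0) :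
    0 < (-1) ^ (between Δ.roots.toFinset x).card * Δ.eval x := by
  have h1 := sign_eval_unitPoly h.zero_notMem (x := x)
    (fun hm => hx ((mem_rootsFinset h.ne_zero).1 hm))
  have h2 : Δ.eval x = Δ.eval 0 * (unitPoly Δ.roots.toFinset).eval x := by
    conv_lhs => rw [h.eq_unitPoly]
    simp
  rw [h2, mul_left_comm]
  exact mul_pos (by linarith [h.one_lt]) h1

theorem sign_leadingCoeff (h : IsHillPoly Δ) :
    0 < (-1) ^ (Δ.roots.toFinset.filter (0 < ·)).card * Δ.leadingCoeff := by
  have h1 := sign_leadingCoeff_unitPoly h.zero_notMem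
  have h2 : Δ.leadingCoeff = Δ.eval 0 * (unitPoly Δ.roots.toFinset).leadingCoeff := by
    conv_lhs => rw [h.eq_unitPoly]
    simp
  rw [h2, mul_left_comm]
  exact mul_pos (by linarith [h.one_lt]) h1

theorem card_roots (h : IsHillPoly Δ) : Δ.roots.toFinset.card = Δ.natDegree :=
  card_roots_eq_natDegree h.im_eq_zero h.simple

/-- At a root `κ` of `unitPoly K` the sign of `κ g'(κ) Δ(κ)` is given by the parity of the number of
roots of `g` and of `Δ` between `0` and `κ`. -/
theorem sign_iff_parity (h : IsHillPoly Δ) {K : Finset ℝ} (h0 : (0 : ℝ) ∉ K) {κ : ℝ} (hκ : κ ∈ K)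
    (hΔ : Δ.eval κ ≠ 0) :
    0 < κ * (unitPoly K).derivative.eval κ * Δ.eval κ ↔
      (between Δ.roots.toFinset κ).card % 2 = ((between K κ).card + 1) % 2 := by
  have h1 := h.sign_eval hΔ
  have h2 := sign_derivative_unitPoly h0 hκ
  rcases Nat.even_or_odd (between Δ.roots.toFinset κ).card with e1 | e1 <;>
  rcases Nat.even_or_odd (between K κ).card with e2 | e2 <;>
  rw [e1.neg_one_pow] at h1 <;> rw [e2.neg_one_pow] at h2 <;>
  simp only [Nat.even_iff, Nat.odd_iff] at e1 e2
  · exact ⟨fun hp => by nlinarith, fun hp => by omega⟩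
  · exact ⟨fun hp => by omega, fun hp => by nlinarith⟩
  · exact ⟨fun hp => by omega, fun hp => by nlinarith⟩
  · exact ⟨fun hp => by nlinarith, fun hp => by omega⟩

/-- By parity neither side of 0 has fewer zeros of Δ than elements of `K`, and the total excess is
at most two. If it is two, the opposite signs of the leading coefficients make the excess on the
positive side odd, so it splits as 1 + 1. -/
theorem card_filter_le_add_one (h : IsHillPoly Δ) {K : Finset ℝ} (h0 : (0 : ℝ) ∉ K)
    (hpar : ∀ κ ∈ K, (between Δ.roots.toFinset κ).card % 2 = ((between K κ).card + 1) % 2)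
    (hdeg : Δ.natDegree ≤ K.card + 2)
    (hlead : Δ.natDegree = K.card + 2 → Δ.leadingCoeff * (unitPoly K).leadingCoeff < 0) :
    (Δ.roots.toFinset.filter (0 < ·)).card ≤ (K.filter (0 < ·)).card + 1 ∧
      (Δ.roots.toFinset.filter (· < 0)).card ≤ (K.filter (· < 0)).card + 1 := by
  have h1 := card_filter_le_of_parity hpar
  have h2 := card_filter_pos_add_card_filter_neg h.zero_notMem
  have h3 := card_filter_pos_add_card_filter_neg h0
  rw [h.card_roots] at h2
  by_cases hN : Δ.natDegree = K.card + 2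
  · have h4 := hlead hN
    have h5 := h.sign_leadingCoeff
    have h6 := sign_leadingCoeff_unitPoly h0
    have hodd : (Δ.roots.toFinset.filter (0 < ·)).card % 2 ≠ (K.filter (0 < ·)).card % 2 := by
      intro he
      rcases Nat.even_or_odd (Δ.roots.toFinset.filter (0 < ·)).card with e1 | e1 <;>
      rcases Nat.even_or_odd (K.filter (0 < ·)).card with e2 | e2 <;>
      rw [e1.neg_one_pow] at h5 <;> rw [e2.neg_one_pow] at h6 <;>
      simp only [Nat.even_iff, Nat.odd_iff] at e1 e2 <;> first | omega | nlinarith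
    omega
  · omega

end IsHillPoly

/-! ### Trace and Wronskian at the Dirichlet eigenvalues -/

theorem IsNormalizedPair.eq_unitPoly {g r : ℝ[X]} (h : IsNormalizedPair g r) :
    g = unitPoly g.roots.toFinset := by
  have := eq_C_mul_unitPoly h.nev.im_eq_zero (fun x hx h0 => by simpa [h0] using h.nev.pos x hx)
    (by rw [h.eval_zero]; exact one_ne_zero)
  rwa [h.eval_zero, C_1, one_mul] at this

theorem IsNormalizedPair.mem_roots {g r : ℝ[X]} (h : IsNormalizedPair g r) {x : ℝ} :
    x ∈ g.roots.toFinset ↔ g.eval x = 0 := mem_rootsFinset h.ne_zero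

theorem IsNormalizedPair.zero_notMem {g r : ℝ[X]} (h : IsNormalizedPair g r) :
    (0 : ℝ) ∉ g.roots.toFinset := fun hm => by
  simpa [h.eval_zero] using h.mem_roots.1 hm

section

variable {a b : ℝ} {L : List (ℝ × ℝ × ℝ)} {w v : ℝ} {Δ : ℝ[X]}

/-- The value of the derivative of the Dirichlet solution at the right end point, at an eigenvalue. -/
def dirichletValue (a : ℝ) (L : List (ℝ × ℝ × ℝ)) (b x : ℝ) : ℝ :=
  x * (chainNorm a L b).2.eval x / sinhSol a b

theorem eval_chainP_zero_one (hV : ValidChain a L b) (x : ℝ) :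
    (chainP a (0, 1) L b).1.eval x = sinhSol a b * (chainNorm a L b).1.eval x ∧
    (chainP a (0, 1) L b).2.eval x =
      Real.cosh ((b - a) / 2) * (chainNorm a L b).1.eval x + dirichletValue a L b x := by
  rw [chainP_zero_one hV]
  simp only [ofNormalized, dirichletValue, eval_mul, eval_C, eval_add, eval_X, true_and]
  ring

theorem chainP_one_zero_mul (hV : ValidChain a L b) {κ : ℝ} (hκ : (chainNorm a L b).1.eval κ = 0) :
    (chainP a (1, 0) L b).1.eval κ * dirichletValue a L b κ = 1 := by
  obtain ⟨h1, h2⟩ := eval_chainP_zero_one hV κ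
  have hdet := congrArg (eval κ) (chainP_det a (1, 0) (0, 1) L b)
  simp only [eval_sub, eval_mul, h1, h2, hκ] at hdet
  simpa using hdet

/-- At an eigenvalue the term carrying the mass at a vanishes with s, which leaves c + s' = 2Δ,
while the Wronskian is c s' = 1. -/
theorem chainTrace_eval_root (hV : ValidChain a L b) (ht : chainTrace a L b w v = C 2 * Δ) {κ : ℝ}
    (hκ : (chainNorm a L b).1.eval κ = 0) :
    (2 * Δ.eval κ - dirichletValue a L b κ) * dirichletValue a L b κ = 1 := by
  obtain ⟨h1, h2⟩ := eval_chainP_zero_one hV κ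
  have hdet := chainP_one_zero_mul hV hκ
  have htr := congrArg (eval κ) ht
  simp only [chainTrace, eval_sub, eval_add, eval_mul, h1, h2, hκ, eval_C] at htr
  have : 2 * Δ.eval κ - dirichletValue a L b κ = (chainP a (1, 0) L b).1.eval κ := by
    linarith
  rw [this, hdet]

/-- The Nevanlinna condition g' r > 0 at κ, multiplied by κ² and a positive constant. -/
theorem dirichletValue_sign (hV : ValidChain a L b) {κ : ℝ}
    (hκ : (chainNorm a L b).1.eval κ = 0) :
    0 < κ * (chainNorm a L b).1.derivative.eval κ * dirichletValue a L b κ := by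
  have hN := isNormalizedPair_chainNorm hV
  have hpos := hN.nev.pos κ hκ
  have hS := sinhSol_pos hV.lt
  have hκ0 : κ ≠ 0 := fun e => by
    rw [e, hN.eval_zero] at hκ
    exact one_ne_zero hκ
  have : κ * (chainNorm a L b).1.derivative.eval κ * dirichletValue a L b κ = κ ^ 2 *
      ((chainNorm a L b).1.derivative.eval κ * (chainNorm a L b).2.eval κ) / sinhSol a b := by
    rw [dirichletValue]; ring
  rw [this]
  positivity

/-- Completing the square; the middle conclusion is 2 d s = 1 + s². -/
theorem one_le_abs_of_mul_eq_one {d s : ℝ} (h : (2 * d - s) * s = 1) :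
    1 ≤ |d| ∧ 0 < d * s ∧ (d - s) ^ 2 = d ^ 2 - 1 := by
  have h1 : (d - s) ^ 2 = d ^ 2 - 1 := by linarith
  refine ⟨?_, by nlinarith [sq_nonneg s], h1⟩
  rw [← one_le_sq_iff_one_le_abs]
  nlinarith [sq_nonneg (d - s)]

/-- Only the term -v X² s of the trace can reach degree deg g + 2, and v ≥ 0 determines its sign. -/
theorem natDegree_chainTrace_le (hV : ValidChain a L b) (hv : 0 ≤ v)
    (ht : chainTrace a L b w v = C 2 * Δ) :
    Δ.natDegree ≤ (chainNorm a L b).1.natDegree + 2 ∧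
      (Δ.natDegree = (chainNorm a L b).1.natDegree + 2 →
        Δ.leadingCoeff * (chainNorm a L b).1.leadingCoeff < 0) := by
  have hN := isNormalizedPair_chainNorm hV
  have hS := sinhSol_pos hV.lt
  set g := (chainNorm a L b).1 with hg
  have hc := (chainP_natDegree_le (F := (1, 0)) (by simp) (by simp) hV).1
  have hs := (chainP_natDegree_le (F := (0, 1)) (by simp) (by simp) hV).2
  rw [← hg] at hc hs
  have h1 : (chainP a (0, 1) L b).1 = C (sinhSol a b) * g := by rw [chainP_zero_one hV]; rfl
  set A := (chainP a (1, 0) L b).1 + (chainP a (0, 1) L b).2 with hA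
  have hAd : A.natDegree ≤ g.natDegree := (natDegree_add_le _ _).trans (max_le hc hs)
  have e : C 2 * Δ = A - (C w * X + C v * X ^ 2) * (C (sinhSol a b) * g) := by
    rw [← ht, chainTrace, h1]
  have hq : (C w * X + C v * X ^ 2 : ℝ[X]).natDegree ≤ 2 := by compute_degree
  have hmul : ((C w * X + C v * X ^ 2) * (C (sinhSol a b) * g)).natDegree ≤ g.natDegree + 2 := by
    refine natDegree_mul_le.trans ?_
    have := natDegree_C_mul_le (sinhSol a b) g
    omega
  have hle : Δ.natDegree ≤ g.natDegree + 2 := by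
    have h2 : (C 2 * Δ).natDegree = Δ.natDegree := natDegree_C_mul two_ne_zero
    rw [← h2, e]
    exact (natDegree_sub_le _ _).trans (max_le (by omega) hmul)
  refine ⟨hle, fun heq => ?_⟩
  have hcoeff : 2 * Δ.leadingCoeff = -(v * (sinhSol a b * g.leadingCoeff)) := by
    have h2 := congrArg (fun P : ℝ[X] => P.coeff (g.natDegree + 2)) e
    simp only [coeff_C_mul, coeff_sub] at h2
    rw [coeff_eq_zero_of_natDegree_lt (by omega : A.natDegree < g.natDegree + 2), ← heq,
      coeff_natDegree, heq, add_comm g.natDegree 2,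
      coeff_mul_add_eq_of_natDegree_le hq (natDegree_C_mul_le _ _)] at h2
    simpa [coeff_X, coeff_C_mul] using h2
  have hl : Δ.leadingCoeff ≠ 0 := by
    rw [Ne, leadingCoeff_eq_zero]
    rintro rfl
    simp at heq
  have hgl : g.leadingCoeff ≠ 0 := leadingCoeff_ne_zero.2 hN.ne_zero
  have hv0 : v ≠ 0 := fun h => hl (by rw [h] at hcoeff; linarith)
  have hv' : 0 < v := lt_of_le_of_ne hv hv0.symm
  have : Δ.leadingCoeff * g.leadingCoeff = -(v * sinhSol a b * g.leadingCoeff ^ 2) / 2 := by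
    linear_combination g.leadingCoeff / 2 * hcoeff
  rw [this]
  have : 0 < v * sinhSol a b * g.leadingCoeff ^ 2 := by positivity
  linarith

end

section

variable {ℓ a : ℝ} {Δ : ℝ[X]} {p : (ℝ → ℝ) × Measure ℝ} {L : List (ℝ × ℝ × ℝ)}

theorem MemP.ofReal_mem_dirichletSpectrum_iff (hp : MemP ℓ p)
    (hL : MassList (omegaMass p.1) (upsilonMass p) a L (a + ℓ)) (x : ℝ) :
    (x : ℂ) ∈ dirichletSpectrum ℓ a p ↔ (chainNorm a L (a + ℓ)).1.eval x = 0 := by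
  have hV := hL.validChain (upsilonMass_nonneg p)
  rw [hp.mem_dirichletSpectrum_iff hL, aeval_ofReal, Complex.ofReal_eq_zero,
    (eval_chainP_zero_one hV x).1, mul_eq_zero, or_iff_right (sinhSol_pos hV.lt).ne']

theorem MemP.ivp_re_eq (hp : MemP ℓ p)
    (hL : MassList (omegaMass p.1) (upsilonMass p) a L (a + ℓ)) {x : ℝ}
    (hx : (chainNorm a L (a + ℓ)).1.eval x = 0) :
    (ivp p a (x : ℂ) 0 1 (a + ℓ)).2.re = dirichletValue a L (a + ℓ) x := by
  have hV := hL.validChain (upsilonMass_nonneg p)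
  rw [hp.ivp_zero_one hL, aevalPair]
  dsimp only
  rw [aeval_ofReal, Complex.ofReal_re, (eval_chainP_zero_one hV x).2, hx, mul_zero, zero_add]

theorem mem_iso_iff (hp : MemP ℓ p) (hL : MassList (omegaMass p.1) (upsilonMass p) a L (a + ℓ)) :
    p ∈ Iso ℓ a Δ ↔
      chainTrace a L (a + ℓ) (omegaMass p.1 a) (upsilonMass p a) = C 2 * Δ := by
  constructor
  · rintro ⟨-, h⟩
    refine polynomial_eq_of_aeval fun z => ?_
    have := h z
    rw [hp.discriminant_eq hL] at this
    simp only [map_mul, aeval_C, Complex.coe_algebraMap, Complex.ofReal_ofNat, ← this]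
    ring
  · intro h
    refine ⟨hp, fun z => ?_⟩
    rw [hp.discriminant_eq hL, h]
    simp

theorem dirichletDivisors_of_unique {i : GapIndex Δ} {κ : ℝ} (hκ : (κ : EReal) ∈ gap Δ i)
    (hs : (κ : ℂ) ∈ dirichletSpectrum ℓ a p)
    (hu : ∀ x : ℝ, (x : EReal) ∈ gap Δ i → (x : ℂ) ∈ dirichletSpectrum ℓ a p → x = κ) :
    dirichletDivisors ℓ a Δ p i =
      ((κ : EReal), Δ.eval κ - (ivp p a (κ : ℂ) 0 1 (a + ℓ)).2.re) := by
  have h : ∃ κ : ℝ, (κ : EReal) ∈ gap Δ i ∧ (κ : ℂ) ∈ dirichletSpectrum ℓ a p := ⟨κ, hκ, hs⟩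
  have hc : h.choose = κ := hu _ h.choose_spec.1 h.choose_spec.2
  rw [dirichletDivisors, dif_pos h, hc]

theorem dirichletDivisors_of_not_exists {i : GapIndex Δ}
    (h : ¬ ∃ κ : ℝ, (κ : EReal) ∈ gap Δ i ∧ (κ : ℂ) ∈ dirichletSpectrum ℓ a p) :
    dirichletDivisors ℓ a Δ p i = (if i.1 < 0 then ⊥ else ⊤, 0) := by
  rw [dirichletDivisors, dif_neg h]

end

/-! ### Dirichlet divisors of isospectral pairs lie on the torus -/

/-- The description of a pair in the isospectral set by means of its chain of point masses. -/
structure IsoData (ℓ a : ℝ) (Δ : ℝ[X]) (p : (ℝ → ℝ) × Measure ℝ) (L : List (ℝ × ℝ × ℝ)) :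
    Prop where
  memP : MemP ℓ p
  massList : MassList (omegaMass p.1) (upsilonMass p) a L (a + ℓ)
  trace : chainTrace a L (a + ℓ) (omegaMass p.1 a) (upsilonMass p a) = C 2 * Δ

theorem exists_isoData {ℓ a : ℝ} (hℓ : 0 < ℓ) {Δ : ℝ[X]} {p : (ℝ → ℝ) × Measure ℝ}
    (hp : p ∈ Iso ℓ a Δ) : ∃ L, IsoData ℓ a Δ p L := by
  obtain ⟨L, hL⟩ := hp.1.exists_massList (a := a) (b := a + ℓ) (by linarith)
  exact ⟨L, hp.1, hL, (mem_iso_iff hp.1 hL).1 hp⟩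

namespace IsoData

variable {ℓ a : ℝ} {Δ : ℝ[X]} {p : (ℝ → ℝ) × Measure ℝ} {L : List (ℝ × ℝ × ℝ)}

theorem validChain (h : IsoData ℓ a Δ p L) : ValidChain a L (a + ℓ) :=
  h.massList.validChain (upsilonMass_nonneg p)

theorem isNormalizedPair (h : IsoData ℓ a Δ p L) :
    IsNormalizedPair (chainNorm a L (a + ℓ)).1 (chainNorm a L (a + ℓ)).2 :=
  isNormalizedPair_chainNorm h.validChain

theorem root_spec (h : IsoData ℓ a Δ p L) {κ : ℝ} (hκ : (chainNorm a L (a + ℓ)).1.eval κ = 0) :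
    1 ≤ |Δ.eval κ| ∧
      0 < κ * (chainNorm a L (a + ℓ)).1.derivative.eval κ * Δ.eval κ ∧
      (Δ.eval κ - dirichletValue a L (a + ℓ) κ) ^ 2 = Δ.eval κ ^ 2 - 1 := by
  obtain ⟨h1, h2, h3⟩ := one_le_abs_of_mul_eq_one (chainTrace_eval_root h.validChain h.trace hκ)
  refine ⟨h1, ?_, h3⟩
  have h4 := dirichletValue_sign h.validChain hκ
  have h5 := mul_pos h4 h2
  have : κ * (chainNorm a L (a + ℓ)).1.derivative.eval κ * dirichletValue a L (a + ℓ) κ *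
      (Δ.eval κ * dirichletValue a L (a + ℓ) κ) =
      (κ * (chainNorm a L (a + ℓ)).1.derivative.eval κ * Δ.eval κ) *
        dirichletValue a L (a + ℓ) κ ^ 2 := by ring
  rw [this] at h5
  exact pos_of_mul_pos_left h5 (sq_nonneg _)

/-- The set of Dirichlet eigenvalues. -/
def eigenvalues (a ℓ : ℝ) (L : List (ℝ × ℝ × ℝ)) : Finset ℝ :=
  (chainNorm a L (a + ℓ)).1.roots.toFinset

theorem mem_eigenvalues (h : IsoData ℓ a Δ p L) {x : ℝ} :
    x ∈ eigenvalues a ℓ L ↔ (chainNorm a L (a + ℓ)).1.eval x = 0 := h.isNormalizedPair.mem_roots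

theorem zero_notMem (h : IsoData ℓ a Δ p L) : (0 : ℝ) ∉ eigenvalues a ℓ L :=
  h.isNormalizedPair.zero_notMem

theorem eq_unitPoly (h : IsoData ℓ a Δ p L) :
    (chainNorm a L (a + ℓ)).1 = unitPoly (eigenvalues a ℓ L) := h.isNormalizedPair.eq_unitPoly

theorem mem_spectrum_iff (h : IsoData ℓ a Δ p L) {x : ℝ} :
    (x : ℂ) ∈ dirichletSpectrum ℓ a p ↔ x ∈ eigenvalues a ℓ L := by
  rw [h.mem_eigenvalues, h.memP.ofReal_mem_dirichletSpectrum_iff h.massList]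

theorem parity (h : IsoData ℓ a Δ p L) (hΔ : IsHillPoly Δ) : ∀ κ ∈ eigenvalues a ℓ L,
    (between Δ.roots.toFinset κ).card % 2 = ((between (eigenvalues a ℓ L) κ).card + 1) % 2 := by
  intro κ hκ
  obtain ⟨h1, h2, -⟩ := h.root_spec (h.mem_eigenvalues.1 hκ)
  rw [h.eq_unitPoly] at h2
  refine (hΔ.sign_iff_parity h.zero_notMem hκ ?_).1 h2
  intro h0
  rw [h0] at h1
  norm_num at h1

theorem card_filter_le (h : IsoData ℓ a Δ p L) (hΔ : IsHillPoly Δ) :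
    (Δ.roots.toFinset.filter (0 < ·)).card ≤ ((eigenvalues a ℓ L).filter (0 < ·)).card + 1 ∧
      (Δ.roots.toFinset.filter (· < 0)).card ≤ ((eigenvalues a ℓ L).filter (· < 0)).card + 1 := by
  have := natDegree_chainTrace_le h.validChain (upsilonMass_nonneg p a) h.trace
  rw [h.eq_unitPoly, natDegree_unitPoly h.zero_notMem] at this
  exact hΔ.card_filter_le_add_one h.zero_notMem (h.parity hΔ) this.1 this.2

theorem card_between (h : IsoData ℓ a Δ p L) (hΔ : IsHillPoly Δ) : ∀ κ ∈ eigenvalues a ℓ L,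
    (between Δ.roots.toFinset κ).card = (between (eigenvalues a ℓ L) κ).card + 1 :=
  card_between_of_parity h.zero_notMem (h.parity hΔ) (h.card_filter_le hΔ).1 (h.card_filter_le hΔ).2

/-- A gap contains at most one Dirichlet eigenvalue. -/
theorem eq_of_mem_gap (h : IsoData ℓ a Δ p L) (hΔ : IsHillPoly Δ) {i : GapIndex Δ} {x y : ℝ}
    (hx : (x : EReal) ∈ gap Δ i) (hy : (y : EReal) ∈ gap Δ i) (hxK : x ∈ eigenvalues a ℓ L)
    (hyK : y ∈ eigenvalues a ℓ L) : x = y := by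
  rw [hΔ.coe_mem_gap_iff] at hx hy
  refine eq_of_card_between_eq hxK hyK ?_ ?_
  · have := mul_pos hx.1 hy.1
    have e : x * i.1 * (y * i.1) = x * y * (i.1 : ℝ) ^ 2 := by ring
    rw [e] at this
    exact pos_of_mul_pos_left this (sq_nonneg _)
  · have h1 := h.card_between hΔ x hxK
    have h2 := h.card_between hΔ y hyK
    have h3 := hx.2.1
    have h4 := hy.2.1
    omega

/-- Every Dirichlet eigenvalue lies in a gap. -/
theorem exists_mem_gap (h : IsoData ℓ a Δ p L) (hΔ : IsHillPoly Δ) {κ : ℝ}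
    (hκ : κ ∈ eigenvalues a ℓ L) : ∃ i : GapIndex Δ, (κ : EReal) ∈ gap Δ i := by
  have h1 := h.card_between hΔ κ hκ
  have h2 := (h.root_spec (h.mem_eigenvalues.1 hκ)).1
  have hκ0 : κ ≠ 0 := fun e => h.zero_notMem (e ▸ hκ)
  rcases lt_or_gt_of_ne hκ0 with hneg | hpos
  · have hle : (between Δ.roots.toFinset κ).card ≤ numNeg Δ := by
      rw [hΔ.numNeg_eq_card]
      refine Finset.card_le_card fun t ht => ?_
      simp only [between, Finset.mem_filter] at ht ⊢
      refine ⟨ht.1, ?_⟩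
      rcases ht.2 with h | h <;> linarith
    refine ⟨⟨-((between Δ.roots.toFinset κ).card : ℤ), by omega, by omega, by omega⟩, ?_⟩
    rw [hΔ.coe_mem_gap_iff]
    refine ⟨?_, by simp, h2⟩
    push_cast
    have : (0 : ℝ) < (between Δ.roots.toFinset κ).card := by rw [h1]; positivity
    nlinarith
  · have hle : (between Δ.roots.toFinset κ).card ≤ numPos Δ := by
      rw [hΔ.numPos_eq_card]
      refine Finset.card_le_card fun t ht => ?_
      simp only [between, Finset.mem_filter] at ht ⊢
      refine ⟨ht.1, ?_⟩
      rcases ht.2 with h | h <;> linarith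
    refine ⟨⟨((between Δ.roots.toFinset κ).card : ℤ), by omega, by omega, by omega⟩, ?_⟩
    rw [hΔ.coe_mem_gap_iff]
    refine ⟨?_, by simp, h2⟩
    push_cast
    have : (0 : ℝ) < (between Δ.roots.toFinset κ).card := by rw [h1]; positivity
    positivity

/-- Every bounded gap contains a Dirichlet eigenvalue. -/
theorem exists_eigenvalue (h : IsoData ℓ a Δ p L) (hΔ : IsHillPoly Δ) (i : GapIndex Δ)
    (hi : i.1 ≠ numPos Δ) (hi' : i.1 ≠ -(numNeg Δ : ℤ)) :
    ∃ κ ∈ eigenvalues a ℓ L, (κ : EReal) ∈ gap Δ i := by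
  have hc := h.card_filter_le hΔ
  rw [← hΔ.numPos_eq_card, ← hΔ.numNeg_eq_card] at hc
  obtain ⟨h0, h1, h2⟩ := i.2
  -- Each side has at most one zero of Δ more than eigenvalues, so a non-extreme index i still has
  -- an eigenvalue with |i| - 1 others between it and 0.
  obtain ⟨κ, hκ, hs, he⟩ := exists_card_between_eq (eigenvalues a ℓ L) h0 (by omega) (by omega)
  refine ⟨κ, hκ, (hΔ.coe_mem_gap_iff i κ).2 ⟨hs, ?_, (h.root_spec (h.mem_eigenvalues.1 hκ)).1⟩⟩
  rw [h.card_between hΔ κ hκ, he]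

theorem dirichletDivisors_eq (h : IsoData ℓ a Δ p L) (hΔ : IsHillPoly Δ) {i : GapIndex Δ} {κ : ℝ}
    (hκ : κ ∈ eigenvalues a ℓ L) (hi : (κ : EReal) ∈ gap Δ i) :
    dirichletDivisors ℓ a Δ p i = ((κ : EReal), Δ.eval κ - dirichletValue a L (a + ℓ) κ) := by
  rw [dirichletDivisors_of_unique hi (h.mem_spectrum_iff.2 hκ)
    fun x hx hx' => h.eq_of_mem_gap hΔ hx hi (h.mem_spectrum_iff.1 hx') hκ,
    h.memP.ivp_re_eq h.massList (h.mem_eigenvalues.1 hκ)]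

theorem dirichletDivisors_eq_of_forall_notMem (h : IsoData ℓ a Δ p L) {i : GapIndex Δ}
    (hi : ∀ κ ∈ eigenvalues a ℓ L, (κ : EReal) ∉ gap Δ i) :
    dirichletDivisors ℓ a Δ p i = (if i.1 < 0 then ⊥ else ⊤, 0) :=
  dirichletDivisors_of_not_exists fun ⟨κ, h1, h2⟩ => hi κ (h.mem_spectrum_iff.1 h2) h1

theorem dirichletDivisors_mem_torus (h : IsoData ℓ a Δ p L) (hΔ : IsHillPoly Δ) :
    dirichletDivisors ℓ a Δ p ∈ torus Δ := by
  intro i _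
  by_cases hi : ∃ κ ∈ eigenvalues a ℓ L, (κ : EReal) ∈ gap Δ i
  · obtain ⟨κ, hκ, hκi⟩ := hi
    rw [h.dirichletDivisors_eq hΔ hκ hκi]
    refine ⟨hκi, ?_⟩
    simpa [evalExt] using (h.root_spec (h.mem_eigenvalues.1 hκ)).2.2
  · have hi' := hi
    push Not at hi'
    rw [h.dirichletDivisors_eq_of_forall_notMem hi']
    obtain ⟨h0, h1, h2⟩ := i.2
    refine ⟨?_, ?_⟩
    · by_cases hp : i.1 = numPos Δ
      · rw [if_neg (by omega)]
        exact (IsHillPoly.top_mem_gap_iff i).2 hp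
      · by_cases hn : i.1 = -(numNeg Δ : ℤ)
        · rw [if_pos (by omega)]
          exact (IsHillPoly.bot_mem_gap_iff i).2 hn
        · exact absurd (h.exists_eigenvalue hΔ i hp hn) hi
    · split_ifs <;> simp [evalExt]

end IsoData

/-! ### Injectivity -/

theorem IsoData.dirichletValue_eq {ℓ a : ℝ} {Δ : ℝ[X]} {p p' : (ℝ → ℝ) × Measure ℝ}
    {L L' : List (ℝ × ℝ × ℝ)} (hΔ : IsHillPoly Δ) (h : IsoData ℓ a Δ p L) (h' : IsoData ℓ a Δ p' L')
    (he : dirichletDivisors ℓ a Δ p = dirichletDivisors ℓ a Δ p') {κ : ℝ}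
    (hκ : κ ∈ eigenvalues a ℓ L) : κ ∈ eigenvalues a ℓ L' ∧
      dirichletValue a L (a + ℓ) κ = dirichletValue a L' (a + ℓ) κ := by
  obtain ⟨i, hi⟩ := h.exists_mem_gap hΔ hκ
  have h1 := congrFun he i
  rw [h.dirichletDivisors_eq hΔ hκ hi] at h1
  by_cases hex : ∃ t ∈ eigenvalues a ℓ L', (t : EReal) ∈ gap Δ i
  · obtain ⟨t, ht, hti⟩ := hex
    rw [h'.dirichletDivisors_eq hΔ ht hti, Prod.mk.injEq, EReal.coe_eq_coe_iff] at h1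
    obtain ⟨rfl, h2⟩ := h1
    exact ⟨ht, by linarith⟩
  · push Not at hex
    rw [h'.dirichletDivisors_eq_of_forall_notMem hex, Prod.mk.injEq] at h1
    have h2 := h1.1
    split_ifs at h2
    · exact absurd h2 (EReal.coe_ne_bot κ)
    · exact absurd h2 (EReal.coe_ne_top κ)

/-- The divisors give the zeros of g and the values of r there, hence g and r, hence the masses
inside the period by `chain_unique`. The trace then gives the masses at a. -/
theorem injOn_dirichletDivisors {ℓ a : ℝ} (hℓ : 0 < ℓ) {Δ : ℝ[X]} (hΔ : IsHillPoly Δ) :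
    Set.InjOn (dirichletDivisors ℓ a Δ) (Iso ℓ a Δ) := by
  intro p hp p' hp' he
  obtain ⟨L, h⟩ := exists_isoData hℓ hp
  obtain ⟨L', h'⟩ := exists_isoData hℓ hp'
  have hS := sinhSol_pos h.validChain.lt
  have hK : IsoData.eigenvalues a ℓ L = IsoData.eigenvalues a ℓ L' :=
    Finset.Subset.antisymm (fun κ hκ => (h.dirichletValue_eq hΔ h' he hκ).1)
      fun κ hκ => (h'.dirichletValue_eq hΔ h he.symm hκ).1
  have h1 : (chainNorm a L (a + ℓ)).1 = (chainNorm a L' (a + ℓ)).1 := by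
    rw [h.eq_unitPoly, h'.eq_unitPoly, hK]
  have hdeg : (chainNorm a L (a + ℓ)).1.degree = (IsoData.eigenvalues a ℓ L).card := by
    rw [degree_eq_natDegree h.isNormalizedPair.ne_zero, h.eq_unitPoly,
      natDegree_unitPoly h.zero_notMem]
  have h2 : (chainNorm a L (a + ℓ)).2 = (chainNorm a L' (a + ℓ)).2 := by
    refine eq_of_degrees_lt_of_eval_finset_eq (IsoData.eigenvalues a ℓ L) ?_ ?_ fun κ hκ => ?_
    · rw [← hdeg]; exact h.isNormalizedPair.degree_lt
    · rw [← hdeg, h1]; exact h'.isNormalizedPair.degree_lt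
    · have hκ0 : κ ≠ 0 := fun e => h.zero_notMem (e ▸ hκ)
      have := (h.dirichletValue_eq hΔ h' he hκ).2
      rw [dirichletValue, dirichletValue, div_left_inj' hS.ne'] at this
      exact mul_left_cancel₀ hκ0 this
  obtain rfl : L = L' := chain_unique h.validChain h'.validChain (Prod.ext h1 h2)
  have hs : (chainP a (0, 1) L (a + ℓ)).1 ≠ 0 := by
    rw [chainP_zero_one h.validChain]
    exact mul_ne_zero (C_ne_zero.2 hS.ne') h.isNormalizedPair.ne_zero
  -- With equal interior masses the two traces differ only in the term of the mass at a. Cancelling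
  -- s leaves w X + v X².
  have hq := h.trace.trans h'.trace.symm
  rw [chainTrace, chainTrace, sub_right_inj] at hq
  replace hq := mul_right_cancel₀ hs hq
  have hw : omegaMass p.1 a = omegaMass p'.1 a := by
    simpa [coeff_X, coeff_C_mul] using congrArg (fun P : ℝ[X] => P.coeff 1) hq
  have hv : upsilonMass p a = upsilonMass p' a := by
    simpa [coeff_X, coeff_C_mul] using congrArg (fun P : ℝ[X] => P.coeff 2) hq
  have hmass : ∀ x, omegaMass p.1 x = omegaMass p'.1 x ∧ upsilonMass p x = upsilonMass p' x := by
    intro x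
    have hmod : ∀ {f : ℝ → ℝ}, Function.Periodic f ℓ → f (toIcoMod hℓ a x) = f x := by
      intro f hf
      rw [toIcoMod, hf.sub_zsmul_eq]
    rw [← hmod h.memP.periodic_omegaMass, ← hmod h'.memP.periodic_omegaMass,
      ← hmod h.memP.periodic_upsilonMass, ← hmod h'.memP.periodic_upsilonMass]
    obtain ⟨hx1, hx2⟩ := toIcoMod_mem_Ico hℓ a x
    rcases hx1.eq_or_lt with hx | hx
    · rw [← hx]; exact ⟨hw, hv⟩
    · exact h.massList.eq_on h'.massList _ ⟨hx, hx2⟩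
  exact h.memP.eq_of_mass_eq hℓ h'.memP (fun x => (hmass x).1) fun x => (hmass x).2

/-! ### Surjectivity -/

theorem unitPoly_dvd {K : Finset ℝ} (h0 : (0 : ℝ) ∉ K) {A : ℝ[X]} (hA : ∀ κ ∈ K, A.eval κ = 0) :
    unitPoly K ∣ A := by
  have hdeg : (unitPoly K).degree = K.card := by
    rw [degree_eq_natDegree (unitPoly_ne_zero K), natDegree_unitPoly h0]
  refine EuclideanDomain.mod_eq_zero.1
    (eq_zero_of_degree_lt_of_eval_finset_eq_zero K ?_ fun κ hκ => ?_)
  · rw [← hdeg]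
    exact EuclideanDomain.mod_lt A (unitPoly_ne_zero K)
  · have h1 := congrArg (eval κ) (EuclideanDomain.div_add_mod A (unitPoly K))
    rw [eval_add, eval_mul, (eval_unitPoly_eq_zero_iff h0).2 hκ, hA κ hκ, zero_mul, zero_add] at h1
    exact h1

/-- The inverse spectral problem: the chain of point masses with prescribed Dirichlet eigenvalues,
values at the eigenvalues, and Floquet discriminant. -/
theorem exists_chain_of_eigenvalues {Δ : ℝ[X]} (hΔ : IsHillPoly Δ) {a b : ℝ} (hab : a < b)
    (hzero : Δ.eval 0 = Real.cosh ((b - a) / 2)) {K : Finset ℝ} (h0 : (0 : ℝ) ∉ K) {σ : ℝ → ℝ}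
    (hσ : ∀ κ ∈ K, (2 * Δ.eval κ - σ κ) * σ κ = 1)
    (hpar : ∀ κ ∈ K, (between Δ.roots.toFinset κ).card % 2 = ((between K κ).card + 1) % 2)
    (hpos : (Δ.roots.toFinset.filter (0 < ·)).card ≤ (K.filter (0 < ·)).card + 1)
    (hneg : (Δ.roots.toFinset.filter (· < 0)).card ≤ (K.filter (· < 0)).card + 1) :
    ∃ L w v, ValidChain a L b ∧ 0 ≤ v ∧ chainTrace a L b w v = C 2 * Δ ∧
      (chainNorm a L b).1 = unitPoly K ∧ ∀ κ ∈ K, dirichletValue a L b κ = σ κ := by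
  have hS := sinhSol_pos hab
  set g := unitPoly K with hg
  have hdeg : g.degree = K.card := by
    rw [degree_eq_natDegree (unitPoly_ne_zero K), natDegree_unitPoly h0]
  -- The nodal values are chosen to make `dirichletValue` equal to σ.
  set r : ℝ[X] := Lagrange.interpolate K id fun x => sinhSol a b * σ x / x with hr
  have hrK : ∀ κ ∈ K, r.eval κ = sinhSol a b * σ κ / κ := fun κ hκ =>
    Lagrange.eval_interpolate_at_node (v := id) _ (Set.injOn_id _) hκ
  -- Positivity of the residues: σ has the sign of Δ, and the parity hypothesis says that this is
  -- the sign of κ g'(κ).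
  have hN : IsNormalizedPair g r := by
    refine ⟨⟨fun z hz => aeval_unitPoly_im hz, fun x hx => ?_⟩, ?_, eval_zero_unitPoly K⟩
    · have hxK := (eval_unitPoly_eq_zero_iff h0).1 hx
      have hx0 : x ≠ 0 := fun e => h0 (e ▸ hxK)
      obtain ⟨h1, h2, -⟩ := one_le_abs_of_mul_eq_one (hσ x hxK)
      have hΔx : Δ.eval x ≠ 0 := fun e => by simp [e] at h2
      have h3 := (hΔ.sign_iff_parity h0 hxK hΔx).2 (hpar x hxK)
      have h4 := mul_pos h3 h2
      have e1 : x * (unitPoly K).derivative.eval x * Δ.eval x * (Δ.eval x * σ x) =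
          (x * g.derivative.eval x * σ x) * Δ.eval x ^ 2 := by rw [hg]; ring
      rw [e1] at h4
      have h5 : 0 < x * g.derivative.eval x * σ x := pos_of_mul_pos_left h4 (sq_nonneg _)
      rw [hrK x hxK]
      have e2 : g.derivative.eval x * (sinhSol a b * σ x / x) =
          sinhSol a b * (x * g.derivative.eval x * σ x) / x ^ 2 := by field_simp
      rw [e2]
      positivity
    · rw [hdeg]
      exact Lagrange.degree_interpolate_lt _ (Set.injOn_id _)
  obtain ⟨L, hV, hL⟩ := exists_chain hN hab
  have hL1 : (chainNorm a L b).1 = g := by rw [hL]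
  have hval : ∀ κ ∈ K, dirichletValue a L b κ = σ κ := fun κ hκ => by
    have hκ0 : κ ≠ 0 := fun e => h0 (e ▸ hκ)
    rw [dirichletValue, hL]
    dsimp only
    rw [hrK κ hκ]
    field_simp
  have hs1 : (chainP a (0, 1) L b).1 = C (sinhSol a b) * g := by
    rw [chainP_zero_one hV, hL]; rfl
  have hc := (chainP_natDegree_le (F := (1, 0)) (by simp) (by simp) hV).1
  have hs := (chainP_natDegree_le (F := (0, 1)) (by simp) (by simp) hV).2
  rw [hL1, hg, natDegree_unitPoly h0] at hc hs
  set B := (chainP a (1, 0) L b).1 + (chainP a (0, 1) L b).2 with hB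
  have hBd : B.natDegree ≤ K.card := (natDegree_add_le _ _).trans (max_le hc hs)
  -- At a zero of g, s' = σ by construction and c σ = 1 by the Wronskian, so c = 2Δ - σ and the
  -- trace is correct there without any mass at a.
  obtain ⟨q, hq⟩ := unitPoly_dvd h0 (A := B - C 2 * Δ) fun κ hκ => by
    have hκ' : (chainNorm a L b).1.eval κ = 0 := by
      rw [hL1]; exact (eval_unitPoly_eq_zero_iff h0).2 hκ
    have h1 := chainP_one_zero_mul hV hκ'
    have h2 := (eval_chainP_zero_one hV κ).2
    rw [hκ', mul_zero, zero_add] at h2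
    rw [hval κ hκ] at h1 h2
    have hσ0 : σ κ ≠ 0 := fun e => by simp [e] at h1
    have h3 : (chainP a (1, 0) L b).1.eval κ = 2 * Δ.eval κ - σ κ :=
      mul_right_cancel₀ hσ0 (h1.trans (hσ κ hκ).symm)
    simp only [hB, eval_sub, eval_add, eval_mul, eval_C, h2, h3]
    ring
  rw [← hg] at hq
  -- At z = 0 both polynomials equal 2 cosh((b - a)/2); this is where the normalization of Δ(0)
  -- enters.
  have hq0 : q.coeff 0 = 0 := by
    have h1 := congrArg (eval 0) hq
    have h2 := (chainP_eval_zero a (1, 0) L b).1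
    have h3 := (chainP_eval_zero a (0, 1) L b).2
    simp only [transP, eval_add, eval_mul, eval_C, eval_one, eval_zero] at h2 h3
    simp only [hB, eval_sub, eval_add, eval_mul, eval_C, h2, h3, hzero, hg, eval_zero_unitPoly] at h1
    rw [coeff_zero_eq_eval_zero]
    linarith
  have hR := card_filter_pos_add_card_filter_neg hΔ.zero_notMem
  have hKc := card_filter_pos_add_card_filter_neg h0
  rw [hΔ.card_roots] at hR
  have hAd : (B - C 2 * Δ).natDegree ≤ K.card + 2 := by
    refine (natDegree_sub_le _ _).trans (max_le (by omega) ?_)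
    have := natDegree_C_mul_le 2 Δ
    omega
  have hqd : q.natDegree ≤ 2 := by
    by_cases hq' : q = 0
    · simp [hq']
    · rw [hq, natDegree_mul (unitPoly_ne_zero K) hq', natDegree_unitPoly h0] at hAd
      omega
  have hqe : q = C (q.coeff 1) * X + C (q.coeff 2) * X ^ 2 := by
    ext n
    rcases n with _ | _ | _ | n
    · simp [hq0]
    · simp
    · simp
    · rw [coeff_eq_zero_of_natDegree_lt (by omega)]
      simp
  refine ⟨L, q.coeff 1 / sinhSol a b, q.coeff 2 / sinhSol a b, hV, ?_, ?_, hL1, hval⟩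
  -- A negative coefficient would force deg Δ = |K| + 2, so Δ has exactly one extra zero on each
  -- side of 0. The leading coefficients of Δ and g then have opposite signs, which makes the
  -- coefficient positive.
  · refine div_nonneg ?_ hS.le
    by_contra hlt
    have hgl : g.leadingCoeff ≠ 0 := leadingCoeff_ne_zero.2 (unitPoly_ne_zero K)
    have hcoeff : g.leadingCoeff * q.coeff 2 = -(2 * Δ.coeff (K.card + 2)) := by
      have h1 := congrArg (fun P : ℝ[X] => P.coeff (K.card + 2)) hq
      simp only [coeff_sub, coeff_C_mul] at h1
      rw [coeff_eq_zero_of_natDegree_lt (by omega : B.natDegree < K.card + 2),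
        coeff_mul_add_eq_of_natDegree_le (natDegree_unitPoly h0).le hqd] at h1
      rw [leadingCoeff, natDegree_unitPoly h0]
      linarith
    have hne : Δ.coeff (K.card + 2) ≠ 0 := fun e => by
      rw [e, mul_zero, neg_zero, mul_eq_zero, or_iff_right hgl] at hcoeff
      exact hlt hcoeff.ge
    have hdegΔ : Δ.natDegree = K.card + 2 :=
      le_antisymm (by omega) (le_natDegree_of_ne_zero hne)
    have hcard : (Δ.roots.toFinset.filter (0 < ·)).card = (K.filter (0 < ·)).card + 1 := by omega
    have h1 := hΔ.sign_leadingCoeff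
    have h2 := sign_leadingCoeff_unitPoly h0
    rw [← hdegΔ, coeff_natDegree] at hcoeff
    rw [hcard, pow_succ] at h1
    have h3 := mul_pos h1 h2
    have e : (-1) ^ (K.filter (0 < ·)).card * -1 * Δ.leadingCoeff *
        ((-1) ^ (K.filter (0 < ·)).card * (unitPoly K).leadingCoeff) =
        -(Δ.leadingCoeff * g.leadingCoeff) := by
      have : ((-1 : ℝ) ^ (K.filter (0 < ·)).card) ^ 2 = 1 := by
        rw [← pow_mul, mul_comm, pow_mul]; simp
      rw [hg]
      linear_combination -(Δ.leadingCoeff * (unitPoly K).leadingCoeff) * this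
    rw [e] at h3
    have h4 : g.leadingCoeff ^ 2 * q.coeff 2 = -(Δ.leadingCoeff * g.leadingCoeff) * 2 := by
      linear_combination g.leadingCoeff * hcoeff
    have h5 : 0 < g.leadingCoeff ^ 2 := by positivity
    nlinarith
  · have e : (C (q.coeff 1 / sinhSol a b) * X + C (q.coeff 2 / sinhSol a b) * X ^ 2) *
        (C (sinhSol a b) * g) = g * q := by
      have e1 : ∀ t : ℝ, C t = C (t / sinhSol a b) * C (sinhSol a b) := fun t => by
        rw [← C_mul, div_mul_cancel₀ _ hS.ne']
      conv_rhs => rw [hqe, e1 (q.coeff 1), e1 (q.coeff 2)]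
      ring
    rw [chainTrace, ← hB, hs1, e, ← hq]
    ring

section

variable {Δ : ℝ[X]}

theorem exists_coe_of_mem_torus {τ : GapIndex Δ → EReal × ℝ} (hτ : τ ∈ torus Δ) (i : GapIndex Δ) :
    (∃ x : ℝ, (τ i).1 = x) ∨ ((i.1 = numPos Δ ∨ i.1 = -(numNeg Δ : ℤ)) ∧
      τ i = (if i.1 < 0 then ⊥ else ⊤, 0)) := by
  have hi := hτ i (Set.mem_univ i)
  obtain ⟨h0, h1, h2⟩ := i.2
  have hm := hi.1
  have hz := hi.2
  induction h : (τ i).1 with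
  | bot =>
    rw [h] at hm hz
    rw [IsHillPoly.bot_mem_gap_iff] at hm
    refine Or.inr ⟨Or.inr hm, Prod.ext ?_ ?_⟩
    · rw [h, if_pos (by omega)]
    · simpa [evalExt] using hz
  | top =>
    rw [h] at hm hz
    rw [IsHillPoly.top_mem_gap_iff] at hm
    refine Or.inr ⟨Or.inl hm, Prod.ext ?_ ?_⟩
    · rw [h, if_neg (by omega)]
    · simpa [evalExt] using hz
  | coe x => exact Or.inl ⟨x, rfl⟩

/-- The number of zeros of Δ between 0 and x is monotone away from 0, so the gaps are ordered like
their indices. -/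
theorem IsHillPoly.lt_of_mem_gap (hΔ : IsHillPoly Δ) {i j : GapIndex Δ} {x y : ℝ}
    (hx : (x : EReal) ∈ gap Δ i) (hy : (y : EReal) ∈ gap Δ j) (hij : i.1 < j.1) : x < y := by
  rw [hΔ.coe_mem_gap_iff] at hx hy
  have hsx : 0 < x ∧ 0 < i.1 ∨ x < 0 ∧ i.1 < 0 := by
    rcases pos_and_pos_or_neg_and_neg_of_mul_pos hx.1 with h | h
    · exact Or.inl ⟨h.1, by exact_mod_cast h.2⟩
    · exact Or.inr ⟨h.1, by exact_mod_cast h.2⟩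
  have hsy : 0 < y ∧ 0 < j.1 ∨ y < 0 ∧ j.1 < 0 := by
    rcases pos_and_pos_or_neg_and_neg_of_mul_pos hy.1 with h | h
    · exact Or.inl ⟨h.1, by exact_mod_cast h.2⟩
    · exact Or.inr ⟨h.1, by exact_mod_cast h.2⟩
  have h1 := hx.2.1
  have h2 := hy.2.1
  by_contra hcon
  rw [not_lt] at hcon
  rcases hsx with hsx | hsx <;> rcases hsy with hsy | hsy
  · have := between_mono Δ.roots.toFinset hsy.1 hcon
    omega
  · omega
  · linarith
  · have := between_mono (Δ.roots.toFinset.image (-·)) (neg_pos.2 hsx.1) (neg_le_neg hcon)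
    rw [card_between_image_neg, card_between_image_neg] at this
    omega

theorem IsHillPoly.gap_index_unique (hΔ : IsHillPoly Δ) {i j : GapIndex Δ} {x : ℝ}
    (hx : (x : EReal) ∈ gap Δ i) (hy : (x : EReal) ∈ gap Δ j) : i = j := by
  rcases lt_trichotomy i.1 j.1 with h | h | h
  · exact absurd (hΔ.lt_of_mem_gap hx hy h) (lt_irrefl x)
  · exact Subtype.ext h
  · exact absurd (hΔ.lt_of_mem_gap hy hx h) (lt_irrefl x)

theorem finite_gapIndex (Δ : ℝ[X]) : Finite (GapIndex Δ) :=
  ((Set.finite_Icc (-(numNeg Δ : ℤ)) (numPos Δ)).subset fun _ h => h.2).to_subtype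

/-- The finite points of a point of the torus. -/
theorem exists_finite_points (hΔ : IsHillPoly Δ) {τ : GapIndex Δ → EReal × ℝ} (hτ : τ ∈ torus Δ) :
    ∃ (K : Finset ℝ) (ζ : ℝ → ℝ), (0 : ℝ) ∉ K ∧
      (∀ κ ∈ K, ∃ i, τ i = ((κ : EReal), ζ κ) ∧ (between K κ).card + 1 = i.1.natAbs) ∧
      ∀ i (x : ℝ), (τ i).1 = x → x ∈ K := by
  classical
  have := finite_gapIndex Δ
  have := Fintype.ofFinite (GapIndex Δ)
  set F : Finset (GapIndex Δ) := Finset.univ.filter fun i => ∃ x : ℝ, (τ i).1 = x with hF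
  set K : Finset ℝ := F.image fun i => (τ i).1.toReal with hK
  have hFi : ∀ i ∈ F, (τ i).1 = ((τ i).1.toReal : EReal) := by
    intro i hi
    obtain ⟨x, hx⟩ := (Finset.mem_filter.1 hi).2
    rw [hx, EReal.toReal_coe]
  have hgap : ∀ i ∈ F, (((τ i).1.toReal : ℝ) : EReal) ∈ gap Δ i := fun i hi => by
    rw [← hFi i hi]; exact (hτ i (Set.mem_univ i)).1
  have hex : ∀ κ, κ ∈ K → ∃ i ∈ F, (τ i).1.toReal = κ := fun κ hκ => Finset.mem_image.1 hκ
  have hlt : ∀ i ∈ F, ∀ j ∈ F, ((τ i).1.toReal < (τ j).1.toReal ↔ i.1 < j.1) := by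
    intro i hi j hj
    refine ⟨fun h => ?_, hΔ.lt_of_mem_gap (hgap i hi) (hgap j hj)⟩
    by_contra hcon
    rcases (not_lt.1 hcon).eq_or_lt with h1 | h1
    · rw [Subtype.ext h1] at h
      exact lt_irrefl _ h
    · exact lt_asymm h (hΔ.lt_of_mem_gap (hgap j hj) (hgap i hi) h1)
  have hsign : ∀ i ∈ F, (0 < (τ i).1.toReal ↔ 0 < i.1) ∧ ((τ i).1.toReal < 0 ↔ i.1 < 0) := by
    intro i hi
    have h := ((hΔ.coe_mem_gap_iff _ _).1 (hgap i hi)).1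
    rcases pos_and_pos_or_neg_and_neg_of_mul_pos h with h | h
    · have h2 : 0 < i.1 := by exact_mod_cast h.2
      exact ⟨iff_of_true h.1 h2, iff_of_false h.1.not_gt h2.not_gt⟩
    · have h2 : i.1 < 0 := by exact_mod_cast h.2
      exact ⟨iff_of_false h.1.not_gt h2.not_gt, iff_of_true h.1 h2⟩
  have hinj : Set.InjOn (fun i => (τ i).1.toReal) (F : Set (GapIndex Δ)) := by
    intro i hi j hj he
    refine Subtype.ext (le_antisymm ?_ ?_)
    · exact not_lt.1 fun h => ((hlt j hj i hi).2 h).ne he.symm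
    · exact not_lt.1 fun h => ((hlt i hi j hj).2 h).ne he
  have hcard : ∀ i ∈ F, (between K (τ i).1.toReal).card + 1 = i.1.natAbs := by
    intro i hi
    -- The indices strictly between 0 and i. None is extreme, so each carries a finite point, and
    -- there are |i| - 1 of them.
    set G : Finset (GapIndex Δ) :=
      Finset.univ.filter fun j => (0 < j.1 ∧ j.1 < i.1) ∨ (i.1 < j.1 ∧ j.1 < 0) with hG
    have hGF : ∀ j ∈ G, j ∈ F := by
      intro j hj
      have hj' := (Finset.mem_filter.1 hj).2
      obtain ⟨-, h1, h2⟩ := i.2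
      refine Finset.mem_filter.2 ⟨Finset.mem_univ j, ?_⟩
      rcases exists_coe_of_mem_torus hτ j with h | h
      · exact h
      · omega
    have e1 : between K (τ i).1.toReal = G.image fun j => (τ j).1.toReal := by
      ext x
      simp only [between, hK, Finset.mem_filter, Finset.mem_image]
      constructor
      · rintro ⟨⟨j, hj, rfl⟩, h⟩
        refine ⟨j, Finset.mem_filter.2 ⟨Finset.mem_univ j, ?_⟩, rfl⟩
        rwa [(hsign j hj).1, (hsign j hj).2, hlt j hj i hi, hlt i hi j hj] at h
      · rintro ⟨j, hj, rfl⟩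
        refine ⟨⟨j, hGF j hj, rfl⟩, ?_⟩
        rw [(hsign j (hGF j hj)).1, (hsign j (hGF j hj)).2, hlt j (hGF j hj) i hi,
          hlt i hi j (hGF j hj)]
        exact (Finset.mem_filter.1 hj).2
    have e2 : G.map (Function.Embedding.subtype _) =
        if 0 < i.1 then Finset.Ioo 0 i.1 else Finset.Ioo i.1 0 := by
      obtain ⟨h0, h1, h2⟩ := i.2
      ext k
      simp only [Finset.mem_map, hG, Finset.mem_filter, Finset.mem_univ, true_and,
        Function.Embedding.subtype_apply]
      constructor
      · rintro ⟨j, hj, rfl⟩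
        split_ifs <;> rw [Finset.mem_Ioo] <;> omega
      · intro hk
        have hk' : (0 < k ∧ k < i.1) ∨ (i.1 < k ∧ k < 0) := by
          split_ifs at hk <;> rw [Finset.mem_Ioo] at hk <;> tauto
        exact ⟨⟨k, by omega, by omega, by omega⟩, hk', rfl⟩
    have h0 := i.2.1
    rw [e1, Finset.card_image_of_injOn (hinj.mono hGF), ← Finset.card_map, e2]
    split_ifs <;> simp <;> omega
  have hζ : ∀ i ∈ F, ∃ y, ∀ j ∈ F, (τ j).1.toReal = (τ i).1.toReal → y = (τ j).2 :=
    fun i hi => ⟨(τ i).2, fun j hj he => by rw [hinj hj hi he]⟩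
  have hζ' : ∀ κ, ∃ y, ∀ j ∈ F, (τ j).1.toReal = κ → y = (τ j).2 := by
    intro κ
    by_cases h : ∃ i ∈ F, (τ i).1.toReal = κ
    · obtain ⟨i, hi, rfl⟩ := h
      exact hζ i hi
    · exact ⟨0, fun j hj he => absurd ⟨j, hj, he⟩ h⟩
  choose ζ hζ'' using hζ'
  refine ⟨K, ζ, fun h => ?_, fun κ hκ => ?_, fun i x hx => ?_⟩
  · obtain ⟨i, hi, he⟩ := hex 0 h
    have := (hsign i hi)
    have h0 := i.2.1
    rw [he] at this
    simp only [lt_irrefl, false_iff] at this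
    omega
  · obtain ⟨i, hi, rfl⟩ := hex κ hκ
    exact ⟨i, Prod.ext (hFi i hi) (hζ'' _ i hi rfl).symm, hcard i hi⟩
  · refine Finset.mem_image.2 ⟨i, Finset.mem_filter.2 ⟨Finset.mem_univ i, x, hx⟩, ?_⟩
    rw [hx, EReal.toReal_coe]

/-- At most the outermost point on either side is infinite. -/
theorem card_filter_le_of_mem_torus (hΔ : IsHillPoly Δ) {τ : GapIndex Δ → EReal × ℝ}
    (hτ : τ ∈ torus Δ) {K : Finset ℝ} {ζ : ℝ → ℝ}
    (hK : ∀ κ ∈ K, ∃ i, τ i = ((κ : EReal), ζ κ) ∧ (between K κ).card + 1 = i.1.natAbs)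
    (hx : ∀ i (x : ℝ), (τ i).1 = x → x ∈ K) :
    (Δ.roots.toFinset.filter (0 < ·)).card ≤ (K.filter (0 < ·)).card + 1 ∧
      (Δ.roots.toFinset.filter (· < 0)).card ≤ (K.filter (· < 0)).card + 1 := by
  have key : ∀ i : GapIndex Δ, i.1 ≠ numPos Δ → i.1 ≠ -(numNeg Δ : ℤ) →
      ∃ κ ∈ K, 0 < κ * i.1 ∧ (between K κ).card + 1 = i.1.natAbs := by
    intro i h1 h2
    rcases exists_coe_of_mem_torus hτ i with ⟨x, hxi⟩ | h
    · have hxK := hx i x hxi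
      obtain ⟨j, hj, hc⟩ := hK x hxK
      have hgi : (x : EReal) ∈ gap Δ i := hxi ▸ (hτ i (Set.mem_univ i)).1
      have hgj : (x : EReal) ∈ gap Δ j := by
        have := (hτ j (Set.mem_univ j)).1
        rwa [hj] at this
      obtain rfl := hΔ.gap_index_unique hgi hgj
      exact ⟨x, hxK, ((hΔ.coe_mem_gap_iff _ _).1 hgi).1, hc⟩
    · exact absurd h.1 (by tauto)
  rw [← hΔ.numPos_eq_card, ← hΔ.numNeg_eq_card]
  constructor
  · by_contra hcon
    -- If the bound failed, I₊ would be at least 2, so I₊ - 1 is an index that is not extreme. Its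
    -- finite point with those between it and 0 gives I₊ - 1 positive elements of `K`, a
    -- contradiction.
    obtain ⟨κ, hκ, hs, hc⟩ := key ⟨numPos Δ - 1, by omega, by omega, by omega⟩
      (by simp) (by dsimp only; omega)
    dsimp only at hs hc
    have hi : (0 : ℝ) < ((numPos Δ - 1 : ℤ) : ℝ) := by
      exact_mod_cast (by omega : (0 : ℤ) < numPos Δ - 1)
    have hκ0 : 0 < κ := by
      by_contra hneg
      nlinarith
    have hsub : insert κ (between K κ) ⊆ K.filter (0 < ·) := by
      intro t ht
      rw [Finset.mem_insert, between, Finset.mem_filter] at ht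
      rw [Finset.mem_filter]
      rcases ht with rfl | ⟨ht, h | h⟩
      · exact ⟨hκ, hκ0⟩
      · exact ⟨ht, h.1⟩
      · linarith
    have := Finset.card_le_card hsub
    rw [Finset.card_insert_of_notMem (by simp [between])] at this
    omega
  · by_contra hcon
    obtain ⟨κ, hκ, hs, hc⟩ := key ⟨-(numNeg Δ - 1 : ℤ), by omega, by omega, by omega⟩
      (by dsimp only; omega) (by dsimp only; omega)
    dsimp only at hs hc
    have hi : ((-(numNeg Δ - 1 : ℤ) : ℤ) : ℝ) < 0 := by
      exact_mod_cast (by omega : (-(numNeg Δ - 1) : ℤ) < 0)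
    have hκ0 : κ < 0 := by
      by_contra hneg
      nlinarith
    have hsub : insert κ (between K κ) ⊆ K.filter (· < 0) := by
      intro t ht
      rw [Finset.mem_insert, between, Finset.mem_filter] at ht
      rw [Finset.mem_filter]
      rcases ht with rfl | ⟨ht, h | h⟩
      · exact ⟨hκ, hκ0⟩
      · linarith
      · exact ⟨ht, h.2⟩
    have := Finset.card_le_card hsub
    rw [Finset.card_insert_of_notMem (by simp [between])] at this
    omega

theorem surjOn_dirichletDivisors {ℓ a : ℝ} (hℓ : 0 < ℓ) (hΔ : IsHillPoly Δ)
    (hzero : Δ.eval 0 = Real.cosh (ℓ / 2)) :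
    Set.SurjOn (dirichletDivisors ℓ a Δ) (Iso ℓ a Δ) (torus Δ) := by
  intro τ hτ
  obtain ⟨K, ζ, h0, hK, hx⟩ := exists_finite_points hΔ hτ
  have hgap : ∀ {κ : ℝ} {i : GapIndex Δ}, τ i = ((κ : EReal), ζ κ) →
      (κ : EReal) ∈ gap Δ i ∧ ζ κ ^ 2 = Δ.eval κ ^ 2 - 1 := by
    intro κ i hi
    have := hτ i (Set.mem_univ i)
    rw [hi] at this
    exact ⟨this.1, by simpa [evalExt] using this.2⟩
  obtain ⟨hpos, hneg⟩ := card_filter_le_of_mem_torus hΔ hτ hK hx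
  -- The choice σ = Δ - ζ turns ζ² = Δ² - 1 into (2Δ - σ) σ = 1. The parity holds because |i| zeros
  -- of Δ and |i| - 1 points of `K` lie between 0 and κ.
  obtain ⟨L, w, v, hV, hv, htr, hg, hval⟩ := exists_chain_of_eigenvalues hΔ
    (by linarith : a < a + ℓ) (by rw [hzero, add_sub_cancel_left]) h0
    (σ := fun κ => Δ.eval κ - ζ κ) (fun κ hκ => by
      obtain ⟨i, hi, -⟩ := hK κ hκ
      linear_combination -(hgap hi).2) (fun κ hκ => by
      obtain ⟨i, hi, hc⟩ := hK κ hκ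
      rw [hc, ((hΔ.coe_mem_gap_iff _ _).1 (hgap hi).1).2.1]) hpos hneg
  obtain ⟨p, hp, hL, hpw, hpv⟩ := exists_memP_of_validChain hℓ hV w hv
  have h : IsoData ℓ a Δ p L := ⟨hp, hL, by rw [hpw, hpv, htr]⟩
  have hE : ∀ x, x ∈ IsoData.eigenvalues a ℓ L ↔ x ∈ K := fun x => by
    rw [h.mem_eigenvalues, hg, eval_unitPoly_eq_zero_iff h0]
  refine ⟨p, (mem_iso_iff hp hL).2 h.trace, funext fun i => ?_⟩
  rcases exists_coe_of_mem_torus hτ i with ⟨x, hxi⟩ | ⟨-, hi⟩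
  · have hxK := hx i x hxi
    obtain ⟨j, hj, -⟩ := hK x hxK
    have hgi : (x : EReal) ∈ gap Δ i := hxi ▸ (hτ i (Set.mem_univ i)).1
    obtain rfl := hΔ.gap_index_unique hgi (hgap hj).1
    rw [h.dirichletDivisors_eq hΔ ((hE x).2 hxK) hgi, hval x hxK, hj, sub_sub_cancel]
  · rw [h.dirichletDivisors_eq_of_forall_notMem, hi]
    intro κ hκ hκi
    obtain ⟨j, hj, -⟩ := hK κ ((hE κ).1 hκ)
    obtain rfl := hΔ.gap_index_unique hκi (hgap hj).1
    rw [hj, Prod.mk.injEq] at hi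
    have h2 := hi.1
    split_ifs at h2
    · exact absurd h2 (EReal.coe_ne_bot κ)
    · exact absurd h2 (EReal.coe_ne_top κ)

end

/-! ### Conclusion -/

theorem isHillPoly_of_roots {ℓ : ℝ} (hℓ : 0 < ℓ) {Δ : ℝ[X]}
    (hroots : ∀ z : ℂ, aeval z Δ = 0 → z.im = 0 ∧ z ≠ 0 ∧ aeval z (derivative Δ) ≠ 0)
    (hzero : Δ.eval 0 = Real.cosh (ℓ / 2))
    (hcrit : ∀ x : ℝ, (derivative Δ).eval x = 0 → 1 ≤ |Δ.eval x|) : IsHillPoly Δ where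
  im_eq_zero z hz := (hroots z hz).1
  simple x hx h := (hroots x (by rw [aeval_ofReal, hx, Complex.ofReal_zero])).2.2
    (by rw [aeval_ofReal, h, Complex.ofReal_zero])
  one_lt := by
    rw [hzero, Real.one_lt_cosh]
    exact (half_pos hℓ).ne'
  crit := hcrit

end PeriodicPeakon

end

open PeriodicPeakon in
theorem mainTheorem3 (ℓ a : ℝ) (hℓ : 0 < ℓ) (Δ : Polynomial ℝ)
    (hroots : ∀ z : ℂ, Polynomial.aeval z Δ = 0 →
      z.im = 0 ∧ z ≠ 0 ∧ Polynomial.aeval z (Polynomial.derivative Δ) ≠ 0)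
    (hzero : Δ.eval 0 = Real.cosh (ℓ / 2))
    (hcrit : ∀ x : ℝ, (Polynomial.derivative Δ).eval x = 0 → 1 ≤ |Δ.eval x|) :
    Set.BijOn (dirichletDivisors ℓ a Δ) (Iso ℓ a Δ) (torus Δ) := by
  have hΔ := isHillPoly_of_roots hℓ hroots hzero hcrit
  refine ⟨fun p hp => ?_, injOn_dirichletDivisors hℓ hΔ, surjOn_dirichletDivisors hℓ hΔ hzero⟩
  obtain ⟨L, h⟩ := exists_isoData hℓ hp
  exact h.dirichletDivisors_mem_torus hΔ
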